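/- **Theorem (numerical precession of the implicit midpoint rule).** Consider the Kepler problem $\ddot x = f(x) := -x/|x|^3$ in $\mathbb{R}^2\setminus\{0\}$, with Lagrangian $\mathcal L(x,\dot x) = \frac12|\dot x|^2 + \frac1{|x|}$, and let $\gamma$ be a solution whose orbit is an ellipse with one focus at the origin, with semimajor axis $a$ and semiminor axis $b$, $0<b<a$. Let $T$ be its period and $\mathbb L = x_1\dot x_2-\dot x_1x_2$ its angular momentum. Consider two methods with step size $h$, each with its modified Lagrangian of second order accuracy: * the implicit midpoint rule $\frac{x_{k+1}-2x_k+x_{k-1}}{h^2} = \frac12 f\big(\frac{x_k+x_{k+1}}2\big)+\frac12 f\big(\frac{x_{k-1}+x_k}2\big)$, with $$\mathcal L^{MP}_h = \frac12|\dot x|^2+\frac1{|x|}+\frac{h^2}{24}\Big(\frac1{|x|^4}+\frac{|\dot x|^2}{|x|^3}-3\frac{\langle x,\dot x\rangle^2}{|x|^5}\Big);$$ * the Störmer–Verlet method $\frac{x_{k+1}-2x_k+x_{k-1}}{h^2}=f(x_k)$, with $$\mathcal L^{SV}_h = \frac12|\dot x|^2+\frac1{|x|}+\frac{h^2}{24}\Big(\frac1{|x|^4}-2\frac{|\dot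 x|^2}{|x|^3}+6\frac{\langle x,\dot x\rangle^2}{|x|^5}\Big).$$ For a curve $x$, let $\Delta\omega$ be the change from time $0$ to time $T$ (the period of the unperturbed orbit) of the continuously followed angle of the Laplace–Runge–Lenz vector $|\dot x|^2x-\langle x,\dot x\rangle\dot x-x/|x|$. We say that a method has numerical precession rate $\rho h^2+O(h^4)$, in terms of its modified Lagrangian $\mathcal L_h$, if the following two conditions hold. 1. *The Euler–Lagrange equation of $\mathcal L_h$ describes the numerical solutions up to $O(h^4)$.* For every $K>0$ there are $C,h_0>0$ such that for $0<h<h_0$ and every $x_1$ with $|x_1-\gamma(h)|\le Kh^3$, a numerical solution $x_0=\gamma(0),x_1,x_2,\dots$ up to time $T$ exists, and each such numerical solution satisfies $|x_k-X(kh)|\le Ch^4$ for $0\le kh\le T$, for some solution $X$ on $[0,T]$ of the Euler–Lagrange equation of $\mathcal L_h$ with $|X(0)-\gamma(0)|\le Ch^2$ and $|\dot X(0)-\dot\gamma(0)|\le Ch^2$. (Numerical solutions are taken with $|x_{k+1}-x_k|\le\frac12|x_k|$, which excludes spurious solutions of the implicit equation whose midpoint nearly hits the origin.) 2. *Precession rate.*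 For every $K>0$ there are $C,h_0>0$ such that for $0<h<h_0$ and all $(y,w)$ with $|y-\gamma(0)|\le Kh^2$ and $|w-\dot\gamma(0)|\le Kh^2$, the Euler–Lagrange equation of $\mathcal L_h$ has a solution on $[0,T]$ with initial position $y$ and initial velocity $w$, and along every such solution the Laplace–Runge–Lenz vector does not vanish and $|\Delta\omega-\rho h^2|\le Ch^4$. Then the implicit midpoint rule has numerical precession rate $$\operatorname{sgn}(\mathbb L)\,\frac{\pi}{12}\Big(15\frac{a^3}{b^6}-3\frac a{b^4}\Big)h^2+O(h^4),$$ and its coefficient of $h^2$ is exactly $-2$ times the coefficient $\rho_{SV}$ in the numerical precession rate $\rho_{SV}h^2+O(h^4)$ of the Störmer–Verlet method. -/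

import Mathlib

noncomputable section

namespace Kepler

open Set

/-- The Euclidean plane. -/
abbrev Plane := EuclideanSpace ℝ (Fin 2)

/-! ### Lagrangian mechanics in the punctured plane -/

/-- `(X, V)` is a motion on the time set `J` of the Lagrangian `L(x, ẋ)`, in the plane without the
origin: `Ẋ = V`, and the Euler-Lagrange equation `d/dt (∂L/∂ẋ) = ∂L/∂x` holds. -/
def IsMotion (L : Plane → Plane → ℝ) (J : Set ℝ) (X V : ℝ → Plane) : Prop :=
  ∀ t ∈ J, X t ≠ 0 ∧ HasDerivWithinAt X (V t) J t ∧
    HasDerivWithinAt (fun s => gradient (fun w => L (X s) w) (V s))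
      (gradient (fun y => L y (V t)) (X t)) J t

/-- The Lagrangian of the Kepler problem. -/
def lagrangian (x v : Plane) : ℝ := ‖v‖ ^ 2 / 2 + 1 / ‖x‖

/-- The modified Lagrangian, of second order accuracy, of the implicit midpoint rule. -/
def midpointLagrangian (h : ℝ) (x v : Plane) : ℝ :=
  ‖v‖ ^ 2 / 2 + 1 / ‖x‖ + h ^ 2 / 24 *
    (1 / ‖x‖ ^ 4 + ‖v‖ ^ 2 / ‖x‖ ^ 3 - 3 * inner ℝ x v ^ 2 / ‖x‖ ^ 5)

/-- The modified Lagrangian, of second order accuracy, of the Störmer-Verlet method. -/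
def verletLagrangian (h : ℝ) (x v : Plane) : ℝ :=
  ‖v‖ ^ 2 / 2 + 1 / ‖x‖ + h ^ 2 / 24 *
    (1 / ‖x‖ ^ 4 - 2 * (‖v‖ ^ 2 / ‖x‖ ^ 3) + 6 * inner ℝ x v ^ 2 / ‖x‖ ^ 5)

/-- The angular momentum `x₁ ẋ₂ - ẋ₁ x₂`. -/
def angularMomentum (x v : Plane) : ℝ := x 0 * v 1 - v 0 * x 1

/-- The Laplace-Runge-Lenz vector `|ẋ|² x - ⟨x, ẋ⟩ ẋ - x / |x|`. -/
def lrl (x v : Plane) : Plane := ‖v‖ ^ 2 • x - inner ℝ x v • v - ‖x‖⁻¹ • x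

/-! ### Orbits -/

/-- `S` is the ellipse with foci `F₁`, `F₂`, semimajor axis `a` and semiminor axis `b`. -/
def IsEllipse (S : Set Plane) (F₁ F₂ : Plane) (a b : ℝ) : Prop :=
  0 < a ∧ 0 < b ∧ (dist F₁ F₂ / 2) ^ 2 + b ^ 2 = a ^ 2 ∧
    S = {p | dist p F₁ + dist p F₂ = 2 * a}

/-- `T` is the (smallest positive) period of `γ`. -/
def IsPeriod (γ : ℝ → Plane) (T : ℝ) : Prop :=
  IsLeast {t | 0 < t ∧ Function.Periodic γ t} T

/-- The vector `Z t` does not vanish for `0 ≤ t ≤ T`, and its angle with the first coordinate axis,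
followed continuously, changes by `Δ` from time `0` to time `T`. -/
def HasAngleChange (Z : ℝ → Plane) (T Δ : ℝ) : Prop :=
  ∃ ω : ℝ → ℝ, ContinuousOn ω (Icc 0 T) ∧ ω T - ω 0 = Δ ∧
    ∀ t ∈ Icc 0 T, Z t ≠ 0 ∧ Z t = ‖Z t‖ • !₂[Real.cos (ω t), Real.sin (ω t)]

/-! ### The numerical methods -/

/-- The force `f(x) = - x / |x|³`. -/
def force (x : Plane) : Plane := -((‖x‖ ^ 3)⁻¹ • x)

/-- Right hand side of the midpoint rule, as a function of `x_{k-1}`, `x_k`, `x_{k+1}`. -/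
def midpointForce (xm x xp : Plane) : Plane :=
  (1 / 2 : ℝ) • force ((1 / 2 : ℝ) • (x + xp)) + (1 / 2 : ℝ) • force ((1 / 2 : ℝ) • (xm + x))

/-- Right hand side of the Störmer-Verlet method, as a function of `x_{k-1}`, `x_k`, `x_{k+1}`. -/
def verletForce (_ x _ : Plane) : Plane := force x

/-- `x₀, x₁, …` is a numerical solution with step size `h`, up to time `T`, of the method
`(x_{k+1} - 2 x_k + x_{k-1}) / h² = Φ (x_{k-1}, x_k, x_{k+1})`. The bound on the steps selects the
relevant solution `x_{k+1}` of an implicit equation: the midpoint rule also has spurious ones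
`x_{k+1} ≈ - x_k`, for which the midpoint nearly hits the singularity at the origin. -/
def IsNumericalSolution (Φ : Plane → Plane → Plane → Plane) (h T : ℝ) (x : ℕ → Plane) : Prop :=
  (∀ k : ℕ, (k + 2 : ℝ) * h ≤ T →
    (h ^ 2)⁻¹ • (x (k + 2) - (2 : ℝ) • x (k + 1) + x k) = Φ (x k) (x (k + 1)) (x (k + 2))) ∧
  ∀ k : ℕ, (k + 1 : ℝ) * h ≤ T → ‖x (k + 1) - x k‖ ≤ ‖x k‖ / 2

/-- Along the Kepler motion `(γ, γ')` and up to time `T`, the Euler-Lagrange equation of `L h`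
is the modified equation of the method `Φ` up to `O(h⁴)`: numerical solutions, started on the orbit
with `x₀ = γ(0)` and `x₁ = γ(h) + O(h³)`, exist for small `h` and agree, up to `O(h⁴)`, with a
motion of the Lagrangian `L h` with initial data `O(h²)`-close to those of `γ`. -/
def IsModifiedLagrangian (Φ : Plane → Plane → Plane → Plane) (L : ℝ → Plane → Plane → ℝ)
    (γ γ' : ℝ → Plane) (T : ℝ) : Prop :=
  ∀ K > 0, ∃ C > 0, ∃ h₀ > 0, ∀ h ∈ Ioo 0 h₀,
    (∀ x₁ : Plane, ‖x₁ - γ h‖ ≤ K * h ^ 3 →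
      ∃ x, IsNumericalSolution Φ h T x ∧ x 0 = γ 0 ∧ x 1 = x₁) ∧
    ∀ x, IsNumericalSolution Φ h T x → x 0 = γ 0 → ‖x 1 - γ h‖ ≤ K * h ^ 3 →
      ∃ X V, IsMotion (L h) (Icc 0 T) X V ∧
        ‖X 0 - γ 0‖ ≤ C * h ^ 2 ∧ ‖V 0 - γ' 0‖ ≤ C * h ^ 2 ∧
        ∀ k : ℕ, k * h ≤ T → ‖x k - X (k * h)‖ ≤ C * h ^ 4

/-- The precession rate of the perturbed Kepler problem with Lagrangian `L h` is `ρ h² + O(h⁴)`: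
for small `h` the motions of `L h` with initial data `O(h²)`-close to those of the Kepler motion
`(γ, γ')` exist on the time interval `[0, T]`, and along each of them the angle of the
Laplace-Runge-Lenz vector changes by `ρ h² + O(h⁴)` from time `0` to time `T`, where `T` is to be
the period of the unperturbed motion `γ`. -/
def HasPrecessionRate (L : ℝ → Plane → Plane → ℝ) (γ γ' : ℝ → Plane) (T ρ : ℝ) : Prop :=
  ∀ K > 0, ∃ C > 0, ∃ h₀ > 0, ∀ h ∈ Ioo 0 h₀, ∀ y w : Plane,
    ‖y - γ 0‖ ≤ K * h ^ 2 → ‖w - γ' 0‖ ≤ K * h ^ 2 →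
    (∃ X V, IsMotion (L h) (Icc 0 T) X V ∧ X 0 = y ∧ V 0 = w) ∧
    ∀ X V, IsMotion (L h) (Icc 0 T) X V → X 0 = y → V 0 = w →
      ∃ Δ, HasAngleChange (fun t => lrl (X t) (V t)) T Δ ∧ |Δ - ρ * h ^ 2| ≤ C * h ^ 4

/-- The numerical precession rate of the method `Φ` is `ρ h² + O(h⁴)`: it is the precession rate
of the perturbed Kepler problem `L h` that describes the numerical solutions up to `O(h⁴)`. -/
def HasNumericalPrecessionRate (Φ : Plane → Plane → Plane → Plane) (L : ℝ → Plane → Plane → ℝ)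
    (γ γ' : ℝ → Plane) (T ρ : ℝ) : Prop :=
  IsModifiedLagrangian Φ L γ γ' T ∧ HasPrecessionRate L γ γ' T ρ

end Kepler

end

/-! Both modified Lagrangians lie in one family: `modLagrangian σ h` perturbs the Kepler Lagrangian
by h²/24 (1/|x|⁴ + σ Q) with Q = |v|²/|x|³ - 3⟨x,v⟩²/|x|⁵, where σ = 1 is the midpoint rule and σ =
-2 is Störmer-Verlet. Along a Kepler orbit Q = 1/|x|⁴ + d/dt(⟨x,v⟩/|x|³), so over a full period the
perturbation acts to first order like (1 + σ)/|x|⁴. The precession rate is therefore proportional to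
1 + σ, and the values 2 and -1 give the ratio -2.

Rate. The angle of the Laplace-Runge-Lenz vector moves with speed h² times `precessionSpeed`.
Perturbed motions stay O(h²)-close to the orbit on [0, T] (`exists_flow`, `IsMotion.eqOn`), so
evaluating this speed on the Kepler orbit costs only O(h⁴). There it is a polynomial in 1/|x|;
modulo derivatives of ⟨x,v⟩/|x|ⁿ it reduces to a multiple of 1/|x|², which integrates to the polar
angle (`exists_precession`), and this angle makes one turn per period (`exists_angle`). The geometry
of the ellipse turns angular momentum and eccentricity into a and b (`elliptic`,
`precession_coefficient`).

Numerical solutions. Solutions of the Euler-Lagrange equation satisfy the difference equation with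
residual O(h⁶), because the h⁴ terms cancel for the right σ (`verlet_isConsistent`,
`midpoint_isConsistent`). Stability sums these residuals to an O(h⁴) error
(`IsNumericalSolution.close`). Since x₁ is prescribed only up to O(h³), the initial velocity of the
shadowing motion is found by shooting (`exists_shooting`), which moves it by O(h²).

The square ε of the step size is carried as a constant coordinate of the state, so that dependence
on ε becomes dependence on initial data of one smooth autonomous system. -/

noncomputable section

namespace Kepler

open Set Metric Topology Filter
open scoped ContDiff NNReal RealInnerProductSpace

/-! ### Smooth functions along integral curves -/

section Smooth

variable {S F : Type*} [NormedAddCommGroup S] [NormedSpace ℝ S]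
  [NormedAddCommGroup F] [NormedSpace ℝ F]

/-- The derivative of a smooth function along the integral curves of a smooth vector field is a
smooth function of the position. -/
theorem exists_lieDeriv {U : Set S} (hU : IsOpen U) {W : S → S} (hW : ContDiffOn ℝ ∞ W U)
    {u : S → F} (hu : ContDiffOn ℝ ∞ u U) :
    ∃ u' : S → F, ContDiffOn ℝ ∞ u' U ∧ ∀ (s : ℝ → S) (t : ℝ), s t ∈ U →
      HasDerivAt s (W (s t)) t → HasDerivAt (fun τ => u (s τ)) (u' (s t)) t := by
  refine ⟨fun x => fderiv ℝ u x (W x), (hu.fderiv_of_isOpen hU (by simp)).clm_apply hW, ?_⟩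
  intro s t hs hd
  have h1 : DifferentiableAt ℝ u (s t) :=
    (hu.contDiffAt (hU.mem_nhds hs)).differentiableAt (by simp)
  exact h1.hasFDerivAt.comp_hasDerivAt t hd

/-- A smooth function is bounded and Lipschitz on compact sets. -/
theorem exists_bound_lipschitz {U K : Set S} (hU : IsOpen U) (hK : IsCompact K) (hKU : K ⊆ U)
    {u : S → F} (hu : ContDiffOn ℝ ∞ u U) :
    ∃ C > 0, (∀ x ∈ K, ‖u x‖ ≤ C) ∧ ∀ x ∈ K, ∀ y ∈ K, ‖u x - u y‖ ≤ C * ‖x - y‖ := by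
  obtain ⟨C₁, hC₁⟩ := hK.exists_bound_of_continuousOn (hu.continuousOn.mono hKU)
  have hl : LocallyLipschitzOn K u := by
    intro x hx
    obtain ⟨C, t, ht, hC⟩ :=
      ((hu.contDiffAt (hU.mem_nhds (hKU hx))).of_le (by simp) :
        ContDiffAt ℝ 1 u x).exists_lipschitzOnWith
    exact ⟨C, t, mem_nhdsWithin_of_mem_nhds ht, hC⟩
  obtain ⟨C₂, hC₂⟩ := hl.exists_lipschitzOnWith_of_compact hK
  refine ⟨max 1 (max C₁ C₂), by positivity, fun x hx => (hC₁ x hx).trans (by simp),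
    fun x hx y hy => ?_⟩
  rw [lipschitzOnWith_iff_norm_sub_le] at hC₂
  exact (hC₂ hx hy).trans (by gcongr; simp)

end Smooth

/-! ### Taylor expansion of symmetric differences -/

section Taylor

variable {F : Type*} [NormedAddCommGroup F] [NormedSpace ℝ F]

theorem norm_le_of_deriv_le {φ φ' : ℝ → F} {h C : ℝ} (hφ : ∀ s ∈ Icc 0 h, HasDerivAt φ (φ' s) s)
    (h0 : φ 0 = 0) (hC : ∀ s ∈ Icc 0 h, ‖φ' s‖ ≤ C) : ∀ s ∈ Icc 0 h, ‖φ s‖ ≤ C * h := by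
  intro s hs
  have h1 := norm_image_sub_le_of_norm_deriv_le_segment' (a := 0) (b := h) (C := C)
    (fun x hx => (hφ x hx).hasDerivWithinAt) (fun x hx => hC x ⟨hx.1, hx.2.le⟩) s hs
  have hC0 : 0 ≤ C := (norm_nonneg _).trans (hC s hs)
  rw [h0, sub_zero, sub_zero] at h1
  exact h1.trans (by gcongr; exact hs.2)

theorem norm_le_of_deriv2_le {φ φ' φ'' : ℝ → F} {h C : ℝ}
    (hφ : ∀ s ∈ Icc 0 h, HasDerivAt φ (φ' s) s) (hφ' : ∀ s ∈ Icc 0 h, HasDerivAt φ' (φ'' s) s)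
    (h0 : φ 0 = 0) (h0' : φ' 0 = 0) (hC : ∀ s ∈ Icc 0 h, ‖φ'' s‖ ≤ C) :
    ∀ s ∈ Icc 0 h, ‖φ s‖ ≤ C * h ^ 2 := by
  intro s hs
  have := norm_le_of_deriv_le hφ h0 (norm_le_of_deriv_le hφ' h0' hC) s hs
  rwa [mul_assoc, ← sq] at this

theorem hasDerivAt_comp_neg {y : ℝ → F} {y' : F} {s : ℝ} (hy : HasDerivAt y y' (-s)) :
    HasDerivAt (fun τ => y (-τ)) (-y') s := by
  have := hy.scomp s (hasDerivAt_neg s)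
  rwa [neg_one_smul] at this

/-- Symmetric differences, second order Taylor expansion. -/
theorem norm_symm_diff_le_two {y₀ y₁ y₂ : ℝ → F} {h C : ℝ}
    (h0 : ∀ s ∈ Icc (-h) h, HasDerivAt y₀ (y₁ s) s)
    (h1 : ∀ s ∈ Icc (-h) h, HasDerivAt y₁ (y₂ s) s)
    (hC : ∀ s ∈ Icc (-h) h, ‖y₂ s‖ ≤ C) :
    ∀ s ∈ Icc 0 h, ‖y₀ s + y₀ (-s) - (2 : ℝ) • y₀ 0‖ ≤ 2 * C * h ^ 2 := by
  have hm : ∀ s ∈ Icc 0 h, s ∈ Icc (-h) h ∧ -s ∈ Icc (-h) h := fun s hs =>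
    ⟨⟨by linarith [hs.1, hs.2], hs.2⟩, ⟨by linarith [hs.1, hs.2], by linarith [hs.1, hs.2]⟩⟩
  -- The even combination has an odd first derivative, which vanishes at 0; two integrations then
  -- suffice.
  refine norm_le_of_deriv2_le (φ' := fun s => y₁ s - y₁ (-s)) (φ'' := fun s => y₂ s + y₂ (-s))
    (fun s hs => ?_) (fun s hs => ?_) ?_ (by simp) (fun s hs => ?_)
  · exact (((h0 s (hm s hs).1).fun_add (hasDerivAt_comp_neg (h0 (-s) (hm s hs).2))).sub_const
      ((2 : ℝ) • y₀ 0)).congr_deriv (by abel)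
  · exact ((h1 s (hm s hs).1).fun_sub (hasDerivAt_comp_neg (h1 (-s) (hm s hs).2))).congr_deriv
      (by abel)
  · simp [two_smul]
  · exact (norm_add_le _ _).trans (by linarith [hC s (hm s hs).1, hC (-s) (hm s hs).2])

/-- Symmetric differences, one step up in the Taylor expansion. -/
theorem norm_symm_diff_step {y₀ y₁ y₂ : ℝ → F} {p p' p'' : ℝ → F} {h C : ℝ}
    (h0 : ∀ s ∈ Icc (-h) h, HasDerivAt y₀ (y₁ s) s)
    (h1 : ∀ s ∈ Icc (-h) h, HasDerivAt y₁ (y₂ s) s)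
    (hp : ∀ s, HasDerivAt p (p' s) s) (hp' : ∀ s, HasDerivAt p' (p'' s) s)
    (hp0 : p 0 = (2 : ℝ) • y₀ 0) (hp0' : p' 0 = 0)
    (hC : ∀ s ∈ Icc 0 h, ‖y₂ s + y₂ (-s) - p'' s‖ ≤ C) :
    ∀ s ∈ Icc 0 h, ‖y₀ s + y₀ (-s) - p s‖ ≤ C * h ^ 2 := by
  have hm : ∀ s ∈ Icc 0 h, s ∈ Icc (-h) h ∧ -s ∈ Icc (-h) h := fun s hs =>
    ⟨⟨by linarith [hs.1, hs.2], hs.2⟩, ⟨by linarith [hs.1, hs.2], by linarith [hs.1, hs.2]⟩⟩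
  refine norm_le_of_deriv2_le (φ' := fun s => y₁ s - y₁ (-s) - p' s) (fun s hs => ?_)
    (fun s hs => ?_) ?_ (by simp [hp0']) hC
  · exact (((h0 s (hm s hs).1).fun_add (hasDerivAt_comp_neg (h0 (-s) (hm s hs).2))).fun_sub
      (hp s)).congr_deriv (by abel)
  · exact (((h1 s (hm s hs).1).fun_sub (hasDerivAt_comp_neg (h1 (-s) (hm s hs).2))).fun_sub
      (hp' s)).congr_deriv (by abel)
  · simp [hp0, two_smul]

/-- Symmetric differences, fourth order Taylor expansion. -/
theorem norm_symm_diff_le_four {y₀ y₁ y₂ y₃ y₄ : ℝ → F} {h C : ℝ}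
    (h0 : ∀ s ∈ Icc (-h) h, HasDerivAt y₀ (y₁ s) s)
    (h1 : ∀ s ∈ Icc (-h) h, HasDerivAt y₁ (y₂ s) s)
    (h2 : ∀ s ∈ Icc (-h) h, HasDerivAt y₂ (y₃ s) s)
    (h3 : ∀ s ∈ Icc (-h) h, HasDerivAt y₃ (y₄ s) s)
    (hC : ∀ s ∈ Icc (-h) h, ‖y₄ s‖ ≤ C) :
    ∀ s ∈ Icc 0 h, ‖y₀ s + y₀ (-s) - ((2 : ℝ) • y₀ 0 + s ^ 2 • y₂ 0)‖ ≤ 2 * C * h ^ 4 := by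
  intro s hs
  have := norm_symm_diff_step (p := fun s => (2 : ℝ) • y₀ 0 + s ^ 2 • y₂ 0)
    (p' := fun s => (2 * s) • y₂ 0) (p'' := fun _ => (2 : ℝ) • y₂ 0) h0 h1
    (fun s => by simpa using ((hasDerivAt_pow 2 s).smul_const (y₂ 0)).const_add ((2 : ℝ) • y₀ 0))
    (fun s => by simpa using ((hasDerivAt_id s).const_mul 2).smul_const (y₂ 0))
    (by simp) (by simp) (norm_symm_diff_le_two h2 h3 hC) s hs
  exact this.trans (by ring_nf; rfl)

/-- Symmetric differences, sixth order Taylor expansion. -/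
theorem norm_symm_diff_le_six {y₀ y₁ y₂ y₃ y₄ y₅ y₆ : ℝ → F} {h C : ℝ}
    (h0 : ∀ s ∈ Icc (-h) h, HasDerivAt y₀ (y₁ s) s)
    (h1 : ∀ s ∈ Icc (-h) h, HasDerivAt y₁ (y₂ s) s)
    (h2 : ∀ s ∈ Icc (-h) h, HasDerivAt y₂ (y₃ s) s)
    (h3 : ∀ s ∈ Icc (-h) h, HasDerivAt y₃ (y₄ s) s)
    (h4 : ∀ s ∈ Icc (-h) h, HasDerivAt y₄ (y₅ s) s)
    (h5 : ∀ s ∈ Icc (-h) h, HasDerivAt y₅ (y₆ s) s)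
    (hC : ∀ s ∈ Icc (-h) h, ‖y₆ s‖ ≤ C) :
    ∀ s ∈ Icc 0 h, ‖y₀ s + y₀ (-s) - ((2 : ℝ) • y₀ 0 + s ^ 2 • y₂ 0 + (s ^ 4 / 12) • y₄ 0)‖ ≤
      2 * C * h ^ 6 := by
  intro s hs
  have := norm_symm_diff_step (p := fun s => (2 : ℝ) • y₀ 0 + s ^ 2 • y₂ 0 + (s ^ 4 / 12) • y₄ 0)
    (p' := fun s => (2 * s) • y₂ 0 + (s ^ 3 / 3) • y₄ 0)
    (p'' := fun s => (2 : ℝ) • y₂ 0 + s ^ 2 • y₄ 0) h0 h1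
    (fun s => by
      have e : HasDerivAt (fun s : ℝ => s ^ 4 / 12) (s ^ 3 / 3) s := by
        refine ((hasDerivAt_pow 4 s).div_const 12).congr_deriv ?_; push_cast; ring
      simpa using (((hasDerivAt_pow 2 s).smul_const (y₂ 0)).const_add ((2 : ℝ) • y₀ 0)).fun_add
        (e.smul_const (y₄ 0)))
    (fun s => by
      have e : HasDerivAt (fun s : ℝ => s ^ 3 / 3) (s ^ 2) s := by
        refine ((hasDerivAt_pow 3 s).div_const 3).congr_deriv ?_; push_cast; ring
      simpa using (((hasDerivAt_id s).const_mul 2).smul_const (y₂ 0)).fun_add (e.smul_const (y₄ 0)))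
    (by simp) (by simp) (norm_symm_diff_le_four h2 h3 h4 h5 hC) s hs
  exact this.trans (by ring_nf; rfl)

end Taylor

/-! ### The flow near a reference curve -/

section Flow

variable {S : Type*} [NormedAddCommGroup S] [NormedSpace ℝ S] [FiniteDimensional ℝ S]

/-- A smooth vector field on an open set agrees near a given compact subset with a smooth vector
field of compact support. -/
theorem exists_cutoff {U K : Set S} (hU : IsOpen U) (hK : IsCompact K) (hKU : K ⊆ U)
    {W : S → S} (hW : ContDiffOn ℝ ∞ W U) :
    ∃ W' : S → S, ContDiff ℝ ∞ W' ∧ HasCompactSupport W' ∧ EqOn W' W K := by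
  obtain ⟨K', hK', hKK', hK'U⟩ := exists_compact_between hK hU hKU
  obtain ⟨χ, hχ1, hχ0, -⟩ := exists_contMDiffMap_one_nhds_of_subset_interior
    (modelWithCornersSelf ℝ S) (n := ⊤) hK.isClosed hKK'
  have hχ : ContDiff ℝ ∞ χ := χ.contMDiff.contDiff
  have hz : ∀ x ∉ K', χ x • W x = 0 := fun x hx => by simp [hχ0 x hx]
  refine ⟨fun x => χ x • W x, ?_, HasCompactSupport.intro hK' hz, fun x hx => ?_⟩
  · rw [contDiff_iff_contDiffAt]
    intro x
    by_cases hx : x ∈ K'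
    · exact hχ.contDiffAt.smul (hW.contDiffAt (hU.mem_nhds (hK'U hx)))
    · refine (contDiffAt_const (c := (0 : S))).congr_of_eventuallyEq ?_
      filter_upwards [hK'.isClosed.isOpen_compl.mem_nhds hx] with y hy using hz y hy
  · have := hχ1.self_of_nhdsSet x hx
    simp [this]

/-- A vector field that is bounded and Lipschitz has integral curves on every interval. -/
theorem exists_integralCurve {W : S → S} {Λ : ℝ≥0} (hΛ : LipschitzWith Λ W) {M : ℝ}
    (hM : ∀ x, ‖W x‖ ≤ M) {T : ℝ} (hT : 0 ≤ T) (x : S) :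
    ∃ s : ℝ → S, s 0 = x ∧ ∀ t ∈ Icc 0 T, HasDerivAt s (W (s t)) t := by
  have hM0 : 0 ≤ M := (norm_nonneg _).trans (hM x)
  -- The interval exceeds [0, T] on both sides so that derivatives at 0 and T are two-sided. A curve
  -- of speed at most M cannot leave the ball of radius M(T + 1).
  have h : IsPicardLindelof (fun _ => W) (tmin := -1) (tmax := T + 1)
      ⟨0, by norm_num, by linarith⟩ x (M.toNNReal * (T + 1).toNNReal) 0 M.toNNReal Λ := by
    refine IsPicardLindelof.of_time_independent (fun y _ => ?_) hΛ.lipschitzOnWith ?_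
    · rw [Real.coe_toNNReal _ hM0]; exact hM y
    · have : max (T + 1 - 0) (0 - -1) = T + 1 := by
        rw [max_eq_left]
        all_goals linarith
      simp only [NNReal.coe_mul, NNReal.coe_zero, sub_zero]
      rw [Real.coe_toNNReal (T + 1) (by linarith)]
      gcongr
      simp [hT]
  obtain ⟨s, hs0, hs⟩ := h.exists_eq_forall_mem_Icc_hasDerivWithinAt₀
  exact ⟨s, hs0, fun t ht => (hs t ⟨by linarith [ht.1], by linarith [ht.2]⟩).hasDerivAt
    (Icc_mem_nhds (by linarith [ht.1]) (by linarith [ht.2]))⟩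

/-- The flow of a smooth vector field near a reference integral curve `c`, with linear dependence
on the initial point. -/
theorem exists_flow {U : Set S} (hU : IsOpen U) {W : S → S} (hW : ContDiffOn ℝ ∞ W U)
    {c : ℝ → S} {T : ℝ} (hT : 0 ≤ T)
    (hc : ∀ t ∈ Icc 0 T, c t ∈ U ∧ HasDerivAt c (W (c t)) t) :
    ∃ K ⊆ U, IsCompact K ∧ ∃ δ > 0, ∃ A ≥ 1, ∃ Φ : S → ℝ → S,
      (∀ t ∈ Icc 0 T, ∀ x, dist x (c t) ≤ δ → x ∈ K) ∧
      (∀ x, A * dist x (c 0) ≤ δ → Φ x 0 = x ∧ ∀ t ∈ Icc 0 T,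
        HasDerivAt (Φ x) (W (Φ x t)) t ∧ dist (Φ x t) (c t) ≤ A * dist x (c 0)) ∧
      (∀ x y, ∀ t ∈ Icc 0 T, dist (Φ x t) (Φ y t) ≤ A * dist x y) := by
  have hcc : ContinuousOn c (Icc 0 T) := fun t ht => (hc t ht).2.continuousAt.continuousWithinAt
  have hcK : IsCompact (c '' Icc 0 T) := isCompact_Icc.image_of_continuousOn hcc
  obtain ⟨δ, hδ, hδU⟩ := hcK.exists_cthickening_subset_open hU
    (by rintro _ ⟨t, ht, rfl⟩; exact (hc t ht).1)
  have hKc : IsCompact (cthickening δ (c '' Icc 0 T)) := hcK.cthickening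
  obtain ⟨W', hW', hW'c, hWW'⟩ := exists_cutoff hU hKc hδU hW
  obtain ⟨Λ, hΛ⟩ := hW'.lipschitzWith_of_hasCompactSupport hW'c (by simp)
  obtain ⟨M, hM⟩ := hW'c.exists_bound_of_continuous hW'.continuous
  choose Φ hΦ0 hΦ using exists_integralCurve hΛ hM hT
  have hmem : ∀ t ∈ Icc 0 T, ∀ x, dist x (c t) ≤ δ → x ∈ cthickening δ (c '' Icc 0 T) :=
    fun t ht x hx => mem_cthickening_of_dist_le x (c t) δ _ (mem_image_of_mem c ht) hx
  have hcont : ∀ x, ContinuousOn (Φ x) (Icc 0 T) := fun x t ht =>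
    (hΦ x t ht).continuousAt.continuousWithinAt
  have hexp : ∀ t ∈ Icc 0 T, Real.exp (Λ * (t - 0)) ≤ Real.exp (Λ * T) := fun t ht => by
    gcongr; linarith [ht.2]
  refine ⟨_, hδU, hKc, δ, hδ, Real.exp (Λ * T), Real.one_le_exp (by positivity), Φ, hmem,
    fun x hx => ?_, fun x y t ht => ?_⟩
  -- Grönwall applies to the cut-off field, which is globally Lipschitz, so no continuation argument
  -- is needed. Only afterwards is the trajectory seen to lie where the two fields agree.
  · have key : ∀ t ∈ Icc 0 T, dist (Φ x t) (c t) ≤ Real.exp (Λ * T) * dist x (c 0) := by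
      intro t ht
      have := dist_le_of_trajectories_ODE (v := fun _ => W') (fun _ => hΛ) (hcont x)
        (fun t ht => (hΦ x t ⟨ht.1, ht.2.le⟩).hasDerivWithinAt) hcc
        (fun t ht => by
          have h1 := (hc t ⟨ht.1, ht.2.le⟩).2.hasDerivWithinAt (s := Ici t)
          rwa [← hWW' (hmem t ⟨ht.1, ht.2.le⟩ _ (by simp [hδ.le]))] at h1)
        (le_refl _) t ht
      rw [hΦ0] at this
      rw [mul_comm]
      exact this.trans (by gcongr; exact ht.2.trans' (by simp))
    refine ⟨hΦ0 x, fun t ht => ⟨?_, key t ht⟩⟩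
    rw [← hWW' (hmem t ht _ ((key t ht).trans hx))]
    exact hΦ x t ht
  · have := dist_le_of_trajectories_ODE (v := fun _ => W') (fun _ => hΛ) (hcont x)
        (fun t ht => (hΦ x t ⟨ht.1, ht.2.le⟩).hasDerivWithinAt) (hcont y)
        (fun t ht => (hΦ y t ⟨ht.1, ht.2.le⟩).hasDerivWithinAt) (le_refl _) t ht
    rw [hΦ0, hΦ0] at this
    rw [mul_comm]
    exact this.trans (by gcongr; exact ht.2.trans' (by simp))

end Flow

/-! ### A family of modified Lagrangians -/

/-- A family of Lagrangians that contains those of the Kepler problem and of both methods. -/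
def modLagrangian (σ h : ℝ) (x v : Plane) : ℝ :=
  ‖v‖ ^ 2 / 2 + 1 / ‖x‖ + h ^ 2 / 24 *
    (1 / ‖x‖ ^ 4 + σ * (‖v‖ ^ 2 / ‖x‖ ^ 3 - 3 * inner ℝ x v ^ 2 / ‖x‖ ^ 5))

theorem midpointLagrangian_eq (h : ℝ) : midpointLagrangian h = modLagrangian 1 h := by
  ext x v; simp only [midpointLagrangian, modLagrangian]; ring

theorem verletLagrangian_eq (h : ℝ) : verletLagrangian h = modLagrangian (-2) h := by
  ext x v; simp only [verletLagrangian, modLagrangian]; ring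

theorem lagrangian_eq (σ : ℝ) : lagrangian = modLagrangian σ 0 := by
  ext x v; simp only [lagrangian, modLagrangian]; ring

/-- Minus the derivative of the force at `x`, in the direction `w`. -/
def tidal (x w : Plane) : Plane := (‖x‖ ^ 3)⁻¹ • w - (3 * ⟪x, w⟫ * (‖x‖ ^ 5)⁻¹) • x

/-- The derivative of `tidal x w` with respect to `x` in the direction `v`, for `w = v`. -/
def tidalDot (x v : Plane) : Plane :=
  -(6 * ⟪x, v⟫ * (‖x‖ ^ 5)⁻¹) • v +
    (15 * ⟪x, v⟫ ^ 2 * (‖x‖ ^ 7)⁻¹ - 3 * ‖v‖ ^ 2 * (‖x‖ ^ 5)⁻¹) • x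

/-- The momentum, where `ε` is the square of the step size. -/
def momentum (σ ε : ℝ) (x v : Plane) : Plane := v + (ε * σ / 12) • tidal x v

/-- The derivative of the Lagrangian with respect to the position. -/
def positionGradient (σ ε : ℝ) (x v : Plane) : Plane :=
  (-(‖x‖ ^ 3)⁻¹ + ε / 24 * (-4 * (‖x‖ ^ 6)⁻¹ +
    σ * (15 * ⟪x, v⟫ ^ 2 * (‖x‖ ^ 7)⁻¹ - 3 * ‖v‖ ^ 2 * (‖x‖ ^ 5)⁻¹))) • x
    - (ε / 24 * σ * (6 * ⟪x, v⟫ * (‖x‖ ^ 5)⁻¹)) • v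

/-- The transversal eigenvalue of the mass matrix. -/
def massTrans (σ ε : ℝ) (x : Plane) : ℝ := 1 + ε * σ / 12 * (‖x‖ ^ 3)⁻¹

/-- The radial eigenvalue of the mass matrix. -/
def massRad (σ ε : ℝ) (x : Plane) : ℝ := 1 - ε * σ / 6 * (‖x‖ ^ 3)⁻¹

/-- The velocity, as a function of the momentum. -/
def velocity (σ ε : ℝ) (x p : Plane) : Plane :=
  (massTrans σ ε x)⁻¹ • (p + (ε * σ / 4 * (‖x‖ ^ 5)⁻¹ * (massRad σ ε x)⁻¹ * ⟪x, p⟫) • x)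

/-- The coefficient of `x` in the perturbing acceleration. -/
def radialCoeff (σ : ℝ) (x v : Plane) : ℝ :=
  (1 / 24 : ℝ) * (-(4 + 4 * σ) * (‖x‖ ^ 6)⁻¹ +
    σ * (3 * ‖v‖ ^ 2 * (‖x‖ ^ 5)⁻¹ - 15 * ⟪x, v⟫ ^ 2 * (‖x‖ ^ 7)⁻¹))

/-- The coefficient of `v` in the perturbing acceleration. -/
def velocityCoeff (σ : ℝ) (x v : Plane) : ℝ := (1 / 24 : ℝ) * (σ * (6 * ⟪x, v⟫ * (‖x‖ ^ 5)⁻¹))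

/-- The perturbing acceleration, to leading order. -/
def leadingPerturbation (σ : ℝ) (x v : Plane) : Plane :=
  radialCoeff σ x v • x + velocityCoeff σ x v • v

/-- The perturbing acceleration is `ε` times this. -/
def perturbation (σ ε : ℝ) (x v : Plane) : Plane :=
  leadingPerturbation σ x v -
    ε • (σ / 12) • velocity σ ε x (tidal x (leadingPerturbation σ x v))

/-- The acceleration given by the Euler-Lagrange equation of the modified Lagrangian. -/
def acceleration (σ ε : ℝ) (x v : Plane) : Plane := force x + ε • perturbation σ ε x v

/-! ### Inversion of the mass matrix. -/

/-- `tidal x` multiplies by |x|⁻³ across x and by -2|x|⁻³ along x, which gives the two eigenvalues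
of the mass matrix. Being a multiple of the identity plus a rank one term, the matrix has the
explicit inverse `velocity`. -/
theorem momentum_velocity {σ ε : ℝ} {x : Plane} (hx : x ≠ 0) (h1 : massTrans σ ε x ≠ 0)
    (h2 : massRad σ ε x ≠ 0) (p : Plane) : momentum σ ε x (velocity σ ε x p) = p := by
  have hr : ‖x‖ ≠ 0 := norm_ne_zero_iff.mpr hx
  have e1 : massTrans σ ε x * (massTrans σ ε x)⁻¹ = 1 := mul_inv_cancel₀ h1
  have e2 : massRad σ ε x * (massRad σ ε x)⁻¹ = 1 := mul_inv_cancel₀ h2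
  have e3 : massTrans σ ε x = 1 + ε * σ / 12 * (‖x‖ ^ 3)⁻¹ := rfl
  have e4 : massRad σ ε x = 1 - ε * σ / 6 * (‖x‖ ^ 3)⁻¹ := rfl
  have e5 : ‖x‖ ^ 2 * (‖x‖ ^ 5)⁻¹ = (‖x‖ ^ 3)⁻¹ := by field_simp
  simp only [momentum, velocity, tidal, inner_smul_right, inner_add_right,
    real_inner_self_eq_norm_sq]
  generalize (‖x‖ ^ 5)⁻¹ = r5 at *
  generalize (‖x‖ ^ 3)⁻¹ = r3 at *
  generalize massTrans σ ε x = m1 at *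
  generalize massRad σ ε x = m2 at *
  generalize m1⁻¹ = i1 at *
  generalize m2⁻¹ = i2 at *
  generalize ‖x‖ ^ 2 = q at *
  generalize ⟪x, p⟫ = s at *
  match_scalars
  · linear_combination e1 - i1 * e3
  · subst e3 e4
    linear_combination (i1 * (ε * σ / 4 * r5) * s) * e2 -
      i1 * (ε * σ / 4 * r5) * s * i2 * (ε * σ / 4) * e5

theorem velocity_momentum {σ ε : ℝ} {x : Plane} (hx : x ≠ 0) (h1 : massTrans σ ε x ≠ 0)
    (h2 : massRad σ ε x ≠ 0) (v : Plane) : velocity σ ε x (momentum σ ε x v) = v := by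
  have hr : ‖x‖ ≠ 0 := norm_ne_zero_iff.mpr hx
  have e1 : massTrans σ ε x * (massTrans σ ε x)⁻¹ = 1 := mul_inv_cancel₀ h1
  have e2 : massRad σ ε x * (massRad σ ε x)⁻¹ = 1 := mul_inv_cancel₀ h2
  have e3 : massTrans σ ε x = 1 + ε * σ / 12 * (‖x‖ ^ 3)⁻¹ := rfl
  have e4 : massRad σ ε x = 1 - ε * σ / 6 * (‖x‖ ^ 3)⁻¹ := rfl
  have e5 : ‖x‖ ^ 2 * (‖x‖ ^ 5)⁻¹ = (‖x‖ ^ 3)⁻¹ := by field_simp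
  simp only [momentum, velocity, tidal, inner_smul_right, inner_add_right, inner_sub_right,
    real_inner_self_eq_norm_sq]
  generalize (‖x‖ ^ 5)⁻¹ = r5 at *
  generalize (‖x‖ ^ 3)⁻¹ = r3 at *
  generalize massTrans σ ε x = m1 at *
  generalize massRad σ ε x = m2 at *
  generalize m1⁻¹ = i1 at *
  generalize m2⁻¹ = i2 at *
  generalize ‖x‖ ^ 2 = q at *
  generalize ⟪x, v⟫ = s at *
  match_scalars
  · linear_combination e1 - i1 * e3
  · subst e3 e4
    linear_combination (i1 * (ε * σ / 4 * r5) * s) * e2 -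
      i1 * (ε * σ / 4 * r5) * s * i2 * (ε * σ / 4) * e5

/-- This is the Euler-Lagrange equation solved for the acceleration. With D the tidal operator and M
= 1 + (εσ/12)D the mass matrix, `perturbation` has the form u - (εσ/12)M⁻¹Du, hence M maps it to the
leading term u. What remains is the first order comparison in ε. -/
theorem momentum_acceleration {σ ε : ℝ} {x : Plane} (hx : x ≠ 0) (h1 : massTrans σ ε x ≠ 0)
    (h2 : massRad σ ε x ≠ 0) (v : Plane) :
    momentum σ ε x (acceleration σ ε x v) + (ε * σ / 12) • tidalDot x v =
      positionGradient σ ε x v := by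
  have hr : ‖x‖ ≠ 0 := norm_ne_zero_iff.mpr hx
  have hadd : ∀ p q : Plane, momentum σ ε x (p + q) = momentum σ ε x p + momentum σ ε x q := by
    intro p q
    simp only [momentum, tidal, inner_add_right]
    module
  have hsmul : ∀ (c : ℝ) (p : Plane), momentum σ ε x (c • p) = c • momentum σ ε x p := by
    intro c p
    simp only [momentum, tidal, inner_smul_right]
    module
  have key : momentum σ ε x (perturbation σ ε x v) = leadingPerturbation σ x v := by
    rw [perturbation, sub_eq_add_neg, hadd, ← neg_smul, hsmul, hsmul, momentum_velocity hx h1 h2,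
      momentum]
    module
  rw [acceleration, hadd, hsmul, key]
  have e5 : ‖x‖ ^ 2 * (‖x‖ ^ 5)⁻¹ = (‖x‖ ^ 3)⁻¹ := by field_simp
  have e6 : (‖x‖ ^ 3)⁻¹ * (‖x‖ ^ 3)⁻¹ = (‖x‖ ^ 6)⁻¹ := by field_simp
  simp only [momentum, tidal, tidalDot, force, leadingPerturbation, radialCoeff, velocityCoeff,
    positionGradient, inner_smul_right, inner_neg_right, real_inner_self_eq_norm_sq]
  generalize (‖x‖ ^ 5)⁻¹ = r5 at *
  generalize (‖x‖ ^ 3)⁻¹ = r3 at *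
  generalize (‖x‖ ^ 6)⁻¹ = r6 at *
  generalize (‖x‖ ^ 7)⁻¹ = r7 at *
  generalize ‖x‖ ^ 2 = q at *
  generalize ⟪x, v⟫ = s at *
  match_scalars
  · linear_combination (ε * σ / 6) * e6 + (ε * σ / 4 * r3) * e5
  · ring

/-! ### Derivatives of the building blocks -/

theorem hasFDerivAt_norm_pow_inv (n : ℕ) {x : Plane} (hx : x ≠ 0) :
    HasFDerivAt (fun y : Plane => (‖y‖ ^ n)⁻¹)
      ((-(n * (‖x‖ ^ (n + 2))⁻¹)) • innerSL ℝ x) x := by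
  have hr : ‖x‖ ≠ 0 := norm_ne_zero_iff.mpr hx
  have h2 : HasFDerivAt (fun y : Plane => ‖y‖ ^ 2) (2 • innerSL ℝ x) x :=
    (hasStrictFDerivAt_norm_sq x).hasFDerivAt
  have h1 : HasFDerivAt (fun y : Plane => ‖y‖) (‖x‖⁻¹ • innerSL ℝ x) x := by
    have := h2.sqrt (by positivity)
    simp only [Real.sqrt_sq (norm_nonneg _)] at this
    refine this.congr_fderiv ?_
    ext w
    simp only [_root_.smul_apply, smul_eq_mul, nsmul_eq_mul]
    push_cast
    field_simp
  have h3 : HasDerivAt (fun s : ℝ => (s ^ n)⁻¹) (-(n * ‖x‖ ^ (n - 1)) / (‖x‖ ^ n) ^ 2) ‖x‖ :=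
    (hasDerivAt_pow n ‖x‖).fun_inv (pow_ne_zero _ hr)
  refine (h3.comp_hasFDerivAt x h1).congr_fderiv ?_
  rw [smul_smul]
  congr 1
  rcases n with _ | n
  · simp
  · simp only [Nat.add_sub_cancel]
    field_simp
    ring

theorem hasGradientAt_velocity (σ h : ℝ) (x v : Plane) :
    HasGradientAt (fun w => modLagrangian σ h x w) (momentum σ (h ^ 2) x v) v := by
  rw [hasGradientAt_iff_hasFDerivAt]
  have h2 : HasFDerivAt (fun y : Plane => ‖y‖ ^ 2) (2 • innerSL ℝ v) v :=
    (hasStrictFDerivAt_norm_sq v).hasFDerivAt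
  have h3 : HasFDerivAt (fun w : Plane => ⟪x, w⟫) (innerSL ℝ x) v := (innerSL ℝ x).hasFDerivAt
  have h4 : HasFDerivAt (fun w : Plane => ⟪x, w⟫ ^ 2) ((2 * ⟪x, v⟫) • innerSL ℝ x) v := by
    simpa using h3.pow 2
  have := ((h2.const_mul (1 / 2 : ℝ)).fun_add ((h2.const_mul (h ^ 2 / 24 * σ * (‖x‖ ^ 3)⁻¹)).fun_sub
    (h4.const_mul (h ^ 2 / 24 * σ * 3 * (‖x‖ ^ 5)⁻¹)))).add_const
      (1 / ‖x‖ + h ^ 2 / 24 * (1 / ‖x‖ ^ 4))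
  refine (this.congr_fderiv ?_).congr_of_eventuallyEq (.of_forall fun w => ?_)
  · ext w
    simp [momentum, tidal]
    ring
  · simp only [modLagrangian, div_eq_mul_inv]
    ring

theorem hasGradientAt_position (σ h : ℝ) {x : Plane} (hx : x ≠ 0) (v : Plane) :
    HasGradientAt (fun y => modLagrangian σ h y v) (positionGradient σ (h ^ 2) x v) x := by
  rw [hasGradientAt_iff_hasFDerivAt]
  have h3 : HasFDerivAt (fun w : Plane => ⟪w, v⟫) (innerSL ℝ v) x := by
    simp only [real_inner_comm v]
    exact (innerSL ℝ v).hasFDerivAt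
  have h4 : HasFDerivAt (fun w : Plane => ⟪w, v⟫ ^ 2) ((2 * ⟪x, v⟫) • innerSL ℝ v) x := by
    simpa using h3.pow 2
  have := (hasFDerivAt_norm_pow_inv 1 hx).fun_add
    (((hasFDerivAt_norm_pow_inv 4 hx).const_mul (h ^ 2 / 24)).fun_add
      (((hasFDerivAt_norm_pow_inv 3 hx).const_mul (h ^ 2 / 24 * σ * ‖v‖ ^ 2)).fun_sub
        (((h4.mul (hasFDerivAt_norm_pow_inv 5 hx))).const_mul (h ^ 2 / 24 * σ * 3))))
  refine ((this.add_const (‖v‖ ^ 2 / 2)).congr_fderiv ?_).congr_of_eventuallyEq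
    (.of_forall fun w => ?_)
  · ext w
    simp [positionGradient]
    ring
  · simp only [modLagrangian, div_eq_mul_inv, Pi.mul_apply]
    ring

section Curves

variable {J : Set ℝ} {t : ℝ} {X V : ℝ → Plane} {A : Plane}

theorem hasDerivWithinAt_norm_pow_inv (n : ℕ) {v : Plane} (hX : HasDerivWithinAt X v J t)
    (h0 : X t ≠ 0) :
    HasDerivWithinAt (fun s => (‖X s‖ ^ n)⁻¹) (-(n * (‖X t‖ ^ (n + 2))⁻¹) * ⟪X t, v⟫) J t :=
  ((hasFDerivAt_norm_pow_inv n h0).comp_hasDerivWithinAt t hX).congr_deriv (by simp)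

theorem hasDerivWithinAt_tidal (hX : HasDerivWithinAt X (V t) J t)
    (hV : HasDerivWithinAt V A J t) (h0 : X t ≠ 0) :
    HasDerivWithinAt (fun s => tidal (X s) (V s)) (tidalDot (X t) (V t) + tidal (X t) A) J t := by
  have h3 := hasDerivWithinAt_norm_pow_inv 3 hX h0
  have h5 := hasDerivWithinAt_norm_pow_inv 5 hX h0
  have hs := hX.inner ℝ hV
  refine ((h3.fun_smul hV).fun_sub (((hs.const_mul 3).fun_mul h5).fun_smul hX)).congr_deriv ?_
  simp only [tidal, tidalDot, real_inner_self_eq_norm_sq]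
  push_cast
  match_scalars <;> ring

theorem hasDerivWithinAt_momentum (σ ε : ℝ) (hX : HasDerivWithinAt X (V t) J t)
    (hV : HasDerivWithinAt V A J t) (h0 : X t ≠ 0) :
    HasDerivWithinAt (fun s => momentum σ ε (X s) (V s))
      (momentum σ ε (X t) A + (ε * σ / 12) • tidalDot (X t) (V t)) J t := by
  refine (hV.fun_add ((hasDerivWithinAt_tidal hX hV h0).const_smul (ε * σ / 12))).congr_deriv ?_
  simp only [momentum]
  module

end Curves

/-- The motions of the modified Lagrangian in terms of the momentum. -/
theorem isMotion_iff {σ h : ℝ} {J : Set ℝ} {X V : ℝ → Plane} :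
    IsMotion (modLagrangian σ h) J X V ↔ ∀ t ∈ J, X t ≠ 0 ∧ HasDerivWithinAt X (V t) J t ∧
      HasDerivWithinAt (fun s => momentum σ (h ^ 2) (X s) (V s))
        (positionGradient σ (h ^ 2) (X t) (V t)) J t := by
  refine forall₂_congr fun t ht => and_congr_right fun h0 => and_congr_right fun _ => ?_
  have h1 : ∀ s, gradient (fun w => modLagrangian σ h (X s) w) (V s) =
      momentum σ (h ^ 2) (X s) (V s) := fun s => (hasGradientAt_velocity σ h (X s) (V s)).gradient
  simp only [h1, (hasGradientAt_position σ h h0 (V t)).gradient]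

/-- Solutions of the Euler-Lagrange equation in normal form are motions. -/
theorem isMotion_of_hasDerivWithinAt {σ h : ℝ} {J : Set ℝ} {X V : ℝ → Plane}
    (hJ : ∀ t ∈ J, X t ≠ 0 ∧ massTrans σ (h ^ 2) (X t) ≠ 0 ∧ massRad σ (h ^ 2) (X t) ≠ 0 ∧
      HasDerivWithinAt X (V t) J t ∧
      HasDerivWithinAt V (acceleration σ (h ^ 2) (X t) (V t)) J t) :
    IsMotion (modLagrangian σ h) J X V := by
  refine isMotion_iff.mpr fun t ht => ?_
  obtain ⟨h0, h1, h2, hX, hV⟩ := hJ t ht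
  refine ⟨h0, hX, (hasDerivWithinAt_momentum σ (h ^ 2) hX hV h0).congr_deriv ?_⟩
  exact momentum_acceleration h0 h1 h2 (V t)

/-! ### The Euler-Lagrange equation as a smooth autonomous system -/

/-- The states `(ε, x, v)`: square of the step size, position and velocity. -/
abbrev State := ℝ × Plane × Plane

/-- The states near which the Euler-Lagrange equation is regular and the Laplace-Runge-Lenz vector
does not vanish. -/
def regular (σ : ℝ) : Set State :=
  {s | s.2.1 ≠ 0 ∧ massTrans σ s.1 s.2.1 ≠ 0 ∧ massRad σ s.1 s.2.1 ≠ 0 ∧ lrl s.2.1 s.2.2 ≠ 0}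

/-- The Euler-Lagrange equation as an autonomous vector field. -/
def field (σ : ℝ) (s : State) : State := (0, s.2.2, acceleration σ s.1 s.2.1 s.2.2)

section Smoothness

variable {E : Type*} [NormedAddCommGroup E] [NormedSpace ℝ E] {e : E → ℝ} {x v : E → Plane} {z : E}

theorem contDiffAt_norm_pow_inv (n : ℕ) (hx : ContDiffAt ℝ ∞ x z) (h0 : x z ≠ 0) :
    ContDiffAt ℝ ∞ (fun y => (‖x y‖ ^ n)⁻¹) z :=
  ((hx.norm ℝ h0).pow n).inv (pow_ne_zero _ (norm_ne_zero_iff.mpr h0))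

theorem contDiffAt_force (hx : ContDiffAt ℝ ∞ x z) (h0 : x z ≠ 0) :
    ContDiffAt ℝ ∞ (fun y => force (x y)) z :=
  ((contDiffAt_norm_pow_inv 3 hx h0).smul hx).neg

theorem contDiffAt_tidal (hx : ContDiffAt ℝ ∞ x z) (hv : ContDiffAt ℝ ∞ v z) (h0 : x z ≠ 0) :
    ContDiffAt ℝ ∞ (fun y => tidal (x y) (v y)) z :=
  ((contDiffAt_norm_pow_inv 3 hx h0).smul hv).sub
    (((contDiffAt_const.mul (hx.inner ℝ hv)).mul (contDiffAt_norm_pow_inv 5 hx h0)).smul hx)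

theorem contDiffAt_massTrans (σ : ℝ) (he : ContDiffAt ℝ ∞ e z) (hx : ContDiffAt ℝ ∞ x z)
    (h0 : x z ≠ 0) : ContDiffAt ℝ ∞ (fun y => massTrans σ (e y) (x y)) z :=
  contDiffAt_const.add (((he.mul contDiffAt_const).div_const 12).mul
    (contDiffAt_norm_pow_inv 3 hx h0))

theorem contDiffAt_massRad (σ : ℝ) (he : ContDiffAt ℝ ∞ e z) (hx : ContDiffAt ℝ ∞ x z)
    (h0 : x z ≠ 0) : ContDiffAt ℝ ∞ (fun y => massRad σ (e y) (x y)) z :=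
  contDiffAt_const.sub (((he.mul contDiffAt_const).div_const 6).mul
    (contDiffAt_norm_pow_inv 3 hx h0))

theorem contDiffAt_velocity {σ : ℝ} (he : ContDiffAt ℝ ∞ e z) (hx : ContDiffAt ℝ ∞ x z)
    (hv : ContDiffAt ℝ ∞ v z) (h0 : x z ≠ 0) (h1 : massTrans σ (e z) (x z) ≠ 0)
    (h2 : massRad σ (e z) (x z) ≠ 0) :
    ContDiffAt ℝ ∞ (fun y => velocity σ (e y) (x y) (v y)) z :=
  ((contDiffAt_massTrans σ he hx h0).inv h1).smul (hv.add
    (((((he.mul contDiffAt_const).div_const 4).mul (contDiffAt_norm_pow_inv 5 hx h0)).mul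
      ((contDiffAt_massRad σ he hx h0).inv h2)).mul (hx.inner ℝ hv) |>.smul hx))

theorem contDiffAt_radialCoeff (σ : ℝ) (hx : ContDiffAt ℝ ∞ x z) (hv : ContDiffAt ℝ ∞ v z)
    (h0 : x z ≠ 0) : ContDiffAt ℝ ∞ (fun y => radialCoeff σ (x y) (v y)) z := by
  have := contDiffAt_norm_pow_inv 5 hx h0
  have := contDiffAt_norm_pow_inv 6 hx h0
  have := contDiffAt_norm_pow_inv 7 hx h0
  have := hx.inner ℝ hv
  have := hv.norm_sq ℝ
  unfold radialCoeff
  fun_prop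

theorem contDiffAt_velocityCoeff (σ : ℝ) (hx : ContDiffAt ℝ ∞ x z) (hv : ContDiffAt ℝ ∞ v z)
    (h0 : x z ≠ 0) : ContDiffAt ℝ ∞ (fun y => velocityCoeff σ (x y) (v y)) z := by
  have := contDiffAt_norm_pow_inv 5 hx h0
  have := hx.inner ℝ hv
  unfold velocityCoeff
  fun_prop

theorem contDiffAt_leadingPerturbation (σ : ℝ) (hx : ContDiffAt ℝ ∞ x z)
    (hv : ContDiffAt ℝ ∞ v z) (h0 : x z ≠ 0) :
    ContDiffAt ℝ ∞ (fun y => leadingPerturbation σ (x y) (v y)) z :=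
  ((contDiffAt_radialCoeff σ hx hv h0).smul hx).add ((contDiffAt_velocityCoeff σ hx hv h0).smul hv)

theorem contDiffAt_perturbation {σ : ℝ} (he : ContDiffAt ℝ ∞ e z) (hx : ContDiffAt ℝ ∞ x z)
    (hv : ContDiffAt ℝ ∞ v z) (h0 : x z ≠ 0) (h1 : massTrans σ (e z) (x z) ≠ 0)
    (h2 : massRad σ (e z) (x z) ≠ 0) :
    ContDiffAt ℝ ∞ (fun y => perturbation σ (e y) (x y) (v y)) z :=
  have h := contDiffAt_leadingPerturbation σ hx hv h0
  h.sub (he.smul ((contDiffAt_const (c := σ / 12)).smul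
    (contDiffAt_velocity he hx (contDiffAt_tidal hx h h0) h0 h1 h2)))

theorem contDiffAt_acceleration {σ : ℝ} (he : ContDiffAt ℝ ∞ e z) (hx : ContDiffAt ℝ ∞ x z)
    (hv : ContDiffAt ℝ ∞ v z) (h0 : x z ≠ 0) (h1 : massTrans σ (e z) (x z) ≠ 0)
    (h2 : massRad σ (e z) (x z) ≠ 0) :
    ContDiffAt ℝ ∞ (fun y => acceleration σ (e y) (x y) (v y)) z :=
  (contDiffAt_force hx h0).add (he.smul (contDiffAt_perturbation he hx hv h0 h1 h2))

theorem contDiffAt_lrl (hx : ContDiffAt ℝ ∞ x z) (hv : ContDiffAt ℝ ∞ v z) (h0 : x z ≠ 0) :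
    ContDiffAt ℝ ∞ (fun y => lrl (x y) (v y)) z :=
  (((hv.norm_sq ℝ).smul hx).sub ((hx.inner ℝ hv).smul hv)).sub
    (((hx.norm ℝ h0).inv (norm_ne_zero_iff.mpr h0)).smul hx)

end Smoothness

theorem contDiffAt_state (s : State) : ContDiffAt ℝ ∞ (fun s : State => s.1) s ∧
    ContDiffAt ℝ ∞ (fun s : State => s.2.1) s ∧ ContDiffAt ℝ ∞ (fun s : State => s.2.2) s :=
  ⟨contDiffAt_fst, contDiffAt_fst.comp s contDiffAt_snd, contDiffAt_snd.comp s contDiffAt_snd⟩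

theorem isOpen_regular (σ : ℝ) : IsOpen (regular σ) := by
  rw [isOpen_iff_mem_nhds]
  rintro s ⟨h0, h1, h2, h3⟩
  obtain ⟨he, hx, hv⟩ := contDiffAt_state s
  filter_upwards [hx.continuousAt.eventually_ne h0,
    (contDiffAt_massTrans σ he hx h0).continuousAt.eventually_ne h1,
    (contDiffAt_massRad σ he hx h0).continuousAt.eventually_ne h2,
    (contDiffAt_lrl hx hv h0).continuousAt.eventually_ne h3] with y a b c d using ⟨a, b, c, d⟩

theorem contDiffOn_perturbation (σ : ℝ) :
    ContDiffOn ℝ ∞ (fun s : State => perturbation σ s.1 s.2.1 s.2.2) (regular σ) := fun s hs =>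
  have ⟨he, hx, hv⟩ := contDiffAt_state s
  (contDiffAt_perturbation he hx hv hs.1 hs.2.1 hs.2.2.1).contDiffWithinAt

theorem contDiffOn_field (σ : ℝ) : ContDiffOn ℝ ∞ (field σ) (regular σ) := fun s hs =>
  have ⟨he, hx, hv⟩ := contDiffAt_state s
  (contDiffAt_const.prodMk (hv.prodMk
    (contDiffAt_acceleration he hx hv hs.1 hs.2.1 hs.2.2.1))).contDiffWithinAt

/-! ### Motions as integral curves -/

/-- The velocity of a motion is differentiable, and its derivative is the acceleration. -/
theorem IsMotion.hasDerivWithinAt_velocity {σ h : ℝ} {J : Set ℝ} {X V : ℝ → Plane}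
    (hm : IsMotion (modLagrangian σ h) J X V) {t : ℝ} (ht : t ∈ J) (hJ : UniqueDiffWithinAt ℝ J t)
    (h1 : massTrans σ (h ^ 2) (X t) ≠ 0) (h2 : massRad σ (h ^ 2) (X t) ≠ 0) :
    HasDerivWithinAt V (acceleration σ (h ^ 2) (X t) (V t)) J t := by
  obtain ⟨h0, hX, hP⟩ := isMotion_iff.mp hm t ht
  set P := fun s => momentum σ (h ^ 2) (X s) (V s)
  have hd : DifferentiableWithinAt ℝ (fun s => velocity σ (h ^ 2) (X s) (P s)) J t := by
    have hc : ContDiffAt ℝ ∞ (fun z : Plane × Plane => velocity σ (h ^ 2) z.1 z.2) (X t, P t) :=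
      contDiffAt_velocity contDiffAt_const contDiffAt_fst contDiffAt_snd h0 h1 h2
    exact (hc.differentiableAt (by simp)).comp_differentiableWithinAt (f := fun s => (X s, P s)) t
      (hX.differentiableWithinAt.prodMk hP.differentiableWithinAt)
  have hcX : ContinuousWithinAt X J t := hX.continuousWithinAt
  -- A motion only provides differentiability of X and of the momentum. Where the mass matrix is
  -- invertible, V is a smooth function of these two and inherits it.
  have hev : V =ᶠ[𝓝[J] t] fun s => velocity σ (h ^ 2) (X s) (P s) := by
    have c1 : ContinuousAt (fun y => massTrans σ (h ^ 2) y) (X t) :=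
      (contDiffAt_massTrans σ contDiffAt_const contDiffAt_id h0).continuousAt
    have c2 : ContinuousAt (fun y => massRad σ (h ^ 2) y) (X t) :=
      (contDiffAt_massRad σ contDiffAt_const contDiffAt_id h0).continuousAt
    filter_upwards [hcX.eventually_ne h0, hcX.eventually (c1.eventually_ne h1),
      hcX.eventually (c2.eventually_ne h2)] with s a b c
    exact (velocity_momentum a b c (V s)).symm
  have hV : HasDerivWithinAt V (derivWithin V J t) J t :=
    (hd.congr_of_eventuallyEq hev (velocity_momentum h0 h1 h2 (V t)).symm).hasDerivWithinAt
  have e := hJ.eq_deriv _ (hasDerivWithinAt_momentum σ (h ^ 2) hX hV h0) hP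
  rw [← momentum_acceleration h0 h1 h2, add_left_inj] at e
  have e' := congrArg (velocity σ (h ^ 2) (X t)) e
  rw [velocity_momentum h0 h1 h2, velocity_momentum h0 h1 h2] at e'
  rwa [e'] at hV

/-- A motion agrees with the integral curve of the vector field that has the same initial data. -/
theorem IsMotion.eqOn {σ h T : ℝ} (hT : 0 < T) {X V : ℝ → Plane}
    (hm : IsMotion (modLagrangian σ h) (Icc 0 T) X V) {s : ℝ → State}
    (hs : ∀ t ∈ Icc 0 T, s t ∈ regular σ ∧ HasDerivAt s (field σ (s t)) t)
    (h0 : s 0 = (h ^ 2, X 0, V 0)) : ∀ t ∈ Icc 0 T, s t = (h ^ 2, X t, V t) := by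
  have hJ : ∀ t ∈ Icc 0 T, UniqueDiffWithinAt ℝ (Icc 0 T) t := uniqueDiffOn_Icc hT
  have hsc : ContinuousOn s (Icc 0 T) := fun t ht => (hs t ht).2.continuousAt.continuousWithinAt
  have hX : ContinuousOn X (Icc 0 T) := fun t ht => (hm t ht).2.1.continuousWithinAt
  set P := fun t => momentum σ (h ^ 2) (X t) (V t) with hP
  have hPc : ContinuousOn P (Icc 0 T) := fun t ht =>
    (isMotion_iff.mp hm t ht).2.2.continuousWithinAt
  -- The comparison is made between momenta, which are continuous on all of [0, T]; V is not known
  -- to be continuous before the motion is known to be in the regular region. The coincidence set is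
  -- thus closed, and local uniqueness extends it to the right.
  set Q : State → State := fun s => (s.1, s.2.1, momentum σ s.1 s.2.1 s.2.2) with hQ
  have hQc : ContinuousOn (fun t => Q (s t)) (Icc 0 T) := by
    intro t ht
    obtain ⟨he, hx, hv⟩ := contDiffAt_state (s t)
    have : ContDiffAt ℝ ∞ Q (s t) := he.prodMk (hx.prodMk
      (hv.add (((he.mul contDiffAt_const).div_const 12).smul
        (contDiffAt_tidal hx hv (hs t ht).1.1))))
    exact this.continuousAt.comp_continuousWithinAt (hsc t ht)
  have hiff : ∀ t ∈ Icc 0 T, Q (s t) = (h ^ 2, X t, P t) → s t = (h ^ 2, X t, V t) := by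
    intro t ht he
    obtain ⟨r0, r1, r2, -⟩ := (hs t ht).1
    simp only [hQ, hP, Prod.mk.injEq] at he
    obtain ⟨e1, e2, e3⟩ := he
    rw [e1, e2] at e3 r1 r2
    rw [e2] at r0
    have e' := congrArg (velocity σ (h ^ 2) (X t)) e3
    rw [velocity_momentum r0 r1 r2, velocity_momentum r0 r1 r2] at e'
    rw [← e1, ← e2, ← e']
  have hcl : IsClosed ({t | Q (s t) = (h ^ 2, X t, P t)} ∩ Icc 0 T) := by
    have := (hQc.sub ((continuousOn_const (c := h ^ 2)).prodMk (hX.prodMk hPc))).preimage_isClosed_of_isClosed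
      isClosed_Icc (isClosed_singleton (x := (0 : State)))
    convert this using 1
    ext t
    simp only [mem_inter_iff, mem_ofPred_eq, mem_preimage, mem_singleton_iff, Pi.sub_apply,
      sub_eq_zero]
    tauto
  intro t ht
  refine hiff t ht (hcl.Icc_subset_of_forall_exists_gt ?_ ?_ ht)
  · simp only [mem_ofPred_eq, h0, hQ, hP]
  · rintro x ⟨hx, hxI⟩ y (hy : x < y)
    have hxI' : x ∈ Icc 0 T := ⟨hxI.1, hxI.2.le⟩
    have hsx := hiff x hxI' hx
    set Y : ℝ → State := fun t => (h ^ 2, X t, V t) with hY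
    have hYd : ∀ t ∈ Icc 0 T, Y t ∈ regular σ → HasDerivWithinAt Y (field σ (Y t)) (Icc 0 T) t := by
      intro t ht hr
      exact (hasDerivWithinAt_const _ _ _).prodMk ((hm t ht).2.1.prodMk
        (hm.hasDerivWithinAt_velocity ht (hJ t ht) hr.2.1 hr.2.2.1))
    have hsx : s x = Y x := hsx
    have hr : Y x ∈ regular σ := hsx ▸ (hs x hxI').1
    obtain ⟨Λ, N, hN, hΛ⟩ := (((contDiffOn_field σ).contDiffAt
      ((isOpen_regular σ).mem_nhds hr)).of_le (by simp) :
        ContDiffAt ℝ 1 (field σ) (Y x)).exists_lipschitzOnWith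
    have hYx : ContinuousWithinAt Y (Icc 0 T) x := by
      refine continuousWithinAt_const.prodMk ((hX x hxI').prodMk ?_)
      exact (hm.hasDerivWithinAt_velocity hxI' (hJ x hxI') hr.2.1 hr.2.2.1).continuousWithinAt
    have hev : ∀ᶠ t in 𝓝[Icc 0 T] x, Y t ∈ N ∧ Y t ∈ regular σ ∧ s t ∈ N :=
      (hYx.eventually hN).and ((hYx.eventually ((isOpen_regular σ).mem_nhds hr)).and
        ((hsc x hxI').eventually (hsx ▸ hN)))
    obtain ⟨η, hη, hηb⟩ := Metric.mem_nhdsWithin_iff.mp hev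
    set z := min (min y T) (x + η / 2) with hz
    have hxz : x < z := lt_min (lt_min hy hxI.2) (by linarith)
    have hzT : z ≤ T := (min_le_left _ _).trans (min_le_right _ _)
    have hzη : z ≤ x + η / 2 := min_le_right _ _
    have hsub : Icc x z ⊆ Icc 0 T := Icc_subset_Icc hxI.1 hzT
    have hg : ∀ t ∈ Icc x z, Y t ∈ N ∧ Y t ∈ regular σ ∧ s t ∈ N := fun t ht =>
      hηb ⟨by rw [mem_ball, Real.dist_eq, abs_of_nonneg] <;> linarith [ht.1, ht.2], hsub ht⟩
    have hioi : ∀ t ∈ Ico x z, 𝓝[≥] t ≤ 𝓝[Icc 0 T] t := fun t ht => by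
      refine nhdsWithin_le_iff.mpr (mem_of_superset (Icc_mem_nhdsGE ht.2) ?_)
      exact Icc_subset_Icc (hxI.1.trans ht.1) hzT
    have heq := ODE_solution_unique_of_mem_Icc_right (v := fun _ => field σ) (s := fun _ => N)
      (f := s) (g := Y) (a := x) (b := z) (fun _ _ => hΛ) (hsc.mono hsub)
      (fun t ht => (hs t (hsub ⟨ht.1, ht.2.le⟩)).2.hasDerivWithinAt)
      (fun t ht => (hg t ⟨ht.1, ht.2.le⟩).2.2)
      (fun t ht => (hYd t (hsub ht) (hg t ht).2.1).continuousWithinAt.mono hsub)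
      (fun t ht => (hYd t (hsub ⟨ht.1, ht.2.le⟩) (hg t ⟨ht.1, ht.2.le⟩).2.1).mono_of_mem_nhdsWithin
        (hioi t ht self_mem_nhdsWithin))
      (fun t ht => (hg t ⟨ht.1, ht.2.le⟩).1) hsx
    refine ⟨z, ?_, hxz, (min_le_left _ _).trans (min_le_left _ _)⟩
    have := heq ⟨hxz.le, le_rfl⟩
    simp only [mem_ofPred_eq, this, hQ, hP, hY]

/-! ### The Laplace-Runge-Lenz vector along perturbed Kepler motions -/

theorem inner_plane (x y : Plane) : ⟪x, y⟫ = x 0 * y 0 + x 1 * y 1 := by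
  simp [PiLp.inner_apply, Fin.sum_univ_two, mul_comm]

theorem norm_sq_plane (x : Plane) : ‖x‖ ^ 2 = x 0 ^ 2 + x 1 ^ 2 := by
  rw [← real_inner_self_eq_norm_sq, inner_plane]; ring

theorem plane_ext {x y : Plane} (h0 : x 0 = y 0) (h1 : x 1 = y 1) : x = y := by
  ext i; fin_cases i <;> assumption

theorem hasDerivAt_coord {X : ℝ → Plane} {v : Plane} {t : ℝ} (hX : HasDerivAt X v t) (i : Fin 2) :
    HasDerivAt (fun s => X s i) (v i) t :=
  (EuclideanSpace.proj (𝕜 := ℝ) i).hasFDerivAt.comp_hasDerivAt t hX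

/-- The derivative of the Laplace-Runge-Lenz vector for the perturbing acceleration `a`. -/
def lrlDot (x v a : Plane) : Plane := (2 * ⟪v, a⟫) • x - ⟪x, a⟫ • v - ⟪x, v⟫ • a

theorem hasDerivAt_norm_pow_inv (n : ℕ) {X : ℝ → Plane} {v : Plane} {t : ℝ}
    (hX : HasDerivAt X v t) (h0 : X t ≠ 0) :
    HasDerivAt (fun s => (‖X s‖ ^ n)⁻¹) (-(n * (‖X t‖ ^ (n + 2))⁻¹) * ⟪X t, v⟫) t :=
  ((hasFDerivAt_norm_pow_inv n h0).comp_hasDerivAt t hX).congr_deriv (by simp)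

theorem hasDerivAt_lrl {X V : ℝ → Plane} {a : Plane} {t : ℝ} (h0 : X t ≠ 0)
    (hX : HasDerivAt X (V t) t) (hV : HasDerivAt V (force (X t) + a) t) :
    HasDerivAt (fun s => lrl (X s) (V s)) (lrlDot (X t) (V t) a) t := by
  have hr : ‖X t‖ ≠ 0 := norm_ne_zero_iff.mpr h0
  have h1 := hasDerivAt_norm_pow_inv 1 hX h0
  have h2 := hX.inner ℝ hV
  have h3 := hV.norm_sq
  simp only [pow_one] at h1
  refine (((h3.fun_smul hX).fun_sub (h2.fun_smul hV)).fun_sub (h1.fun_smul hX)).congr_deriv ?_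
  have e : ‖X t‖ ^ 2 * (‖X t‖ ^ 3)⁻¹ = ‖X t‖⁻¹ := by field_simp
  simp only [lrlDot, force, inner_add_right, inner_neg_right, inner_smul_right,
    real_inner_self_eq_norm_sq, real_inner_comm (X t) (V t), Nat.cast_one, Nat.reduceAdd]
  match_scalars
  · linear_combination e
  · ring
  · ring

theorem hasDerivAt_angularMomentum {X V : ℝ → Plane} {a : Plane} {t : ℝ}
    (hX : HasDerivAt X (V t) t) (hV : HasDerivAt V (force (X t) + a) t) :
    HasDerivAt (fun s => angularMomentum (X s) (V s)) (angularMomentum (X t) a) t := by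
  refine (((hasDerivAt_coord hX 0).fun_mul (hasDerivAt_coord hV 1)).fun_sub
    ((hasDerivAt_coord hV 0).fun_mul (hasDerivAt_coord hX 1))).congr_deriv ?_
  simp [force, angularMomentum]
  ring

theorem angularMomentum_sq (x v : Plane) :
    angularMomentum x v ^ 2 = ‖x‖ ^ 2 * ‖v‖ ^ 2 - ⟪x, v⟫ ^ 2 := by
  rw [norm_sq_plane, norm_sq_plane, inner_plane, angularMomentum]; ring

/-- In the plane the vector is the angular momentum times the velocity turned by a right angle,
minus the unit position vector. In this form it determines the velocity from the position. -/
theorem lrl_zero (x v : Plane) : lrl x v 0 = angularMomentum x v * v 1 - ‖x‖⁻¹ * x 0 := by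
  simp only [lrl, norm_sq_plane v, inner_plane x v, angularMomentum, PiLp.sub_apply,
    PiLp.smul_apply, smul_eq_mul]
  ring

theorem lrl_one (x v : Plane) : lrl x v 1 = -(angularMomentum x v * v 0) - ‖x‖⁻¹ * x 1 := by
  simp only [lrl, norm_sq_plane v, inner_plane x v, angularMomentum, PiLp.sub_apply,
    PiLp.smul_apply, smul_eq_mul]
  ring

/-- The equation of a conic section. -/
theorem inner_lrl (x v : Plane) : ⟪lrl x v, x⟫ = angularMomentum x v ^ 2 - ‖x‖ := by
  rw [angularMomentum_sq, lrl, inner_sub_left, inner_sub_left, real_inner_smul_left,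
    real_inner_smul_left, real_inner_smul_left, real_inner_self_eq_norm_sq, real_inner_comm x v]
  rcases eq_or_ne x 0 with rfl | hx
  · simp
  · have : ‖x‖ ≠ 0 := norm_ne_zero_iff.mpr hx
    field_simp

theorem norm_lrl_sq {x : Plane} (hx : x ≠ 0) (v : Plane) :
    ‖lrl x v‖ ^ 2 = 1 + angularMomentum x v ^ 2 * (‖v‖ ^ 2 - 2 * ‖x‖⁻¹) := by
  have hr : ‖x‖ ≠ 0 := norm_ne_zero_iff.mpr hx
  have e : ‖x‖⁻¹ ^ 2 * (x 0 ^ 2 + x 1 ^ 2) = 1 := by rw [← norm_sq_plane]; field_simp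
  rw [norm_sq_plane (lrl x v), lrl_zero, lrl_one, norm_sq_plane v]
  linear_combination e + 2 * angularMomentum x v * ‖x‖⁻¹ * (by rw [angularMomentum] :
    angularMomentum x v = x 0 * v 1 - v 0 * x 1)

/-- The cross product of two vectors of the plane. -/
def cross (x y : Plane) : ℝ := x 0 * y 1 - x 1 * y 0

/-- The cross product of the Laplace-Runge-Lenz vector and its derivative. -/
theorem cross_lrl_lrlDot {x : Plane} (hx : x ≠ 0) (v : Plane) (p q : ℝ) :
    cross (lrl x v) (lrlDot x v (p • x + q • v)) = angularMomentum x v *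
      (p * (‖x‖ - angularMomentum x v ^ 2) + 2 * q * ⟪x, v⟫ * ‖x‖⁻¹) := by
  have hr : ‖x‖ ≠ 0 := norm_ne_zero_iff.mpr hx
  have e : ‖x‖⁻¹ * (x 0 ^ 2 + x 1 ^ 2) = ‖x‖ := by rw [← norm_sq_plane]; field_simp
  have el : angularMomentum x v = x 0 * v 1 - v 0 * x 1 := rfl
  have e0 : lrlDot x v (p • x + q • v) 0 = 2 * q * angularMomentum x v * v 1 +
      p * angularMomentum x v * x 1 := by
    simp only [lrlDot, inner_plane, PiLp.sub_apply, PiLp.add_apply, PiLp.smul_apply, smul_eq_mul,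
      angularMomentum]
    ring
  have e1 : lrlDot x v (p • x + q • v) 1 = -(2 * q * angularMomentum x v * v 0 +
      p * angularMomentum x v * x 0) := by
    simp only [lrlDot, inner_plane, PiLp.sub_apply, PiLp.add_apply, PiLp.smul_apply, smul_eq_mul,
      angularMomentum]
    ring
  rw [cross, lrl_zero, lrl_one, e0, e1, inner_plane]
  linear_combination (angularMomentum x v * p) * e + p * angularMomentum x v ^ 2 * el

/-! ### Kepler motions -/

/-- Kepler motions in normal form. -/
def IsKepler (γ γ' : ℝ → Plane) : Prop :=
  ∀ t, γ t ≠ 0 ∧ HasDerivAt γ (γ' t) t ∧ HasDerivAt γ' (force (γ t)) t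

theorem acceleration_zero (σ : ℝ) (x v : Plane) : acceleration σ 0 x v = force x := by
  simp [acceleration]

/-- The Kepler Lagrangian is the member h = 0 of the family, where both mass eigenvalues equal 1. -/
theorem IsMotion.isKepler {γ γ' : ℝ → Plane} (hγ : IsMotion lagrangian univ γ γ') :
    IsKepler γ γ' := by
  rw [lagrangian_eq 0] at hγ
  intro t
  have h := hγ.hasDerivWithinAt_velocity (mem_univ t) uniqueDiffWithinAt_univ
    (by simp [massTrans]) (by simp [massRad])
  rw [hasDerivWithinAt_univ] at h
  refine ⟨(hγ t (mem_univ t)).1, by simpa using (hγ t (mem_univ t)).2.1, ?_⟩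
  simpa [acceleration] using h

namespace IsKepler

variable {γ γ' : ℝ → Plane} (hγ : IsKepler γ γ')
include hγ

theorem angularMomentum_eq (t : ℝ) :
    angularMomentum (γ t) (γ' t) = angularMomentum (γ 0) (γ' 0) := by
  have h : ∀ t, HasDerivAt (fun s => angularMomentum (γ s) (γ' s)) 0 t := fun t =>
    (hasDerivAt_angularMomentum (a := 0) (hγ t).2.1 (by simpa using (hγ t).2.2)).congr_deriv
      (by simp [angularMomentum])
  exact is_const_of_deriv_eq_zero (fun t => (h t).differentiableAt) (fun t => (h t).deriv) t 0

theorem lrl_eq (t : ℝ) : lrl (γ t) (γ' t) = lrl (γ 0) (γ' 0) := by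
  have h : ∀ t, HasDerivAt (fun s => lrl (γ s) (γ' s)) 0 t := fun t =>
    (hasDerivAt_lrl (a := 0) (hγ t).1 (hγ t).2.1 (by simpa using (hγ t).2.2)).congr_deriv
      (by simp [lrlDot])
  exact is_const_of_deriv_eq_zero (fun t => (h t).differentiableAt) (fun t => (h t).deriv) t 0

/-- The angular momentum and the Laplace-Runge-Lenz vector of an elliptic orbit. -/
theorem elliptic {F : Plane} {a b : ℝ} (hab : IsEllipse (range γ) 0 F a b) (hecc : b < a) :
    a * angularMomentum (γ 0) (γ' 0) ^ 2 = b ^ 2 ∧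
      a ^ 2 * ‖lrl (γ 0) (γ' 0)‖ ^ 2 = a ^ 2 - b ^ 2 := by
  obtain ⟨ha, hb, hF, hS⟩ := hab
  set A := lrl (γ 0) (γ' 0)
  set l := angularMomentum (γ 0) (γ' 0)
  rw [dist_zero_left] at hF
  have hc : 0 < ‖F‖ := by
    rcases (norm_nonneg F).eq_or_lt with h | h
    · rw [← h] at hF; nlinarith
    · exact h
  -- On the ellipse |p| is affine in p in two ways: by the conic equation of the orbit and by the
  -- focal equation. Eliminating |p| makes a linear functional constant on the ellipse; its values
  -- at the four vertices show that it is zero.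
  have hmem : ∀ p : Plane, ‖p‖ + ‖p - F‖ = 2 * a →
      ⟪p, (2 * a) • A + F⟫ = 2 * (a * l ^ 2 - b ^ 2) := by
    intro p hp
    have : p ∈ range γ := by
      rw [hS]; simpa [dist_eq_norm] using hp
    obtain ⟨t, rfl⟩ := this
    have h1 := inner_lrl (γ t) (γ' t)
    rw [hγ.lrl_eq, hγ.angularMomentum_eq, real_inner_comm] at h1
    have h2 : ‖γ t - F‖ ^ 2 = ‖γ t‖ ^ 2 - 2 * ⟪γ t, F⟫ + ‖F‖ ^ 2 := norm_sub_sq_real _ _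
    have h3 : ‖γ t - F‖ = 2 * a - ‖γ t‖ := by linarith
    rw [h3] at h2
    rw [inner_add_right, inner_smul_right, h1]
    linear_combination h2 / 2 + 2 * hF
  -- F turned by a right angle, so that the ends of the minor axis are F/2 ± (b/|F|)G.
  set G : Plane := !₂[-F 1, F 0] with hG
  have hGn : ‖G‖ = ‖F‖ := by
    rw [← sq_eq_sq₀ (norm_nonneg _) (norm_nonneg _), norm_sq_plane, norm_sq_plane]
    simp [hG]; ring
  have hFG : ⟪F, G⟫ = 0 := by rw [inner_plane]; simp [hG]; ring
  have hca : ‖F‖ / 2 < a := by nlinarith [sq_pos_of_pos hb]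
  have m1 := hmem ((1 / 2 + a / ‖F‖) • F) (by
    have : (1 / 2 + a / ‖F‖) • F - F = (a / ‖F‖ - 1 / 2) • F := by module
    rw [this, norm_smul, norm_smul, Real.norm_of_nonneg (by positivity),
      Real.norm_of_nonneg (by rw [sub_nonneg, le_div_iff₀ hc]; linarith)]
    field_simp
    ring)
  have m2 := hmem ((1 / 2 - a / ‖F‖) • F) (by
    have : (1 / 2 - a / ‖F‖) • F - F = (-(a / ‖F‖ + 1 / 2)) • F := by module
    rw [this, norm_smul, norm_smul, norm_neg,
      Real.norm_of_nonpos (by rw [sub_nonpos, le_div_iff₀ hc]; linarith),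
      Real.norm_of_nonneg (by positivity)]
    field_simp
    ring)
  have hn : ∀ s : ℝ, s ^ 2 = 1 → ∀ s' : ℝ, s' ^ 2 = 1 →
      ‖(s' / 2) • F + (s * b / ‖F‖) • G‖ = a := by
    intro s hs s' hs'
    rw [← sq_eq_sq₀ (norm_nonneg _) ha.le, norm_add_sq_real, inner_smul_left, inner_smul_right, hFG,
      norm_smul, norm_smul, hGn, mul_pow, mul_pow, Real.norm_eq_abs, Real.norm_eq_abs, sq_abs,
      sq_abs, ← hF]
    field_simp
    rw [hs, hs']
    ring
  have m3 := hmem ((1 / 2 : ℝ) • F + (1 * b / ‖F‖) • G) (by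
    have : (1 / 2 : ℝ) • F + (1 * b / ‖F‖) • G - F = ((-1) / 2 : ℝ) • F + (1 * b / ‖F‖) • G := by
      module
    rw [this, hn 1 (by norm_num) 1 (by norm_num), hn 1 (by norm_num) (-1) (by norm_num)]
    ring)
  have m4 := hmem ((1 / 2 : ℝ) • F + ((-1) * b / ‖F‖) • G) (by
    have : (1 / 2 : ℝ) • F + ((-1) * b / ‖F‖) • G - F =
      ((-1) / 2 : ℝ) • F + ((-1) * b / ‖F‖) • G := by module
    rw [this, hn (-1) (by norm_num) 1 (by norm_num), hn (-1) (by norm_num) (-1) (by norm_num)]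
    ring)
  set B := (2 * a) • A + F with hB
  rw [inner_smul_left] at m1 m2
  rw [inner_add_left, inner_smul_left, inner_smul_left] at m3 m4
  simp only [conj_trivial] at m1 m2 m3 m4
  have z1 : ⟪F, B⟫ = 0 := by
    have : (2 * (a / ‖F‖)) * ⟪F, B⟫ = 0 := by linear_combination m1 - m2
    exact (mul_eq_zero.mp this).resolve_left (by positivity)
  have z2 : ⟪G, B⟫ = 0 := by
    have : (2 * (b / ‖F‖)) * ⟪G, B⟫ = 0 := by linear_combination m3 - m4
    exact (mul_eq_zero.mp this).resolve_left (by positivity)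
  have z3 : a * l ^ 2 = b ^ 2 := by rw [z1] at m1; linarith
  refine ⟨z3, ?_⟩
  have hB0 : B = 0 := by
    have hF2 : ‖F‖ ^ 2 ≠ 0 := by positivity
    rw [norm_sq_plane] at hF2
    rw [inner_plane] at z1 z2
    simp only [hG, PiLp.toLp_apply, Matrix.cons_val_zero, Matrix.cons_val_one] at z2
    refine plane_ext ?_ ?_ <;>
      refine (mul_eq_zero.mp (?_ : (F 0 ^ 2 + F 1 ^ 2) * _ = 0)).resolve_left hF2
    · linear_combination F 0 * z1 - F 1 * z2
    · linear_combination F 1 * z1 + F 0 * z2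
  have : (2 * a) • A = -F := by rw [hB] at hB0; exact eq_neg_of_add_eq_zero_left hB0
  have h4 := congrArg (fun p => ‖p‖ ^ 2) this
  simp only [norm_smul, norm_neg, mul_pow, Real.norm_eq_abs, sq_abs] at h4
  linear_combination h4 / 4 + hF

end IsKepler

/-! ### Polar angle, period and the precession integral. -/

/-- The force is Lipschitz away from the origin. -/
theorem norm_force_sub_le {ρ : ℝ} (hρ : 0 < ρ) {x y : Plane} (hx : ρ ≤ ‖x‖) (hy : ρ ≤ ‖y‖) :
    ‖force x - force y‖ ≤ 4 / ρ ^ 3 * ‖x - y‖ := by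
  have hx0 : 0 < ‖x‖ := hρ.trans_le hx
  have hy0 : 0 < ‖y‖ := hρ.trans_le hy
  have e : force x - force y = (-(‖x‖ ^ 3)⁻¹) • (x - y) + ((‖y‖ ^ 3)⁻¹ - (‖x‖ ^ 3)⁻¹) • y := by
    simp only [force]; module
  have e2 : ((‖y‖ ^ 3)⁻¹ - (‖x‖ ^ 3)⁻¹) * ‖y‖ =
      (‖x‖ - ‖y‖) * ((‖x‖ * ‖y‖ ^ 2)⁻¹ + (‖x‖ ^ 2 * ‖y‖)⁻¹ + (‖x‖ ^ 3)⁻¹) := by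
    field_simp
    ring
  have i1 : (‖x‖ ^ 3)⁻¹ ≤ (ρ ^ 3)⁻¹ := by gcongr
  have i2 : (‖x‖ * ‖y‖ ^ 2)⁻¹ ≤ (ρ ^ 3)⁻¹ := by
    rw [show ρ ^ 3 = ρ * ρ ^ 2 by ring]; gcongr
  have i3 : (‖x‖ ^ 2 * ‖y‖)⁻¹ ≤ (ρ ^ 3)⁻¹ := by
    rw [show ρ ^ 3 = ρ ^ 2 * ρ by ring]; gcongr
  have n2 : ‖((‖y‖ ^ 3)⁻¹ - (‖x‖ ^ 3)⁻¹) • y‖ ≤ ‖x - y‖ * (3 * (ρ ^ 3)⁻¹) := by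
    rw [norm_smul, ← norm_norm y, ← norm_mul, norm_norm, e2, norm_mul]
    refine mul_le_mul (abs_norm_sub_norm_le x y) ?_ (norm_nonneg _) (norm_nonneg _)
    rw [Real.norm_of_nonneg (by positivity)]
    linarith
  have n1 : ‖(-(‖x‖ ^ 3)⁻¹) • (x - y)‖ ≤ (ρ ^ 3)⁻¹ * ‖x - y‖ := by
    rw [norm_smul, norm_neg, Real.norm_of_nonneg (by positivity)]
    gcongr
  rw [e, div_eq_mul_inv]
  exact (norm_add_le _ _).trans (by linarith)

/-- The angular velocity of the precession, divided by `ε`. -/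
def precessionSpeed (σ ε : ℝ) (x v : Plane) : ℝ :=
  cross (lrl x v) (lrlDot x v (perturbation σ ε x v)) / ‖lrl x v‖ ^ 2

namespace IsKepler

variable {γ γ' : ℝ → Plane} (hγ : IsKepler γ γ')
include hγ

/-- The conic equation and Cauchy-Schwarz bound the perihelion distance. This keeps the whole orbit
where the force is Lipschitz. -/
theorem le_norm (t : ℝ) :
    angularMomentum (γ 0) (γ' 0) ^ 2 / (1 + ‖lrl (γ 0) (γ' 0)‖) ≤ ‖γ t‖ := by
  have h := inner_lrl (γ t) (γ' t)
  rw [hγ.lrl_eq, hγ.angularMomentum_eq] at h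
  have h2 := real_inner_le_norm (lrl (γ 0) (γ' 0)) (γ t)
  rw [div_le_iff₀ (by positivity)]
  nlinarith

/-- A Kepler motion is determined by its initial data. -/
theorem unique (hl : angularMomentum (γ 0) (γ' 0) ≠ 0) {t₁ : ℝ} (h1 : γ t₁ = γ 0)
    (h1' : γ' t₁ = γ' 0) : Function.Periodic γ t₁ := by
  set ρ := angularMomentum (γ 0) (γ' 0) ^ 2 / (1 + ‖lrl (γ 0) (γ' 0)‖)
  have hρ : 0 < ρ := by positivity
  have hlip : LipschitzOnWith (max 1 (4 / ρ ^ 3).toNNReal)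
      (fun z : Plane × Plane => (z.2, force z.1)) {z | ρ ≤ ‖z.1‖} := by
    refine LipschitzOnWith.of_dist_le_mul fun z hz w hw => ?_
    rw [Prod.dist_eq, NNReal.coe_max, NNReal.coe_one, Real.coe_toNNReal _ (by positivity)]
    refine max_le ?_ ?_
    · calc dist z.2 w.2 ≤ 1 * dist z w := by rw [one_mul]; exact le_max_right _ _
        _ ≤ _ := by gcongr; exact le_max_left _ _
    · dsimp only
      rw [dist_eq_norm]
      calc _ ≤ 4 / ρ ^ 3 * ‖z.1 - w.1‖ := norm_force_sub_le hρ hz hw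
        _ ≤ 4 / ρ ^ 3 * dist z w := by
          gcongr; rw [← dist_eq_norm]; exact le_max_left _ _
        _ ≤ _ := by gcongr; exact le_max_right _ _
  have := ODE_solution_unique_univ (v := fun _ (z : Plane × Plane) => (z.2, force z.1))
    (s := fun _ => {z | ρ ≤ ‖z.1‖}) (t₀ := 0) (f := fun t => (γ (t + t₁), γ' (t + t₁)))
    (g := fun t => (γ t, γ' t)) (fun _ => hlip)
    (fun t => ⟨((hγ (t + t₁)).2.1.comp_add_const t t₁).prodMk
      ((hγ (t + t₁)).2.2.comp_add_const t t₁), hγ.le_norm _⟩)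
    (fun t => ⟨(hγ t).2.1.prodMk (hγ t).2.2, hγ.le_norm t⟩) (by simp [h1, h1'])
  intro t
  exact congrArg Prod.fst (congrFun this t)

/-- The polar angle of a Kepler motion, which makes exactly one turn in one period. -/
theorem exists_angle (hl : angularMomentum (γ 0) (γ' 0) ≠ 0) {T : ℝ} (hT : IsPeriod γ T) :
    ∃ φ : ℝ → ℝ, (∀ t, HasDerivAt φ (angularMomentum (γ 0) (γ' 0) * ‖γ t‖⁻¹ ^ 2) t) ∧
      φ T - φ 0 = Real.sign (angularMomentum (γ 0) (γ' 0)) * (2 * Real.pi) := by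
  set l := angularMomentum (γ 0) (γ' 0) with hl_def
  have hr : ∀ t, ‖γ t‖ ≠ 0 := fun t => norm_ne_zero_iff.mpr (hγ t).1
  have hγc : Continuous γ := continuous_iff_continuousAt.mpr fun t => (hγ t).2.1.continuousAt
  have hc : Continuous fun t => l * ‖γ t‖⁻¹ ^ 2 :=
    continuous_const.mul ((hγc.norm.inv₀ hr).pow 2)
  set φ : ℝ → ℝ := fun t => ∫ τ in (0 : ℝ)..t, l * ‖γ τ‖⁻¹ ^ 2 with hφ_def
  have hφ : ∀ t, HasDerivAt φ (l * ‖γ t‖⁻¹ ^ 2) t := fun t =>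
    (hc.integral_hasStrictDerivAt 0 t).hasDerivAt
  have hφ0 : φ 0 = 0 := by simp [hφ_def]
  refine ⟨φ, hφ, ?_⟩
  have hang : ∀ t, γ t 0 * γ' t 1 - γ' t 0 * γ t 1 = l := hγ.angularMomentum_eq
  have hrs : ∀ t, ‖γ t‖⁻¹ ^ 2 * (γ t 0 ^ 2 + γ t 1 ^ 2) = 1 := fun t => by
    rw [← norm_sq_plane, ← mul_pow, inv_mul_cancel₀ (hr t), one_pow]
  have hu0 : ∀ t, HasDerivAt (fun s => ‖γ s‖⁻¹ * γ s 0)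
      (-(l * ‖γ t‖⁻¹ ^ 2) * (‖γ t‖⁻¹ * γ t 1)) t := by
    intro t
    have h1 := hasDerivAt_norm_pow_inv 1 (hγ t).2.1 (hγ t).1
    simp only [pow_one] at h1
    refine (h1.fun_mul (hasDerivAt_coord (hγ t).2.1 0)).congr_deriv ?_
    rw [inner_plane, ← hang t]
    push_cast
    linear_combination -(‖γ t‖⁻¹ * γ' t 0) * hrs t
  have hu1 : ∀ t, HasDerivAt (fun s => ‖γ s‖⁻¹ * γ s 1)
      ((l * ‖γ t‖⁻¹ ^ 2) * (‖γ t‖⁻¹ * γ t 0)) t := by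
    intro t
    have h1 := hasDerivAt_norm_pow_inv 1 (hγ t).2.1 (hγ t).1
    simp only [pow_one] at h1
    refine (h1.fun_mul (hasDerivAt_coord (hγ t).2.1 1)).congr_deriv ?_
    rw [inner_plane, ← hang t]
    push_cast
    linear_combination -(‖γ t‖⁻¹ * γ' t 1) * hrs t
  -- The unit position vector, rotated back by φ, is constant.
  have hy0 : ∀ t, Real.cos (φ t) * (‖γ t‖⁻¹ * γ t 0) + Real.sin (φ t) * (‖γ t‖⁻¹ * γ t 1) =
      ‖γ 0‖⁻¹ * γ 0 0 := by
    intro t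
    have hd : ∀ t, HasDerivAt (fun t => Real.cos (φ t) * (‖γ t‖⁻¹ * γ t 0) +
        Real.sin (φ t) * (‖γ t‖⁻¹ * γ t 1)) 0 t := fun t =>
      (((hφ t).cos.fun_mul (hu0 t)).fun_add ((hφ t).sin.fun_mul (hu1 t))).congr_deriv (by ring)
    have := is_const_of_deriv_eq_zero (fun t => (hd t).differentiableAt) (fun t => (hd t).deriv) t 0
    simpa [hφ0] using this
  have hy1 : ∀ t, Real.cos (φ t) * (‖γ t‖⁻¹ * γ t 1) - Real.sin (φ t) * (‖γ t‖⁻¹ * γ t 0) =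
      ‖γ 0‖⁻¹ * γ 0 1 := by
    intro t
    have hd : ∀ t, HasDerivAt (fun t => Real.cos (φ t) * (‖γ t‖⁻¹ * γ t 1) -
        Real.sin (φ t) * (‖γ t‖⁻¹ * γ t 0)) 0 t := fun t =>
      (((hφ t).cos.fun_mul (hu1 t)).fun_sub ((hφ t).sin.fun_mul (hu0 t))).congr_deriv (by ring)
    have := is_const_of_deriv_eq_zero (fun t => (hd t).differentiableAt) (fun t => (hd t).deriv) t 0
    simpa [hφ0] using this
  obtain ⟨⟨hT0, hper⟩, hmin⟩ := hT
  have hTγ : γ T = γ 0 := by simpa using hper 0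
  have hcos : Real.cos (φ T) = 1 := by
    have h0 := hy0 T
    have h1 := hy1 T
    have h2 := hrs 0
    rw [hTγ] at h0 h1
    linear_combination (‖γ 0‖⁻¹ * γ 0 0) * h0 + (‖γ 0‖⁻¹ * γ 0 1) * h1 +
      (1 - Real.cos (φ T)) * h2
  set ψ : ℝ → ℝ := fun t => Real.sign l * φ t with hψ_def
  have hsl : Real.sign l * l = |l| := by
    rcases lt_or_gt_of_ne hl with h | h
    · rw [Real.sign_of_neg h, abs_of_neg h, neg_one_mul]
    · rw [Real.sign_of_pos h, abs_of_pos h, one_mul]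
  have hψ : ∀ t, HasDerivAt ψ (|l| * ‖γ t‖⁻¹ ^ 2) t := fun t =>
    ((hφ t).const_mul (Real.sign l)).congr_deriv (by rw [← hsl]; ring)
  have hss : Real.sign l = 1 ∨ Real.sign l = -1 := by
    rcases lt_or_gt_of_ne hl with h | h
    · exact Or.inr (Real.sign_of_neg h)
    · exact Or.inl (Real.sign_of_pos h)
  have hcosψ : ∀ t, Real.cos (ψ t) = Real.cos (φ t) := fun t => by
    rcases hss with h | h <;> simp [hψ_def, h]
  have hmono : StrictMono ψ := strictMono_of_hasDerivAt_pos hψ fun t => by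
    have := hr t
    positivity
  have hψ0 : ψ 0 = 0 := by simp [hψ_def, hφ0]
  have hψT : 0 < ψ T := hψ0 ▸ hmono hT0
  -- Periodicity makes the angle at T a positive multiple of 2π. For equality, consider the time t₁
  -- ≤ T of the first full turn: the direction has returned, hence by the conic equation the radius,
  -- and by conservation of the Laplace-Runge-Lenz vector the velocity. So t₁ is a period, and
  -- minimality of T gives t₁ = T.
  have h2π : 2 * Real.pi ≤ ψ T := by
    obtain ⟨n, hn⟩ := (Real.cos_eq_one_iff _).mp ((hcosψ T).trans hcos)
    rw [← hn] at hψT ⊢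
    have : 0 < n := by
      by_contra! h
      have : (n : ℝ) ≤ 0 := by exact_mod_cast h
      nlinarith [Real.pi_pos]
    have : (1 : ℝ) ≤ n := by exact_mod_cast this
    nlinarith [Real.pi_pos]
  have hψc : Continuous ψ := continuous_iff_continuousAt.mpr fun t => (hψ t).continuousAt
  obtain ⟨t₁, ht₁, ht₁ψ⟩ := intermediate_value_Icc hT0.le hψc.continuousOn
    (show 2 * Real.pi ∈ Icc (ψ 0) (ψ T) from ⟨by rw [hψ0]; positivity, h2π⟩)
  have ht₁0 : 0 < t₁ := by
    rw [← hmono.lt_iff_lt, ht₁ψ, hψ0]; positivity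
  have hc1 : Real.cos (φ t₁) = 1 := by rw [← hcosψ, ht₁ψ, Real.cos_two_pi]
  have hs1 : Real.sin (φ t₁) = 0 := by
    have := Real.sin_sq_add_cos_sq (φ t₁)
    rw [hc1] at this
    nlinarith
  have e0 := hy0 t₁
  have e1 := hy1 t₁
  simp only [hc1, hs1, one_mul, zero_mul, add_zero, sub_zero] at e0 e1
  have hconic : ∀ t, ‖γ t‖⁻¹ * l ^ 2 = 1 + lrl (γ 0) (γ' 0) 0 * (‖γ t‖⁻¹ * γ t 0) +
      lrl (γ 0) (γ' 0) 1 * (‖γ t‖⁻¹ * γ t 1) := fun t => by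
    have h := inner_lrl (γ t) (γ' t)
    rw [hγ.lrl_eq, hγ.angularMomentum_eq, inner_plane] at h
    have h' : ‖γ t‖⁻¹ * ‖γ t‖ = 1 := inv_mul_cancel₀ (hr t)
    linear_combination -‖γ t‖⁻¹ * h + h'
  have hrr : ‖γ t₁‖⁻¹ = ‖γ 0‖⁻¹ := by
    have h := hconic t₁
    rw [e0, e1, ← hconic 0] at h
    exact mul_right_cancel₀ (pow_ne_zero 2 hl) h
  have hx : γ t₁ = γ 0 := by
    rw [hrr] at e0 e1
    exact plane_ext (mul_left_cancel₀ (inv_ne_zero (hr 0)) e0)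
      (mul_left_cancel₀ (inv_ne_zero (hr 0)) e1)
  have hv : γ' t₁ = γ' 0 := by
    have a0 := lrl_zero (γ t₁) (γ' t₁)
    have a1 := lrl_one (γ t₁) (γ' t₁)
    rw [hγ.lrl_eq, hγ.angularMomentum_eq, lrl_zero, hx, ← hl_def] at a0
    rw [hγ.lrl_eq, hγ.angularMomentum_eq, lrl_one, hx, ← hl_def] at a1
    refine plane_ext (mul_left_cancel₀ hl ?_) (mul_left_cancel₀ hl ?_)
    · linear_combination a1
    · linear_combination -a0
  have hle : T ≤ t₁ := hmin ⟨ht₁0, hγ.unique hl hx hv⟩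
  have hTt : t₁ = T := le_antisymm ht₁.2 hle
  rw [hTt] at ht₁ψ
  rw [hφ0, sub_zero, ← ht₁ψ, hψ_def, ← mul_assoc]
  rcases hss with h | h <;> simp [h]

/-- The integral of the leading order precession speed over one period. -/
theorem exists_precession (hl : angularMomentum (γ 0) (γ' 0) ≠ 0)
    (hA : lrl (γ 0) (γ' 0) ≠ 0) {T : ℝ} (hT : IsPeriod γ T) (σ : ℝ) :
    ∃ Ψ : ℝ → ℝ, (∀ t, HasDerivAt Ψ (precessionSpeed σ 0 (γ t) (γ' t)) t) ∧
      Ψ T - Ψ 0 = Real.sign (angularMomentum (γ 0) (γ' 0)) * Real.pi * (1 + σ) *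
        (4 + ‖lrl (γ 0) (γ' 0)‖ ^ 2) / (8 * angularMomentum (γ 0) (γ' 0) ^ 6) := by
  obtain ⟨φ, hφ, hφT⟩ := hγ.exists_angle hl hT
  have hr : ∀ t, ‖γ t‖ ≠ 0 := fun t => norm_ne_zero_iff.mpr (hγ t).1
  set l := angularMomentum (γ 0) (γ' 0) with hl_def
  have he0 : ‖lrl (γ 0) (γ' 0)‖ ≠ 0 := norm_ne_zero_iff.mpr hA
  set E := ‖lrl (γ 0) (γ' 0)‖ ^ 2 with hE
  have hE0 : E ≠ 0 := pow_ne_zero 2 he0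
  -- Twice the Kepler energy.
  set m := (E - 1) / l ^ 2 with hm_def
  have hm : ∀ t, ‖γ' t‖ ^ 2 = 2 * ‖γ t‖⁻¹ + m := fun t => by
    have := norm_lrl_sq (hγ t).1 (γ' t)
    rw [hγ.lrl_eq, hγ.angularMomentum_eq, ← hE, ← hl_def] at this
    rw [hm_def]
    field_simp at this ⊢
    linear_combination -this
  have hs : ∀ t, ⟪γ t, γ' t⟫ ^ 2 * ‖γ t‖⁻¹ ^ 2 =
      2 * ‖γ t‖⁻¹ + m - l ^ 2 * ‖γ t‖⁻¹ ^ 2 := fun t => by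
    have h1 := angularMomentum_sq (γ t) (γ' t)
    rw [hγ.angularMomentum_eq, ← hl_def, hm] at h1
    have h2 : ‖γ t‖ * ‖γ t‖⁻¹ = 1 := mul_inv_cancel₀ (hr t)
    linear_combination ‖γ t‖⁻¹ ^ 2 * h1 +
      (‖γ t‖ * ‖γ t‖⁻¹ + 1) * (2 * ‖γ t‖⁻¹ + m) * h2
  -- Reduction formula: modulo derivatives of periodic functions, a power of 1/|γ| is expressed by
  -- the next two lower powers.
  have hB : ∀ (n : ℕ) (t : ℝ), HasDerivAt (fun t => ⟪γ t, γ' t⟫ * (‖γ t‖ ^ n)⁻¹)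
      (n * l ^ 2 * ‖γ t‖⁻¹ ^ (n + 2) - (2 * n - 1) * ‖γ t‖⁻¹ ^ (n + 1) -
        (n - 1) * m * ‖γ t‖⁻¹ ^ n) t := by
    intro n t
    have h1 := hasDerivAt_norm_pow_inv n (hγ t).2.1 (hγ t).1
    have h2 := (hγ t).2.1.inner ℝ (hγ t).2.2
    have h3 : ⟪γ t, force (γ t)⟫ = -‖γ t‖⁻¹ := by
      rw [force, inner_neg_right, inner_smul_right, real_inner_self_eq_norm_sq]
      have := hr t
      field_simp
    refine (h2.fun_mul h1).congr_deriv ?_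
    rw [h3, real_inner_self_eq_norm_sq, hm, ← inv_pow, ← inv_pow]
    linear_combination -n * ‖γ t‖⁻¹ ^ n * hs t
  set κ₁ := 5 / (3 * l ^ 2) + m with hκ₁
  set κ₂ := 2 * m / (3 * l ^ 2) + 3 * κ₁ / (2 * l ^ 2) with hκ₂
  -- In the formula `hk` for the speed, the part outside the factor 4 + 4σ is exactly -3σl² times
  -- the derivative for n = 5. The rest, l²u⁶ - u⁵ with u = 1/|γ|, is lowered by n = 4, 3, 2, 1 to a
  -- multiple of u²; κ₁ and κ₂ are the coefficients of u⁴ and u³ that arise on the way. Only the φ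
  -- term changes over a period.
  refine ⟨fun t => l / (24 * E) * ((4 + 4 * σ) * (1 / 4 * (⟪γ t, γ' t⟫ * (‖γ t‖ ^ 4)⁻¹) +
    3 / 4 * (1 / (3 * l ^ 2) * (⟪γ t, γ' t⟫ * (‖γ t‖ ^ 3)⁻¹) +
      κ₁ / (2 * l ^ 2) * (⟪γ t, γ' t⟫ * (‖γ t‖ ^ 2)⁻¹) +
      κ₂ / l ^ 2 * (⟪γ t, γ' t⟫ * (‖γ t‖ ^ 1)⁻¹))) -
        3 * σ * l ^ 2 * (⟪γ t, γ' t⟫ * (‖γ t‖ ^ 5)⁻¹)) +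
      (1 + σ) * (4 + E) / (16 * l ^ 6) * φ t, fun t => ?_, ?_⟩
  · refine (((((((hB 4 t).const_mul (1 / 4)).fun_add (((((hB 3 t).const_mul (1 / (3 * l ^ 2))).fun_add
      ((hB 2 t).const_mul (κ₁ / (2 * l ^ 2)))).fun_add ((hB 1 t).const_mul (κ₂ / l ^ 2))).const_mul
        (3 / 4))).const_mul (4 + 4 * σ)).fun_sub ((hB 5 t).const_mul (3 * σ * l ^ 2))).const_mul
          (l / (24 * E))).fun_add ((hφ t).const_mul _)).congr_deriv ?_
    have hk : precessionSpeed σ 0 (γ t) (γ' t) = l / (24 * E) *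
        ((4 + 4 * σ) * (l ^ 2 * ‖γ t‖⁻¹ ^ 6 - ‖γ t‖⁻¹ ^ 5) + σ * (27 * l ^ 2 * ‖γ t‖⁻¹ ^ 6 +
          12 * m * l ^ 2 * ‖γ t‖⁻¹ ^ 5 - 15 * l ^ 4 * ‖γ t‖⁻¹ ^ 7)) := by
      have h2 : ‖γ t‖ * ‖γ t‖⁻¹ = 1 := mul_inv_cancel₀ (hr t)
      have hp : perturbation σ 0 (γ t) (γ' t) = radialCoeff σ (γ t) (γ' t) • γ t +
          velocityCoeff σ (γ t) (γ' t) • γ' t := by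
        simp [perturbation, leadingPerturbation]
      rw [precessionSpeed, hp, cross_lrl_lrlDot (hγ t).1, hγ.lrl_eq, hγ.angularMomentum_eq, ← hE,
        ← hl_def, radialCoeff, velocityCoeff, hm]
      simp only [← inv_pow]
      have h3 := hs t
      generalize ‖γ t‖⁻¹ = u at *
      generalize ⟪γ t, γ' t⟫ = s at *
      rw [div_eq_iff hE0]
      have h4 : l / (24 * E) * E = l / 24 := by field_simp
      rw [mul_right_comm (l / (24 * E)), h4]
      linear_combination (l / 24) * ((-(4 + 4 * σ) * u ^ 5 + σ * (3 * (2 * u + m) * u ^ 4 -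
        15 * s ^ 2 * u ^ 6)) * h2 + σ * (15 * l ^ 2 * u ^ 5 - 3 * u ^ 4) * h3)
    rw [hk, hκ₂, hκ₁, hm_def]
    push_cast
    field_simp
    ring
  · have hper : γ T = γ 0 := by simpa using hT.1.2 0
    have hper' : γ' T = γ' 0 := by
      have h1 : HasDerivAt γ (γ' T) 0 := by
        have := (hγ (0 + T)).2.1.comp_add_const 0 T
        rw [zero_add] at this
        exact this.congr_of_eventuallyEq (.of_forall fun t => (hT.1.2 t).symm)
      exact h1.unique (hγ 0).2.1
    simp only [hper, hper']
    rw [add_sub_add_left_eq_sub, ← mul_sub, hφT]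
    field_simp
    ring

end IsKepler

/-! ### Perturbations of an elliptic orbit -/

theorem hasDerivAt_state {s : ℝ → State} {s' : State} {t : ℝ} (hs : HasDerivAt s s' t) :
    HasDerivAt (fun τ => (s τ).1) s'.1 t ∧ HasDerivAt (fun τ => (s τ).2.1) s'.2.1 t ∧
      HasDerivAt (fun τ => (s τ).2.2) s'.2.2 t :=
  have h2 : HasDerivAt (fun τ => (s τ).2) s'.2 t :=
    (ContinuousLinearMap.snd ℝ ℝ (Plane × Plane)).hasFDerivAt.comp_hasDerivAt t hs
  ⟨(ContinuousLinearMap.fst ℝ ℝ (Plane × Plane)).hasFDerivAt.comp_hasDerivAt t hs,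
    (ContinuousLinearMap.fst ℝ Plane Plane).hasFDerivAt.comp_hasDerivAt t h2,
    (ContinuousLinearMap.snd ℝ Plane Plane).hasFDerivAt.comp_hasDerivAt t h2⟩

/-- The flow of the Euler-Lagrange equations near a Kepler motion. -/
theorem IsKepler.exists_flow {γ γ' : ℝ → Plane} (hγ : IsKepler γ γ')
    (hA : lrl (γ 0) (γ' 0) ≠ 0) {T : ℝ} (hT : 0 ≤ T) (σ : ℝ) :
    ∃ K ⊆ regular σ, IsCompact K ∧ ∃ δ > 0, ∃ A ≥ 1, ∃ Φ : State → ℝ → State,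
      (∀ t ∈ Icc 0 T, ((0, γ t, γ' t) : State) ∈ K) ∧
      (∀ z : State, A * dist z (0, γ 0, γ' 0) ≤ δ → Φ z 0 = z ∧ ∀ t ∈ Icc 0 T,
        (Φ z t).1 = z.1 ∧ Φ z t ∈ K ∧ HasDerivAt (Φ z) (field σ (Φ z t)) t ∧
        dist (Φ z t) (0, γ t, γ' t) ≤ A * dist z (0, γ 0, γ' 0)) ∧
      (∀ z z', ∀ t ∈ Icc 0 T, dist (Φ z t) (Φ z' t) ≤ A * dist z z') := by
  obtain ⟨K, hKU, hK, δ, hδ, A, hA1, Φ, h1, h2, h3⟩ := Kepler.exists_flow (isOpen_regular σ)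
    (contDiffOn_field σ) (c := fun t => (0, γ t, γ' t)) hT (fun t _ => by
      refine ⟨⟨(hγ t).1, by simp [massTrans], by simp [massRad], by simpa [hγ.lrl_eq t] using hA⟩,
        ?_⟩
      simp only [field, acceleration_zero]
      exact (hasDerivAt_const t (0 : ℝ)).prodMk ((hγ t).2.1.prodMk (hγ t).2.2))
  refine ⟨K, hKU, hK, δ, hδ, A, hA1, Φ, fun t ht => h1 t ht _ (by simp [hδ.le]), fun z hz => ?_, h3⟩
  obtain ⟨h20, h2⟩ := h2 z hz
  refine ⟨h20, fun t ht => ⟨?_, h1 t ht _ ((h2 t ht).2.trans hz), (h2 t ht).1, (h2 t ht).2⟩⟩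
  have hd : ∀ τ ∈ Icc 0 T, HasDerivAt (fun τ => (Φ z τ).1) 0 τ := fun τ hτ => 
    (hasDerivAt_state (h2 τ hτ).1).1
  have := (convex_Icc 0 T).norm_image_sub_le_of_norm_hasDerivWithin_le (C := 0)
    (fun τ hτ => (hd τ hτ).hasDerivWithinAt) (by simp) (left_mem_Icc.mpr hT) ht
  rw [zero_mul, norm_le_zero_iff, sub_eq_zero, h20] at this
  exact this

/-- Integral curves of the vector field give motions. -/
theorem isMotion_of_field {σ h : ℝ} {J : Set ℝ} {s : ℝ → State}
    (hs : ∀ t ∈ J, (s t).1 = h ^ 2 ∧ s t ∈ regular σ ∧ HasDerivAt s (field σ (s t)) t) :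
    IsMotion (modLagrangian σ h) J (fun t => (s t).2.1) (fun t => (s t).2.2) := by
  refine isMotion_of_hasDerivWithinAt fun t ht => ?_
  obtain ⟨h1, h2, h3⟩ := hs t ht
  rw [← h1]
  exact ⟨h2.1, h2.2.1, h2.2.2.1, (hasDerivAt_state h3).2.1.hasDerivWithinAt,
    (hasDerivAt_state h3).2.2.hasDerivWithinAt⟩

theorem contDiffOn_precessionSpeed (σ : ℝ) :
    ContDiffOn ℝ ∞ (fun s : State => precessionSpeed σ s.1 s.2.1 s.2.2) (regular σ) := by
  intro s hs
  obtain ⟨he, hx, hv⟩ := contDiffAt_state s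
  have ha := contDiffAt_perturbation he hx hv hs.1 hs.2.1 hs.2.2.1
  have hl := contDiffAt_lrl hx hv hs.1
  have hd : ContDiffAt ℝ ∞
      (fun s : State => lrlDot s.2.1 s.2.2 (perturbation σ s.1 s.2.1 s.2.2)) s :=
    (((contDiffAt_const.mul (hv.inner ℝ ha)).smul hx).sub ((hx.inner ℝ ha).smul hv)).sub
      ((hx.inner ℝ hv).smul ha)
  have hc : ∀ {f : State → Plane}, ContDiffAt ℝ ∞ f s → ∀ i, ContDiffAt ℝ ∞ (fun y => f y i) s :=
    fun hf i => (EuclideanSpace.proj (𝕜 := ℝ) i).contDiff.contDiffAt.comp s hf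
  exact (((((hc hl 0).mul (hc hd 1)).sub ((hc hl 1).mul (hc hd 0))).div (hl.norm_sq ℝ)
    (pow_ne_zero 2 (norm_ne_zero_iff.mpr hs.2.2.2)))).contDiffWithinAt

/-- The angle change of a curve that stays near a point. -/
theorem exists_hasAngleChange {Z Z' : ℝ → Plane} {A : Plane} {T ε C : ℝ} (hT : 0 ≤ T)
    {Ψ k : ℝ → ℝ} (hZ : ∀ t ∈ Icc 0 T, HasDerivAt Z (Z' t) t)
    (hZA : ∀ t ∈ Icc 0 T, ‖Z t - A‖ < ‖A‖) (hΨ : ∀ t ∈ Icc 0 T, HasDerivAt Ψ (k t) t)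
    (hC : ∀ t ∈ Icc 0 T, |cross (Z t) (Z' t) / ‖Z t‖ ^ 2 - ε * k t| ≤ C) :
    ∃ Δ, HasAngleChange Z T Δ ∧ |Δ - (Ψ T - Ψ 0) * ε| ≤ C * T := by
  set ι : Plane → ℂ := fun x => ⟨x 0, x 1⟩ with hι
  have hn : ∀ x, ‖ι x‖ = ‖x‖ := fun x => by
    rw [← sq_eq_sq₀ (norm_nonneg _) (norm_nonneg _), norm_sq_plane, Complex.sq_norm,
      Complex.normSq_apply]
    ring
  have hA : ∀ t ∈ Icc 0 T, 0 < ‖A‖ := fun t ht => (norm_nonneg _).trans_lt (hZA t ht)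
  have hA0 : 0 < ‖A‖ := hA 0 (left_mem_Icc.mpr hT)
  have hA0' : ι A ≠ 0 := by rw [← norm_pos_iff, hn]; exact hA0
  have hZ0 : ∀ t ∈ Icc 0 T, Z t ≠ 0 := fun t ht h => by
    have := hZA t ht
    rw [h, zero_sub, norm_neg] at this
    exact lt_irrefl _ this
  -- Division by A moves the curve into the unit disc around 1, where the principal logarithm is
  -- smooth and supplies a continuous angle.
  have hζs : ∀ t ∈ Icc 0 T, ι (Z t) / ι A ∈ Complex.slitPlane := by
    intro t ht
    refine Complex.mem_slitPlane_of_norm_lt_one (z := ι (Z t) / ι A - 1) ?_ |> fun h => by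
      simpa using h
    have : ι (Z t) / ι A - 1 = ι (Z t - A) / ι A := by
      rw [div_sub_one hA0']
      congr 1
    rw [this, norm_div, hn, hn, div_lt_one hA0]
    exact hZA t ht
  have hιd : ∀ t ∈ Icc 0 T, HasDerivAt (fun t => ι (Z t)) (ι (Z' t)) t := by
    intro t ht
    have h0 := (hasDerivAt_coord (hZ t ht) 0).ofReal_comp
    have h1 := (hasDerivAt_coord (hZ t ht) 1).ofReal_comp
    have h := h0.fun_add (h1.mul_const Complex.I)
    have e : ∀ x, ι x = (x 0 : ℂ) + (x 1 : ℂ) * Complex.I := fun x => by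
      simp [hι, Complex.mk_eq_add_mul_I]
    simpa only [e] using h
  set ϑ : ℝ → ℝ := fun t => (ι A).arg + (Complex.log (ι (Z t) / ι A)).im with hϑ
  have hϑd : ∀ t ∈ Icc 0 T, HasDerivAt ϑ (cross (Z t) (Z' t) / ‖Z t‖ ^ 2) t := by
    intro t ht
    have h := ((hιd t ht).div_const (ι A)).clog_real (hζs t ht)
    have h' := (Complex.imCLM.hasFDerivAt.comp_hasDerivAt t h).const_add (ι A).arg
    refine h'.congr_deriv ?_
    rw [div_div_div_cancel_right₀ hA0', ← hn, Complex.sq_norm, Complex.imCLM_apply, Complex.div_im]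
    simp only [hι, cross]
    ring
  refine ⟨ϑ T - ϑ 0, ⟨ϑ, fun t ht => (hϑd t ht).continuousAt.continuousWithinAt, rfl,
    fun t ht => ⟨hZ0 t ht, ?_⟩⟩, ?_⟩
  · have h1 : ι (Z t) = ‖Z t‖ * Complex.exp (ϑ t * Complex.I) := by
      have e1 : ι (Z t) = ι A * (ι (Z t) / ι A) := by field_simp
      have e2 := Complex.norm_mul_exp_arg_mul_I (ι A)
      have e3 := Complex.norm_mul_exp_arg_mul_I (ι (Z t) / ι A)
      have e4 : ι (Z t) = (‖ι A‖ * Complex.exp ((ι A).arg * Complex.I)) *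
          (‖ι (Z t) / ι A‖ * Complex.exp ((ι (Z t) / ι A).arg * Complex.I)) := by
        rw [e2, e3]; exact e1
      simp only [hϑ, Complex.log_im]
      push_cast
      rw [add_mul, Complex.exp_add]
      refine e4.trans ?_
      rw [norm_div, hn, hn]
      push_cast
      have : ((‖A‖ : ℝ) : ℂ) ≠ 0 := by exact_mod_cast hA0.ne'
      field_simp
    have hre := congrArg Complex.re h1
    have him := congrArg Complex.im h1
    rw [Complex.re_ofReal_mul, Complex.exp_ofReal_mul_I_re] at hre
    rw [Complex.im_ofReal_mul, Complex.exp_ofReal_mul_I_im] at him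
    exact plane_ext (by simpa using hre) (by simpa using him)
  · have := norm_image_sub_le_of_norm_deriv_le_segment' (f := fun t => ϑ t - ε * Ψ t) (a := 0) (b := T)
      (fun t ht => ((hϑd t ht).fun_sub ((hΨ t ht).const_mul ε)).hasDerivWithinAt)
      (fun t ht => hC t ⟨ht.1, ht.2.le⟩) T (right_mem_Icc.mpr hT)
    rw [Real.norm_eq_abs, sub_zero] at this
    convert this using 2
    ring

/-- The precession rate of the modified Lagrangians. -/
theorem IsKepler.hasPrecessionRate {γ γ' : ℝ → Plane} (hγ : IsKepler γ γ')
    (hl : angularMomentum (γ 0) (γ' 0) ≠ 0) (hA : lrl (γ 0) (γ' 0) ≠ 0) {T : ℝ}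
    (hT : IsPeriod γ T) (σ : ℝ) :
    HasPrecessionRate (modLagrangian σ) γ γ' T
      (Real.sign (angularMomentum (γ 0) (γ' 0)) * Real.pi * (1 + σ) *
        (4 + ‖lrl (γ 0) (γ' 0)‖ ^ 2) / (8 * angularMomentum (γ 0) (γ' 0) ^ 6)) := by
  obtain ⟨Ψ, hΨ, hΨT⟩ := hγ.exists_precession hl hA hT σ
  rw [← hΨT]
  have hT0 : 0 < T := hT.1.1
  obtain ⟨K, hKU, hK, δ, hδ, A, hA1, Φ, hcK, hΦ, -⟩ := hγ.exists_flow hA hT0.le σ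
  obtain ⟨C₁, hC₁, -, hL₁⟩ := exists_bound_lipschitz (isOpen_regular σ) hK hKU
    (contDiffOn_precessionSpeed σ)
  obtain ⟨C₂, hC₂, -, hL₂⟩ := exists_bound_lipschitz (isOpen_regular σ) hK hKU
    (u := fun s : State => lrl s.2.1 s.2.2) (fun s hs =>
      (contDiffAt_lrl (contDiffAt_state s).2.1 (contDiffAt_state s).2.2 hs.1).contDiffWithinAt)
  have hAn : 0 < ‖lrl (γ 0) (γ' 0)‖ := norm_pos_iff.mpr hA
  intro κ hκ
  set B := A * (κ + 1) with hB
  have hB0 : 0 < B := by positivity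
  -- The distance to the Kepler motion is at most Bh², with κ + 1 covering the initial data and the
  -- coordinate ε = h². The bound δ/B keeps the flow in K; the last bound keeps the
  -- Laplace-Runge-Lenz vector within its own length of the unperturbed one.
  refine ⟨C₁ * B * T, by positivity, min 1 (min (δ / B) (‖lrl (γ 0) (γ' 0)‖ / (C₂ * B))),
    by positivity, fun h hh y w hy hw => ?_⟩
  obtain ⟨h0, hlt⟩ := hh
  rw [lt_min_iff, lt_min_iff, lt_div_iff₀ hB0, lt_div_iff₀ (by positivity)] at hlt
  obtain ⟨hh1, hhδ, hhA⟩ := hlt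
  have hsq : h ^ 2 ≤ h := by nlinarith
  have hdist : A * dist ((h ^ 2, y, w) : State) (0, γ 0, γ' 0) ≤ B * h ^ 2 := by
    rw [hB, mul_assoc]
    gcongr
    rw [Prod.dist_eq, Prod.dist_eq, dist_zero_right, dist_eq_norm, dist_eq_norm,
      Real.norm_of_nonneg (by positivity)]
    have : 0 ≤ κ * h ^ 2 := by positivity
    refine max_le ?_ (max_le ?_ ?_) <;> dsimp only <;> nlinarith [sq_nonneg h]
  obtain ⟨hΦ0, hΦ⟩ := hΦ (h ^ 2, y, w) (hdist.trans (by nlinarith))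
  set s := Φ (h ^ 2, y, w) with hs
  have hdist' : ∀ t ∈ Icc 0 T, ‖s t - (0, γ t, γ' t)‖ ≤ B * h ^ 2 := fun t ht => by
    rw [← dist_eq_norm]; exact (hΦ t ht).2.2.2.trans hdist
  refine ⟨⟨_, _, isMotion_of_field (s := s) fun t ht =>
    ⟨(hΦ t ht).1, hKU (hΦ t ht).2.1, (hΦ t ht).2.2.1⟩, by simp [hΦ0], by simp [hΦ0]⟩, ?_⟩
  intro X V hm hX0 hV0
  have heq := hm.eqOn hT0 (s := s) (fun t ht => ⟨hKU (hΦ t ht).2.1, (hΦ t ht).2.2.1⟩)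
    (by rw [hΦ0, hX0, hV0])
  have hlrl : ∀ t ∈ Icc 0 T, lrl (X t) (V t) = lrl (s t).2.1 (s t).2.2 := fun t ht => by
    rw [heq t ht]
  obtain ⟨Δ, ⟨ϑ, hϑ, hΔ, hϑZ⟩, hb⟩ := exists_hasAngleChange (Z := fun t => lrl (s t).2.1 (s t).2.2)
    (Z' := fun t => lrlDot (s t).2.1 (s t).2.2 (h ^ 2 • perturbation σ (h ^ 2) (s t).2.1 (s t).2.2))
    (A := lrl (γ 0) (γ' 0)) (T := T) (ε := h ^ 2) (C := C₁ * B * h ^ 4) (Ψ := Ψ)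
    (k := fun t => precessionSpeed σ 0 (γ t) (γ' t)) hT0.le
    (fun t ht => by
      have hd := (hΦ t ht).2.2.1
      have hV := (hasDerivAt_state hd).2.2
      simp only [field, (hΦ t ht).1] at hV
      exact hasDerivAt_lrl (hKU (hΦ t ht).2.1).1 (hasDerivAt_state hd).2.1 hV)
    (fun t ht => by
      rw [← hγ.lrl_eq t]
      refine (hL₂ _ (hΦ t ht).2.1 _ (hcK t ht)).trans_lt ?_
      rw [hγ.lrl_eq t]
      calc C₂ * ‖s t - (0, γ t, γ' t)‖ ≤ C₂ * (B * h) := by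
            gcongr
            exact (hdist' t ht).trans (by gcongr)
        _ < _ := by linarith)
    (fun t _ => hΨ t)
    (fun t ht => by
      have e : cross (lrl (s t).2.1 (s t).2.2) (lrlDot (s t).2.1 (s t).2.2
          (h ^ 2 • perturbation σ (h ^ 2) (s t).2.1 (s t).2.2)) / ‖lrl (s t).2.1 (s t).2.2‖ ^ 2 =
          h ^ 2 * precessionSpeed σ (s t).1 (s t).2.1 (s t).2.2 := by
        rw [precessionSpeed, (hΦ t ht).1]
        simp only [cross, lrlDot, inner_smul_right, PiLp.sub_apply, PiLp.smul_apply, smul_eq_mul]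
        ring
      rw [e, ← mul_sub, abs_mul, abs_of_nonneg (by positivity : 0 ≤ h ^ 2)]
      have := hL₁ _ (hΦ t ht).2.1 _ (hcK t ht)
      rw [Real.norm_eq_abs] at this
      calc _ ≤ h ^ 2 * (C₁ * (B * h ^ 2)) := by
            gcongr
            exact this.trans (by gcongr; exact hdist' t ht)
        _ = _ := by ring)
  refine ⟨Δ, ⟨ϑ, hϑ, hΔ, fun t ht => ?_⟩, hb.trans (by ring_nf; rfl)⟩
  simpa only [hlrl t ht] using hϑZ t ht

/-! ### Discrete trajectories -/

/-- Admissible consecutive positions. -/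
def Admissible (ρ : ℝ) (xm x xp : Plane) : Prop :=
  ρ ≤ ‖xm‖ ∧ ρ ≤ ‖x‖ ∧ ‖x - xm‖ ≤ ‖xm‖ / 2 ∧ ‖xp - x‖ ≤ ‖x‖ / 2

/-- The right hand side of a method is bounded by `Λ` and Lipschitz with constant `Λ`. -/
def MethodBound (Φ : Plane → Plane → Plane → Plane) (ρ Λ : ℝ) : Prop :=
  ∀ xm x xp, Admissible ρ xm x xp → ‖Φ xm x xp‖ ≤ Λ ∧ ∀ ym y yp, Admissible ρ ym y yp →
    ‖Φ xm x xp - Φ ym y yp‖ ≤ Λ * (‖xm - ym‖ + ‖x - y‖ + ‖xp - yp‖)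

theorem norm_force (x : Plane) (hx : x ≠ 0) : ‖force x‖ = (‖x‖ ^ 2)⁻¹ := by
  have hr : ‖x‖ ≠ 0 := norm_ne_zero_iff.mpr hx
  rw [force, norm_neg, norm_smul, Real.norm_of_nonneg (by positivity)]
  field_simp

theorem verletForce_bound {ρ : ℝ} (hρ : 0 < ρ) :
    MethodBound verletForce ρ (4 / ρ ^ 3 + (ρ ^ 2)⁻¹) := by
  have i1 : 0 ≤ 4 / ρ ^ 3 := by positivity
  have i2 : 0 ≤ (ρ ^ 2)⁻¹ := by positivity
  rintro xm x xp ⟨-, h2, -, -⟩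
  refine ⟨?_, ?_⟩
  · rw [verletForce, norm_force x (norm_pos_iff.mp (hρ.trans_le h2))]
    have : (‖x‖ ^ 2)⁻¹ ≤ (ρ ^ 2)⁻¹ := by gcongr
    linarith
  · rintro ym y yp ⟨-, h2', -, -⟩
    refine (norm_force_sub_le hρ h2 h2').trans ?_
    gcongr
    · linarith
    · linarith [norm_nonneg (xm - ym), norm_nonneg (xp - yp)]

/-- The restriction on the steps keeps midpoints away from the singularity: half a step is at most
|x|/4. -/
theorem le_norm_midpoint {ρ : ℝ} {x y : Plane} (hx : ρ ≤ ‖x‖) (h : ‖y - x‖ ≤ ‖x‖ / 2) :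
    ρ / 2 ≤ ‖(1 / 2 : ℝ) • (x + y)‖ := by
  have e : x = (1 / 2 : ℝ) • (x + y) - (1 / 2 : ℝ) • (y - x) := by module
  have h1 := norm_sub_le ((1 / 2 : ℝ) • (x + y)) ((1 / 2 : ℝ) • (y - x))
  rw [← e, norm_smul (1 / 2 : ℝ) (y - x), Real.norm_of_nonneg (by norm_num)] at h1
  linarith [norm_nonneg x]

theorem midpointForce_bound {ρ : ℝ} (hρ : 0 < ρ) :
    MethodBound midpointForce ρ (4 / (ρ / 2) ^ 3 + ((ρ / 2) ^ 2)⁻¹) := by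
  have i1 : 0 ≤ 4 / (ρ / 2) ^ 3 := by positivity
  have i2 : 0 ≤ ((ρ / 2) ^ 2)⁻¹ := by positivity
  have hb : ∀ z : Plane, ρ / 2 ≤ ‖z‖ → ‖force z‖ ≤ ((ρ / 2) ^ 2)⁻¹ := fun z hz => by
    rw [norm_force z (norm_pos_iff.mp (by linarith))]
    gcongr
  rintro xm x xp ⟨h1, h2, h3, h4⟩
  have m1 := le_norm_midpoint h2 h4
  have m2 := le_norm_midpoint h1 h3
  refine ⟨?_, ?_⟩
  · refine (norm_add_le _ _).trans ?_
    rw [norm_smul, norm_smul, Real.norm_of_nonneg (by norm_num)]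
    linarith [hb _ m1, hb _ m2]
  · rintro ym y yp ⟨h1', h2', h3', h4'⟩
    have n1 := norm_force_sub_le (by positivity) m1 (le_norm_midpoint h2' h4')
    have n2 := norm_force_sub_le (by positivity) m2 (le_norm_midpoint h1' h3')
    have e : midpointForce xm x xp - midpointForce ym y yp = (1 / 2 : ℝ) •
        (force ((1 / 2 : ℝ) • (x + xp)) - force ((1 / 2 : ℝ) • (y + yp))) + (1 / 2 : ℝ) •
        (force ((1 / 2 : ℝ) • (xm + x)) - force ((1 / 2 : ℝ) • (ym + y))) := by
      simp only [midpointForce]; module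
    have k : ∀ p q p' q' : Plane, ‖(1 / 2 : ℝ) • (p + q) - (1 / 2 : ℝ) • (p' + q')‖ ≤
        1 / 2 * (‖p - p'‖ + ‖q - q'‖) := fun p q p' q' => by
      have : (1 / 2 : ℝ) • (p + q) - (1 / 2 : ℝ) • (p' + q') =
        (1 / 2 : ℝ) • ((p - p') + (q - q')) := by module
      rw [this, norm_smul, Real.norm_of_nonneg (by norm_num)]
      gcongr
      exact norm_add_le _ _
    have n1' := n1.trans (mul_le_mul_of_nonneg_left (k x xp y yp) i1)
    have n2' := n2.trans (mul_le_mul_of_nonneg_left (k xm x ym y) i1)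
    rw [e]
    refine (norm_add_le _ _).trans ?_
    rw [norm_smul, norm_smul, Real.norm_of_nonneg (by norm_num)]
    have j1 := mul_nonneg i1 (norm_nonneg (xm - ym))
    have j2 := mul_nonneg i1 (norm_nonneg (x - y))
    have j3 := mul_nonneg i1 (norm_nonneg (xp - yp))
    have j4 : 0 ≤ ((ρ / 2) ^ 2)⁻¹ * (‖xm - ym‖ + ‖x - y‖ + ‖xp - yp‖) := by positivity
    nlinarith

/-- One step of a discrete Grönwall inequality, with u the position errors and w the errors of the
difference quotients. An implicit method puts w' on the right as well; hΛ ≤ 1/2 absorbs it into a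
crude bound with factor 8, which is then reinserted. This gives 11 = 3 + 8. -/
theorem stability_step {h Λ C u₀ u₁ u₂ w w' : ℝ} (h0 : 0 < h) (h1 : h ≤ 1) (hΛ0 : 0 ≤ Λ)
    (hΛ : h * Λ ≤ 1 / 2) (hC : 0 ≤ C) (hu : 0 ≤ u₀) (hw : 0 ≤ w) (hw' : 0 ≤ w')
    (hu₁ : u₁ ≤ u₀ + h * w) (hu₂ : u₂ ≤ u₁ + h * w')
    (hww : w' ≤ w + h * Λ * (u₀ + u₁ + u₂) + C) :
    u₁ + w' ≤ (1 + (1 + 11 * Λ) * h) * (u₀ + w) + 2 * C := by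
  have a1 : h * w ≤ w := mul_le_of_le_one_left hw h1
  have a2 : h * w' ≤ w' := mul_le_of_le_one_left hw' h1
  have hhΛ : 0 ≤ h * Λ := by positivity
  have a3 : h * Λ * (u₀ + u₁ + u₂) ≤ h * Λ * (3 * (u₀ + w) + h * w') :=
    mul_le_mul_of_nonneg_left (by linarith) hhΛ
  have q1 : h * Λ * (h * w') ≤ 1 / 2 * w' := mul_le_mul hΛ a2 (by positivity) (by norm_num)
  have q2 : h * Λ * (3 * (u₀ + w)) ≤ 1 / 2 * (3 * (u₀ + w)) := by gcongr
  have q3 : w' ≤ 8 * (u₀ + w) + 2 * C := by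
    rw [mul_add] at a3
    linarith
  have q4 : h * Λ * (h * w') ≤ h * Λ * (8 * (u₀ + w)) + C := by
    have z2 := mul_le_mul_of_nonneg_left (a2.trans q3) hhΛ
    have z3 : h * Λ * (2 * C) ≤ 1 / 2 * (2 * C) := by gcongr
    rw [mul_add] at z2
    linarith
  rw [mul_add] at a3
  have a4 : 0 ≤ h * u₀ := by positivity
  have e : (1 + (1 + 11 * Λ) * h) * (u₀ + w) =
      u₀ + w + h * u₀ + h * w + (h * Λ * (3 * (u₀ + w)) + h * Λ * (8 * (u₀ + w))) := by ring
  rw [e]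
  linarith

/-- Stability: numerical solutions stay close to discrete trajectories with small residual. -/
theorem IsNumericalSolution.close {Φ : Plane → Plane → Plane → Plane} {ρ Λ C T h : ℝ}
    (hΦ : MethodBound Φ ρ Λ) (hρ : 0 ≤ ρ) (hΛ0 : 0 ≤ Λ) (hC : 0 ≤ C)
    (h0 : 0 < h) (h1 : h ≤ 1) (hΛ : h * Λ ≤ 1 / 2)
    (hs : C * (1 + 2 * T) * Real.exp ((1 + 11 * Λ) * T) * h ^ 4 ≤ ρ) {X x : ℕ → Plane}
    (hX : ∀ k : ℕ, k * h ≤ T → 2 * ρ ≤ ‖X k‖)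
    (hXs : ∀ k : ℕ, (k + 1) * h ≤ T → ‖X (k + 1) - X k‖ ≤ ‖X k‖ / 2)
    (hXe : ∀ k : ℕ, (k + 2) * h ≤ T → ‖X (k + 2) - (2 : ℝ) • X (k + 1) + X k -
      h ^ 2 • Φ (X k) (X (k + 1)) (X (k + 2))‖ ≤ C * h ^ 6)
    {T' : ℝ} (hT' : T' ≤ T) (hx : IsNumericalSolution Φ h T' x) (hx0 : x 0 = X 0)
    (hx1 : ‖x 1 - X 1‖ ≤ C * h ^ 5) (k : ℕ) (hk : k * h ≤ T') :
    ‖x k - X k‖ ≤ C * (1 + 2 * T) * Real.exp ((1 + 11 * Λ) * T) * h ^ 4 := by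
  set B := C * (1 + 2 * T) * Real.exp ((1 + 11 * Λ) * T) with hB
  set e : ℕ → Plane := fun k => x k - X k with he
  -- The second order recursion becomes first order for position error plus velocity error. A
  -- residual of order h⁶ enters the latter as h⁵, and the O(1/h) steps add up to h⁴.
  set S : ℕ → ℝ := fun k => ‖e k‖ + ‖e (k + 1) - e k‖ / h with hS
  set c := 1 + 11 * Λ with hc
  have hc0 : 0 ≤ c := by positivity
  have hnn : ∀ k, 0 ≤ ‖e (k + 1) - e k‖ / h := fun k => by positivity
  have hSe : ∀ k, ‖e k‖ ≤ S k := fun k => by simp only [hS]; linarith [hnn k]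
  have hdw : ∀ k, ‖e (k + 1) - e k‖ = h * (‖e (k + 1) - e k‖ / h) := fun k => by field_simp
  have hSe1 : ∀ k, ‖e (k + 1)‖ ≤ S k := fun k => by
    have : ‖e (k + 1)‖ ≤ ‖e k‖ + ‖e (k + 1) - e k‖ := by
      simpa using norm_add_le (e k) (e (k + 1) - e k)
    simp only [hS]
    nlinarith [hnn k, hdw k]
  have hpow : ∀ k : ℕ, k * h ≤ T → (1 + c * h) ^ k * (C * h ^ 4 + 2 * C * k * h ^ 5) ≤ B * h ^ 4 := by
    intro k hk
    have i1 : (1 + c * h) ^ k ≤ Real.exp (c * T) := by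
      calc (1 + c * h) ^ k ≤ Real.exp (c * h) ^ k := by
            gcongr
            linarith [Real.add_one_le_exp (c * h)]
        _ = Real.exp (k * (c * h)) := by rw [← Real.exp_nat_mul]
        _ ≤ _ := by
            rw [mul_left_comm]
            gcongr
    have i2 : C * h ^ 4 + 2 * C * k * h ^ 5 ≤ C * (1 + 2 * T) * h ^ 4 := by
      have := mul_le_mul_of_nonneg_left hk (by positivity : 0 ≤ C * h ^ 4)
      nlinarith
    calc _ ≤ Real.exp (c * T) * (C * (1 + 2 * T) * h ^ 4) := by gcongr
      _ = _ := by rw [hB]; ring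
  have main : ∀ k : ℕ, (k + 1) * h ≤ T' →
      S k ≤ (1 + c * h) ^ k * (C * h ^ 4 + 2 * C * k * h ^ 5) := by
    intro k
    induction k with
    | zero =>
      intro _
      simp only [hS, he, hx0, sub_self, norm_zero, zero_add, sub_zero, pow_zero, one_mul,
        Nat.cast_zero, mul_zero, zero_mul, add_zero]
      rw [div_le_iff₀ h0]
      linarith
    | succ k ih =>
      intro hk
      push_cast at hk
      have hk2 : ((k : ℝ) + 2) * h ≤ T' := by linarith
      have hk1 : ((k : ℝ) + 1) * h ≤ T' := by linarith
      have hk0 : (k : ℝ) * h ≤ T' := by linarith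
      have ihS := ih hk1
      -- The reference points have norm at least 2ρ, so an error of at most ρ leaves the numerical
      -- points admissible.
      have hSρ : S k ≤ ρ := (ihS.trans (hpow k (hk0.trans hT'))).trans hs
      have a0 : ρ ≤ ‖x k‖ := by
        have := norm_sub_norm_le (X k) (X k - x k)
        rw [sub_sub_cancel, norm_sub_rev] at this
        linarith [hSe k, hX k (hk0.trans hT')]
      have a1 : ρ ≤ ‖x (k + 1)‖ := by
        have := norm_sub_norm_le (X (k + 1)) (X (k + 1) - x (k + 1))
        rw [sub_sub_cancel, norm_sub_rev] at this
        linarith [hSe1 k, hX (k + 1) (by push_cast; exact hk1.trans hT')]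
      have adx : Admissible ρ (x k) (x (k + 1)) (x (k + 2)) :=
        ⟨a0, a1, hx.2 k hk1, hx.2 (k + 1) (by push_cast; linarith)⟩
      have adX : Admissible ρ (X k) (X (k + 1)) (X (k + 2)) := by
        refine ⟨by linarith [hX k (hk0.trans hT')], ?_, hXs k (hk1.trans hT'),
          hXs (k + 1) (by push_cast; linarith)⟩
        linarith [hX (k + 1) (by push_cast; exact hk1.trans hT')]
      have hL := (hΦ _ _ _ adx).2 _ _ _ adX
      have hxe : x (k + 2) - (2 : ℝ) • x (k + 1) + x k =
          h ^ 2 • Φ (x k) (x (k + 1)) (x (k + 2)) := by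
        rw [← hx.1 k hk2, smul_smul, mul_inv_cancel₀ (by positivity), one_smul]
      have hd : e (k + 2) - e (k + 1) = (e (k + 1) - e k) +
          h ^ 2 • (Φ (x k) (x (k + 1)) (x (k + 2)) - Φ (X k) (X (k + 1)) (X (k + 2))) -
          (X (k + 2) - (2 : ℝ) • X (k + 1) + X k -
            h ^ 2 • Φ (X k) (X (k + 1)) (X (k + 2))) := by
        rw [smul_sub, ← hxe]
        simp only [he]
        module
      have hn : ‖e (k + 2) - e (k + 1)‖ ≤ ‖e (k + 1) - e k‖ +
          h ^ 2 * (Λ * (‖e k‖ + ‖e (k + 1)‖ + ‖e (k + 2)‖)) + C * h ^ 6 := by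
        rw [hd]
        refine (norm_sub_le _ _).trans (add_le_add ((norm_add_le _ _).trans ?_)
          (hXe k (hk2.trans hT')))
        rw [norm_smul, Real.norm_of_nonneg (by positivity : 0 ≤ h ^ 2)]
        exact add_le_add le_rfl (mul_le_mul_of_nonneg_left hL (by positivity))
      have t1 : ‖e (k + 1)‖ ≤ ‖e k‖ + h * (‖e (k + 1) - e k‖ / h) := by
        rw [← hdw k]
        simpa using norm_add_le (e k) (e (k + 1) - e k)
      have t2 : ‖e (k + 2)‖ ≤ ‖e (k + 1)‖ + h * (‖e (k + 2) - e (k + 1)‖ / h) := by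
        rw [← hdw (k + 1)]
        simpa using norm_add_le (e (k + 1)) (e (k + 2) - e (k + 1))
      have t3 : ‖e (k + 2) - e (k + 1)‖ / h ≤ ‖e (k + 1) - e k‖ / h +
          h * Λ * (‖e k‖ + ‖e (k + 1)‖ + ‖e (k + 2)‖) + C * h ^ 5 := by
        rw [div_le_iff₀ h0]
        refine hn.trans (le_of_eq ?_)
        field_simp
      have hstep : S (k + 1) ≤ (1 + c * h) * S k + 2 * (C * h ^ 5) :=
        stability_step h0 h1 hΛ0 hΛ (by positivity) (norm_nonneg _) (hnn k) (hnn (k + 1)) t1 t2 t3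
      have hge : 1 ≤ (1 + c * h) ^ (k + 1) := one_le_pow₀ (by nlinarith)
      calc S (k + 1) ≤ (1 + c * h) * S k + 2 * (C * h ^ 5) := hstep
        _ ≤ (1 + c * h) * ((1 + c * h) ^ k * (C * h ^ 4 + 2 * C * k * h ^ 5)) +
            (1 + c * h) ^ (k + 1) * (2 * (C * h ^ 5)) := by
          have hp : 0 ≤ 1 + c * h := by positivity
          exact add_le_add (mul_le_mul_of_nonneg_left ihS hp)
            (le_mul_of_one_le_left (by positivity) hge)
        _ = _ := by push_cast; ring
  rcases k with _ | k
  · have hT0 : 0 ≤ T := by simpa using hk.trans hT'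
    rw [hx0, sub_self, norm_zero]
    positivity
  · push_cast at hk
    refine (hSe1 k).trans ((main k hk).trans (hpow k ?_))
    nlinarith

/-- One step of an implicit method. -/
theorem MethodBound.exists_step {Φ : Plane → Plane → Plane → Plane} {ρ Λ h : ℝ}
    (hΦ : MethodBound Φ ρ Λ) (h1 : h ^ 2 * Λ ≤ 1 / 2) (h2 : h ^ 2 * Λ ≤ ρ / 4)
    {xm x : Plane} (hxm : ρ ≤ ‖xm‖) (hx : ρ ≤ ‖x‖) (hd : ‖x - xm‖ ≤ ‖xm‖ / 2)
    (hd' : ‖x - xm‖ ≤ ‖x‖ / 4) :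
    ∃ xp, xp - (2 : ℝ) • x + xm = h ^ 2 • Φ xm x xp ∧ ‖xp - x‖ ≤ ‖x‖ / 2 := by
  set B := closedBall x (‖x‖ / 2) with hB
  have hadm : ∀ p ∈ B, Admissible ρ xm x p := fun p hp =>
    ⟨hxm, hx, hd, by rwa [hB, mem_closedBall, dist_eq_norm] at hp⟩
  -- The new point is a fixed point of g. The two quarters from `hd'` and `h2` give invariance of
  -- the ball of radius |x|/2, and `h1` gives contraction by 1/2.
  set g : Plane → Plane := fun p => (2 : ℝ) • x - xm + h ^ 2 • Φ xm x p with hg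
  have hmaps : MapsTo g B B := by
    intro p hp
    rw [hB, mem_closedBall, dist_eq_norm]
    have e : g p - x = (x - xm) + h ^ 2 • Φ xm x p := by simp only [hg]; module
    rw [e]
    refine (norm_add_le _ _).trans ?_
    rw [norm_smul, Real.norm_of_nonneg (sq_nonneg h)]
    have := mul_le_mul_of_nonneg_left (hΦ _ _ _ (hadm p hp)).1 (sq_nonneg h)
    linarith
  have hcontr : ContractingWith (1 / 2) (hmaps.restrict g B B) := by
    refine ⟨by norm_num, LipschitzWith.of_dist_le_mul fun p q => ?_⟩
    rw [Subtype.dist_eq, Subtype.dist_eq, dist_eq_norm, dist_eq_norm, MapsTo.val_restrict_apply,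
      MapsTo.val_restrict_apply]
    have e : g p - g q = h ^ 2 • (Φ xm x p - Φ xm x q) := by simp only [hg]; module
    rw [e, norm_smul, Real.norm_of_nonneg (sq_nonneg h)]
    have := mul_le_mul_of_nonneg_left ((hΦ _ _ _ (hadm p p.2)).2 _ _ _ (hadm q q.2)) (sq_nonneg h)
    simp only [sub_self, norm_zero, zero_add] at this
    refine this.trans ?_
    rw [← mul_assoc]
    gcongr
    simpa using h1
  obtain ⟨p, hp, hfix, -⟩ := hcontr.exists_fixedPoint' isClosed_closedBall.isComplete hmaps
    (mem_closedBall_self (by positivity)) (edist_ne_top _ _)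
  refine ⟨p, ?_, (hadm p hp).2.2.2⟩
  have : g p = p := hfix
  have e : h ^ 2 • Φ xm x p = g p - (2 : ℝ) • x + xm := by simp only [hg]; module
  rw [e, this]

/-- Existence of numerical solutions near discrete trajectories with small residual. -/
theorem exists_isNumericalSolution {Φ : Plane → Plane → Plane → Plane} {ρ Λ C T h : ℝ}
    (hΦ : MethodBound Φ ρ Λ) (h0 : 0 < h)
    (h1 : h ^ 2 * Λ ≤ 1 / 2) (h2 : h ^ 2 * Λ ≤ ρ / 4) {X : ℕ → Plane} {x₀ x₁ : Plane}
    (hX : ∀ k : ℕ, k * h ≤ T → 2 * ρ ≤ ‖X k‖)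
    (hXs : ∀ k : ℕ, (k + 1) * h ≤ T → ‖X (k + 1) - X k‖ ≤ ρ / 8)
    (hC : C ≤ ρ / 16) (hρ : 0 < ρ)
    (hclose : ∀ x T', T' ≤ T → IsNumericalSolution Φ h T' x → x 0 = x₀ → x 1 = x₁ →
      ∀ k : ℕ, k * h ≤ T' → ‖x k - X k‖ ≤ C)
    (hx₁ : ‖x₁ - x₀‖ ≤ ‖x₀‖ / 2) :
    ∃ x, IsNumericalSolution Φ h T x ∧ x 0 = x₀ ∧ x 1 = x₁ := by
  classical
  set good : Plane → Plane → Plane → Prop := fun xm x xp =>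
    xp - (2 : ℝ) • x + xm = h ^ 2 • Φ xm x xp ∧ ‖xp - x‖ ≤ ‖x‖ / 2 with hgood
  -- The default 0 is used only if no admissible continuation exists, which is excluded up to time
  -- T.
  set nxt : Plane × Plane → Plane × Plane := fun p =>
    (p.2, if H : ∃ xp, good p.1 p.2 xp then H.choose else 0) with hnxt
  set y : ℕ → Plane × Plane := fun n => nxt^[n] (x₀, x₁) with hy
  have hys : ∀ n, y (n + 1) = nxt (y n) := fun n => Function.iterate_succ_apply' nxt n _
  set x : ℕ → Plane := fun n => (y n).1 with hx
  have hx1 : ∀ n, (y n).2 = x (n + 1) := fun n => by simp only [hx, hys, hnxt]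
  have hx2 : ∀ n, (∃ xp, good (x n) (x (n + 1)) xp) → good (x n) (x (n + 1)) (x (n + 2)) := by
    intro n H
    have e : x (n + 2) = (nxt (y n)).2 := by rw [← hx1 (n + 1), hys]
    have H' : ∃ xp, good (y n).1 (y n).2 xp := by rw [hx1]; exact H
    rw [e, hnxt]
    simp only [dif_pos H', ← hx1 n]
    exact H'.choose_spec
  have x0 : x 0 = x₀ := rfl
  have x1 : x 1 = x₁ := by rw [← hx1 0]; rfl
  -- Existence and closeness are interleaved: the part already constructed is a numerical solution
  -- up to a shorter time, hence is close to X, which provides the hypotheses for the next step.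
  have key : ∀ N : ℕ, N * h ≤ T → IsNumericalSolution Φ h (N * h) x := by
    intro N
    induction N with
    | zero =>
      intro _
      simp only [Nat.cast_zero, zero_mul]
      exact ⟨fun k hk => absurd hk (by push Not; positivity),
        fun k hk => absurd hk (by push Not; positivity)⟩
    | succ N ih =>
      intro hN
      push_cast at hN
      have hNT : (N : ℝ) * h ≤ T := by nlinarith
      obtain ⟨ih1, ih2⟩ := ih hNT
      have hcl := hclose x _ hNT (ih hNT) x0 x1
      have hcast : ∀ a b : ℕ, (a : ℝ) * h ≤ (b : ℝ) * h ↔ a ≤ b := fun a b => by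
        rw [mul_le_mul_iff_left₀ h0, Nat.cast_le]
      rcases N with _ | N
      · refine ⟨fun k hk => ?_, fun k hk => ?_⟩
        · have := (hcast (k + 2) 1).mp (by push_cast; simpa using hk)
          omega
        · have := (hcast (k + 1) 1).mp (by push_cast; simpa using hk)
          obtain rfl : k = 0 := by omega
          rw [zero_add, x0, x1]
          exact hx₁
      · have c0 := hcl N (by rw [hcast]; omega)
        have c1 := hcl (N + 1) le_rfl
        push_cast at hN hNT
        have b0 := hX N (by nlinarith)
        have b1 := hX (N + 1) (by push_cast; exact hNT)
        have b2 := hXs N hNT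
        have n0 : ρ ≤ ‖x N‖ := by
          have := norm_sub_norm_le (X N) (X N - x N)
          rw [sub_sub_cancel, norm_sub_rev] at this
          linarith
        have n1 : ρ ≤ ‖x (N + 1)‖ := by
          have := norm_sub_norm_le (X (N + 1)) (X (N + 1) - x (N + 1))
          rw [sub_sub_cancel, norm_sub_rev] at this
          linarith
        have n2 : ‖x (N + 1) - x N‖ ≤ ρ / 4 := by
          have e : x (N + 1) - x N = (x (N + 1) - X (N + 1)) + (X (N + 1) - X N) - (x N - X N) := by
            abel
          rw [e]
          refine (norm_sub_le _ _).trans ?_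
          have := norm_add_le (x (N + 1) - X (N + 1)) (X (N + 1) - X N)
          linarith
        obtain ⟨g1, g2⟩ := hx2 N (hΦ.exists_step h1 h2 n0 n1 (by linarith) (by linarith))
        refine ⟨fun k hk => ?_, fun k hk => ?_⟩
        · have := (hcast (k + 2) (N + 1 + 1)).mp (by push_cast at hk ⊢; exact hk)
          rcases (by omega : k + 2 ≤ N + 1 ∨ k = N) with h | rfl
          · exact ih1 k (by have := (hcast _ _).mpr h; push_cast at this ⊢; exact this)
          · rw [g1, smul_smul, inv_mul_cancel₀ (by positivity), one_smul]
        · have := (hcast (k + 1) (N + 1 + 1)).mp (by push_cast at hk ⊢; exact hk)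
          rcases (by omega : k + 1 ≤ N + 1 ∨ k = N + 1) with h | rfl
          · exact ih2 k (by have := (hcast _ _).mpr h; push_cast at this ⊢; exact this)
          · exact g2
  by_cases hT : 0 ≤ T
  · have hfl : (⌊T / h⌋₊ : ℝ) * h ≤ T := by
      rw [← le_div_iff₀ h0]; exact Nat.floor_le (by positivity)
    obtain ⟨k1, k2⟩ := key ⌊T / h⌋₊ hfl
    have hle : ∀ k : ℕ, (k : ℝ) * h ≤ T → (k : ℝ) * h ≤ (⌊T / h⌋₊ : ℝ) * h := fun k hk => by
      gcongr
      exact Nat.le_floor (by rwa [le_div_iff₀ h0])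
    refine ⟨x, ⟨fun k hk => k1 k ?_, fun k hk => k2 k ?_⟩, x0, x1⟩
    · have := hle (k + 2) (by push_cast; exact hk)
      push_cast at this
      exact this
    · have := hle (k + 1) (by push_cast; exact hk)
      push_cast at this
      exact this
  · refine ⟨x, ⟨fun k hk => ?_, fun k hk => ?_⟩, x0, x1⟩ <;>
    · have : (0 : ℝ) ≤ k * h := by positivity
      nlinarith

/-! ### Consistency of the methods with their modified equations -/

/-- The solutions of the Euler-Lagrange equation solve the difference equation of the method up to
a residual of order `h ^ 6`. -/
def IsConsistent (σ : ℝ) (Φ : Plane → Plane → Plane → Plane) : Prop :=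
  ∀ K ⊆ regular σ, IsCompact K → ∃ C > 0, ∃ h₁ > 0, ∀ h ∈ Ioo 0 h₁, ∀ s : ℝ → State,
    (∀ τ ∈ Icc (-h) h, (s τ).1 = h ^ 2 ∧ s τ ∈ K ∧ HasDerivAt s (field σ (s τ)) τ) →
      ‖(s h).2.1 - (2 : ℝ) • (s 0).2.1 + (s (-h)).2.1 -
        h ^ 2 • Φ (s (-h)).2.1 (s 0).2.1 (s h).2.1‖ ≤ C * h ^ 6

theorem hasDerivAt_force {X : ℝ → Plane} {v : Plane} {t : ℝ} (hX : HasDerivAt X v t)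
    (h0 : X t ≠ 0) : HasDerivAt (fun τ => force (X τ)) (-tidal (X t) v) t := by
  have h3 := hasDerivAt_norm_pow_inv 3 hX h0
  refine (h3.fun_smul hX).fun_neg.congr_deriv ?_
  simp only [tidal]
  push_cast
  module

theorem hasDerivAt_tidal {X V : ℝ → Plane} {a : Plane} {t : ℝ} (hX : HasDerivAt X (V t) t)
    (hV : HasDerivAt V a t) (h0 : X t ≠ 0) :
    HasDerivAt (fun τ => tidal (X τ) (V τ)) (tidalDot (X t) (V t) + tidal (X t) a) t := by
  rw [← hasDerivWithinAt_univ] at *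
  exact hasDerivWithinAt_tidal hX hV h0

theorem tidal_add (x v w : Plane) : tidal x (v + w) = tidal x v + tidal x w := by
  simp only [tidal, inner_add_right]; module

theorem tidal_smul (x : Plane) (c : ℝ) (w : Plane) : tidal x (c • w) = c • tidal x w := by
  simp only [tidal, inner_smul_right]; module

theorem tidalDot_smul (x : Plane) (c : ℝ) (v : Plane) :
    tidalDot x (c • v) = c ^ 2 • tidalDot x v := by
  simp only [tidalDot, inner_smul_right, norm_smul, mul_pow, Real.norm_eq_abs, sq_abs]; module

theorem contDiffAt_tidalDot {E : Type*} [NormedAddCommGroup E] [NormedSpace ℝ E] {x v : E → Plane}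
    {z : E} (hx : ContDiffAt ℝ ∞ x z) (hv : ContDiffAt ℝ ∞ v z) (h0 : x z ≠ 0) :
    ContDiffAt ℝ ∞ (fun y => tidalDot (x y) (v y)) z := by
  have := contDiffAt_norm_pow_inv 5 hx h0
  have := contDiffAt_norm_pow_inv 7 hx h0
  have := hx.inner ℝ hv
  have := hv.norm_sq ℝ
  unfold tidalDot
  fun_prop

/-- The fourth order expansion of the second difference of a motion. -/
theorem exists_second_difference_bound (σ : ℝ) {K : Set State} (hKU : K ⊆ regular σ)
    (hK : IsCompact K) : ∃ C > 0, ∀ h > 0, ∀ s : ℝ → State,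
      (∀ τ ∈ Icc (-h) h, (s τ).1 = h ^ 2 ∧ s τ ∈ K ∧ HasDerivAt s (field σ (s τ)) τ) →
      ‖(s h).2.1 - (2 : ℝ) • (s 0).2.1 + (s (-h)).2.1 - (h ^ 2 • force (s 0).2.1 +
        h ^ 4 • (leadingPerturbation σ (s 0).2.1 (s 0).2.2 - (1 / 12 : ℝ) •
          (tidalDot (s 0).2.1 (s 0).2.2 + tidal (s 0).2.1 (force (s 0).2.1))))‖ ≤ C * h ^ 6 := by
  have hU := isOpen_regular σ
  have hW := contDiffOn_field σ
  have hp := contDiffOn_perturbation σ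
  obtain ⟨p₁, hp₁, hp₁d⟩ := exists_lieDeriv hU hW hp
  obtain ⟨p₂, hp₂, hp₂d⟩ := exists_lieDeriv hU hW hp₁
  -- The fourth derivative of the position, written with the state coordinate ε in place of h². It
  -- is then a fixed function of the state, and its further derivatives are bounded on K uniformly
  -- in h.
  have hu₄ : ContDiffOn ℝ ∞ (fun s : State => -(tidalDot s.2.1 s.2.2 +
      tidal s.2.1 (acceleration σ s.1 s.2.1 s.2.2)) + s.1 • p₂ s) (regular σ) := by
    intro s hs
    obtain ⟨he, hx, hv⟩ := contDiffAt_state s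
    exact (((contDiffAt_tidalDot hx hv hs.1).add (contDiffAt_tidal hx
      (contDiffAt_acceleration he hx hv hs.1 hs.2.1 hs.2.2.1) hs.1)).neg.add
      (he.smul (hp₂.contDiffAt (hU.mem_nhds hs)))).contDiffWithinAt
  obtain ⟨u₅, hu₅, hu₅d⟩ := exists_lieDeriv hU hW hu₄
  obtain ⟨u₆, hu₆, hu₆d⟩ := exists_lieDeriv hU hW hu₅
  have hrem : ContDiffOn ℝ ∞ (fun s : State => (1 / 12 : ℝ) • (p₂ s -
      tidal s.2.1 (perturbation σ s.1 s.2.1 s.2.2)) - (σ / 12) • velocity σ s.1 s.2.1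
        (tidal s.2.1 (leadingPerturbation σ s.2.1 s.2.2))) (regular σ) := by
    intro s hs
    obtain ⟨he, hx, hv⟩ := contDiffAt_state s
    have hl := contDiffAt_leadingPerturbation σ hx hv hs.1
    have ht := contDiffAt_tidal hx hl hs.1
    exact (((contDiffAt_const (c := (1 / 12 : ℝ))).smul ((hp₂.contDiffAt (hU.mem_nhds hs)).sub
      (contDiffAt_tidal hx (hp.contDiffAt (hU.mem_nhds hs)) hs.1))).sub
      ((contDiffAt_const (c := σ / 12)).smul
        (contDiffAt_velocity he hx ht hs.1 hs.2.1 hs.2.2.1))).contDiffWithinAt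
  obtain ⟨C₁, hC₁, hb₁, -⟩ := exists_bound_lipschitz hU hK hKU hu₆
  obtain ⟨C₂, hC₂, hb₂, -⟩ := exists_bound_lipschitz hU hK hKU hrem
  refine ⟨2 * C₁ + C₂, by positivity, fun h hh s hs => ?_⟩
  have hr : ∀ τ ∈ Icc (-h) h, s τ ∈ regular σ := fun τ hτ => hKU (hs τ hτ).2.1
  have hx : ∀ τ ∈ Icc (-h) h, HasDerivAt (fun τ => (s τ).2.1) (s τ).2.2 τ := fun τ hτ =>
    (hasDerivAt_state (hs τ hτ).2.2).2.1
  have hv : ∀ τ ∈ Icc (-h) h, HasDerivAt (fun τ => (s τ).2.2)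
      (force (s τ).2.1 + h ^ 2 • perturbation σ (s τ).1 (s τ).2.1 (s τ).2.2) τ := fun τ hτ => by
    have := (hasDerivAt_state (hs τ hτ).2.2).2.2
    simp only [field, acceleration] at this
    rw [← (hs τ hτ).1]
    exact this
  have h6 := norm_symm_diff_le_six (y₀ := fun τ => (s τ).2.1) (y₁ := fun τ => (s τ).2.2)
    (y₂ := fun τ => force (s τ).2.1 + h ^ 2 • perturbation σ (s τ).1 (s τ).2.1 (s τ).2.2)
    (y₃ := fun τ => -tidal (s τ).2.1 (s τ).2.2 + h ^ 2 • p₁ (s τ))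
    (y₄ := fun τ => -(tidalDot (s τ).2.1 (s τ).2.2 + tidal (s τ).2.1
      (acceleration σ (s τ).1 (s τ).2.1 (s τ).2.2)) + (s τ).1 • p₂ (s τ))
    (y₅ := fun τ => u₅ (s τ)) (y₆ := fun τ => u₆ (s τ)) (h := h) (C := C₁) hx hv
    (fun τ hτ => (hasDerivAt_force (hx τ hτ) (hr τ hτ).1).fun_add
      ((hp₁d s τ (hr τ hτ) (hs τ hτ).2.2).const_smul (h ^ 2)))
    (fun τ hτ => by
      have := ((hasDerivAt_tidal (hx τ hτ) (hv τ hτ) (hr τ hτ).1).fun_neg).fun_add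
        ((hp₂d s τ (hr τ hτ) (hs τ hτ).2.2).const_smul (h ^ 2))
      rwa [← (hs τ hτ).1] at this ⊢)
    (fun τ hτ => hu₅d s τ (hr τ hτ) (hs τ hτ).2.2)
    (fun τ hτ => hu₆d s τ (hr τ hτ) (hs τ hτ).2.2)
    (fun τ hτ => hb₁ _ (hs τ hτ).2.1) h ⟨hh.le, le_rfl⟩
  have h0 : (0 : ℝ) ∈ Icc (-h) h := ⟨by linarith, hh.le⟩
  have e2 := hb₂ _ (hs 0 h0).2.1
  have e1 : (s 0).1 = h ^ 2 := (hs 0 h0).1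
  simp only [acceleration, e1, tidal_add, tidal_smul] at h6 e2
  -- The perturbation is expanded only in the h⁴ term; inside `tidal` it belongs to the bounded h⁶
  -- remainder and stays opaque.
  obtain ⟨P, hP⟩ : ∃ P, P = perturbation σ (h ^ 2) (s 0).2.1 (s 0).2.2 := ⟨_, rfl⟩
  rw [← hP] at h6 e2
  have eP : P = _ := hP.trans (perturbation.eq_def ..)
  generalize tidal (s 0).2.1 P = tP at h6 e2
  rw [eP] at h6
  have e3 := mul_le_mul_of_nonneg_left e2 (by positivity : 0 ≤ h ^ 6)
  rw [← Real.norm_of_nonneg (by positivity : 0 ≤ h ^ 6), ← norm_smul,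
    Real.norm_of_nonneg (by positivity : 0 ≤ h ^ 6)] at e3
  calc _ ≤ _ := (le_of_eq ?_ : _ ≤ ‖_ + h ^ 6 • (_ : Plane)‖).trans (norm_add_le _ _)
    _ ≤ 2 * C₁ * h ^ 6 + h ^ 6 * C₂ := add_le_add h6 e3
    _ = _ := by ring
  congr 1
  module

/-- For σ = -2 the leading perturbation is exactly -1/12 of the fourth derivative along the Kepler
flow, so the h⁴ term of the second difference vanishes. -/
theorem verlet_isConsistent : IsConsistent (-2) verletForce := by
  intro K hKU hK
  obtain ⟨C, hC, hb⟩ := exists_second_difference_bound (-2) hKU hK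
  refine ⟨C, hC, 1, one_pos, fun h hh s hs => ?_⟩
  have h1 := hb h hh.1 s hs
  have h0 : (0 : ℝ) ∈ Icc (-h) h := ⟨by linarith [hh.1], hh.1.le⟩
  have hx : ‖(s 0).2.1‖ ≠ 0 := norm_ne_zero_iff.mpr (hKU (hs 0 h0).2.1).1
  have e : leadingPerturbation (-2) (s 0).2.1 (s 0).2.2 - (1 / 12 : ℝ) •
      (tidalDot (s 0).2.1 (s 0).2.2 + tidal (s 0).2.1 (force (s 0).2.1)) = 0 := by
    simp only [leadingPerturbation, radialCoeff, velocityCoeff, tidalDot, tidal, force,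
      inner_neg_right, inner_smul_right, real_inner_self_eq_norm_sq]
    match_scalars
    · field_simp
      ring
    · ring
  rwa [e, smul_zero, add_zero] at h1

/-- The fourth order expansion of the right hand side of the midpoint rule. -/
theorem exists_midpoint_bound (σ : ℝ) {K : Set State} (hKU : K ⊆ regular σ)
    (hK : IsCompact K) : ∃ C > 0, ∃ h₁ > 0, ∀ h ∈ Ioo 0 h₁, ∀ s : ℝ → State,
      (∀ τ ∈ Icc (-h) h, (s τ).1 = h ^ 2 ∧ s τ ∈ K ∧ HasDerivAt s (field σ (s τ)) τ) →
      ‖midpointForce (s (-h)).2.1 (s 0).2.1 (s h).2.1 - (force (s 0).2.1 -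
        h ^ 2 • ((1 / 8 : ℝ) • tidalDot (s 0).2.1 (s 0).2.2 +
          (1 / 4 : ℝ) • tidal (s 0).2.1 (force (s 0).2.1)))‖ ≤ C * h ^ 4 := by
  have hU := isOpen_regular σ
  have hp := contDiffOn_perturbation σ
  -- The position at time 0 is adjoined as a frozen coordinate. The two midpoints of the method are
  -- then the values at τ = ±h of one smooth curve, and its symmetric difference can be expanded.
  set m : Plane × State → Plane := fun z => (1 / 2 : ℝ) • (z.1 + z.2.2.1) with hm
  set U : Set (Plane × State) := {z | z.2 ∈ regular σ ∧ m z ≠ 0} with hU_def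
  have hmc : ContDiff ℝ ∞ m := by fun_prop
  have hUo : IsOpen U := (hU.preimage continuous_snd).inter
    (isOpen_ne_fun hmc.continuous continuous_const)
  set W : Plane × State → Plane × State := fun z => (0, field σ z.2) with hW_def
  have hW : ContDiffOn ℝ ∞ W U := contDiffOn_const.prodMk
    ((contDiffOn_field σ).comp contDiffOn_snd fun z hz => hz.1)
  have hu₂ : ContDiffOn ℝ ∞ (fun z : Plane × State => -(tidalDot (m z) ((1 / 2 : ℝ) • z.2.2.2) +
      tidal (m z) ((1 / 2 : ℝ) • acceleration σ z.2.1 z.2.2.1 z.2.2.2))) U := by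
    intro z hz
    have hsnd : ContDiffAt ℝ ∞ (fun z : Plane × State => z.2) z := contDiffAt_snd
    have he := (contDiffAt_state z.2).1.comp z hsnd
    have hx := (contDiffAt_state z.2).2.1.comp z hsnd
    have hv := (contDiffAt_state z.2).2.2.comp z hsnd
    have hc : ContDiffAt ℝ ∞ (fun _ : Plane × State => (1 / 2 : ℝ)) z := contDiffAt_const
    exact ((contDiffAt_tidalDot hmc.contDiffAt (hc.smul hv) hz.2).add
      (contDiffAt_tidal hmc.contDiffAt (hc.smul
        (contDiffAt_acceleration he hx hv hz.1.1 hz.1.2.1 hz.1.2.2.1)) hz.2)).neg.contDiffWithinAt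
  obtain ⟨u₃, hu₃, hu₃d⟩ := exists_lieDeriv hUo hW hu₂
  obtain ⟨u₄, hu₄, hu₄d⟩ := exists_lieDeriv hUo hW hu₃
  rcases K.eq_empty_or_nonempty with rfl | hKne
  · refine ⟨1, one_pos, 1, one_pos, fun h hh s hs => ?_⟩
    exact absurd (hs h ⟨by linarith [hh.1], le_rfl⟩).2.1 (notMem_empty _)
  obtain ⟨s₀, hs₀, hmin⟩ := hK.exists_isMinOn hKne
    (continuous_snd.fst.norm.continuousOn (s := K) (f := fun s : State => ‖s.2.1‖))
  set d := ‖s₀.2.1‖ with hd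
  have hd0 : 0 < d := norm_pos_iff.mpr (hKU hs₀).1
  have hdK : ∀ s ∈ K, d ≤ ‖s.2.1‖ := fun s hs => hmin hs
  have hsc : ∀ f : State → Plane, (∀ s, ContDiffAt ℝ ∞ f s) → ContDiffOn ℝ ∞ f (regular σ) :=
    fun f hf s _ => (hf s).contDiffWithinAt
  obtain ⟨R, hR, hbR, -⟩ := exists_bound_lipschitz hU hK hKU
    (hsc (fun s => s.2.1) fun s => (contDiffAt_state s).2.1)
  obtain ⟨M, hM, hbM, -⟩ := exists_bound_lipschitz hU hK hKU
    (hsc (fun s => s.2.2) fun s => (contDiffAt_state s).2.2)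
  -- Positions in K have norm at least d, so midpoints of positions at distance at most d stay at
  -- least d/2 from the origin. Steps shorter than d/M satisfy this.
  set K' : Set (Plane × State) := closedBall 0 R ×ˢ K ∩ {z | ‖z.1 - z.2.2.1‖ ≤ d} with hK'
  have hK'c : IsCompact K' := ((isCompact_closedBall 0 R).prod hK).inter_right
    (isClosed_le (by fun_prop) continuous_const)
  have hK'U : K' ⊆ U := by
    rintro z ⟨⟨-, hz⟩, hzd⟩
    refine ⟨hKU hz, ?_⟩
    have e : z.2.2.1 = m z - (1 / 2 : ℝ) • (z.1 - z.2.2.1) := by simp only [hm]; module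
    have h1 := norm_sub_le (m z) ((1 / 2 : ℝ) • (z.1 - z.2.2.1))
    rw [← e, norm_smul (1 / 2 : ℝ) (z.1 - z.2.2.1), Real.norm_of_nonneg (by norm_num)] at h1
    have h2 := hdK _ hz
    have h3 : ‖z.1 - z.2.2.1‖ ≤ d := hzd
    rw [← norm_pos_iff]
    linarith
  obtain ⟨C₁, hC₁, hb₁, -⟩ := exists_bound_lipschitz hUo hK'c hK'U hu₄
  obtain ⟨C₂, hC₂, hb₂, -⟩ := exists_bound_lipschitz hU hK hKU
    (u := fun s : State => (1 / 4 : ℝ) • tidal s.2.1 (perturbation σ s.1 s.2.1 s.2.2))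
    (fun s hs => ((contDiffAt_const (c := (1 / 4 : ℝ))).smul (contDiffAt_tidal
      (contDiffAt_state s).2.1 (hp.contDiffAt (hU.mem_nhds hs)) hs.1)).contDiffWithinAt)
  refine ⟨C₁ + C₂, by positivity, d / M, by positivity, fun h hh s hs => ?_⟩
  obtain ⟨hh0, hh1⟩ := hh
  rw [lt_div_iff₀ hM] at hh1
  have h0 : (0 : ℝ) ∈ Icc (-h) h := ⟨by linarith, hh0.le⟩
  have hr : ∀ τ ∈ Icc (-h) h, s τ ∈ regular σ := fun τ hτ => hKU (hs τ hτ).2.1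
  have hx : ∀ τ ∈ Icc (-h) h, HasDerivAt (fun τ => (s τ).2.1) (s τ).2.2 τ := fun τ hτ =>
    (hasDerivAt_state (hs τ hτ).2.2).2.1
  have hv : ∀ τ ∈ Icc (-h) h, HasDerivAt (fun τ => (s τ).2.2)
      (acceleration σ (s τ).1 (s τ).2.1 (s τ).2.2) τ := fun τ hτ =>
    (hasDerivAt_state (hs τ hτ).2.2).2.2
  set z : ℝ → Plane × State := fun τ => ((s 0).2.1, s τ) with hz_def
  have hzd : ∀ τ ∈ Icc (-h) h, HasDerivAt z (W (z τ)) τ := fun τ hτ =>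
    (hasDerivAt_const τ _).prodMk (hs τ hτ).2.2
  have hzK : ∀ τ ∈ Icc (-h) h, z τ ∈ K' := by
    intro τ hτ
    refine ⟨⟨by simpa using hbR _ (hs 0 h0).2.1, (hs τ hτ).2.1⟩, ?_⟩
    have := (convex_Icc (-h) h).norm_image_sub_le_of_norm_hasDerivWithin_le (C := M)
      (fun τ hτ => (hx τ hτ).hasDerivWithinAt) (fun τ hτ => hbM _ (hs τ hτ).2.1) hτ h0
    refine this.trans ?_
    have h1 : ‖0 - τ‖ ≤ h := by
      rw [zero_sub, norm_neg, Real.norm_eq_abs, abs_le]; exact hτ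
    nlinarith
  have hzU : ∀ τ ∈ Icc (-h) h, z τ ∈ U := fun τ hτ => hK'U (hzK τ hτ)
  have hmd : ∀ τ ∈ Icc (-h) h, HasDerivAt (fun τ => m (z τ)) ((1 / 2 : ℝ) • (s τ).2.2) τ :=
    fun τ hτ => ((hx τ hτ).const_add (s 0).2.1).const_smul (1 / 2 : ℝ)
  have h4 := norm_symm_diff_le_four (y₀ := fun τ => force (m (z τ)))
    (y₁ := fun τ => -tidal (m (z τ)) ((1 / 2 : ℝ) • (s τ).2.2))
    (y₂ := fun τ => -(tidalDot (m (z τ)) ((1 / 2 : ℝ) • (s τ).2.2) +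
      tidal (m (z τ)) ((1 / 2 : ℝ) • acceleration σ (s τ).1 (s τ).2.1 (s τ).2.2)))
    (y₃ := fun τ => u₃ (z τ)) (y₄ := fun τ => u₄ (z τ)) (h := h) (C := C₁)
    (fun τ hτ => hasDerivAt_force (hmd τ hτ) (hzU τ hτ).2)
    (fun τ hτ => (hasDerivAt_tidal (V := fun τ => (1 / 2 : ℝ) • (s τ).2.2) (hmd τ hτ)
      ((hv τ hτ).const_smul (1 / 2 : ℝ)) (hzU τ hτ).2).fun_neg)
    (fun τ hτ => hu₃d z τ (hzU τ hτ) (hzd τ hτ))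
    (fun τ hτ => hu₄d z τ (hzU τ hτ) (hzd τ hτ))
    (fun τ hτ => hb₁ _ (hzK τ hτ)) h ⟨hh0.le, le_rfl⟩
  have e2 := hb₂ _ (hs 0 h0).2.1
  have e1 : (s 0).1 = h ^ 2 := (hs 0 h0).1
  have em : m (z 0) = (s 0).2.1 := by simp only [hm, hz_def]; module
  simp only [em, acceleration, e1, tidal_add, tidal_smul, tidalDot_smul] at h4 e2
  have e5 : midpointForce (s (-h)).2.1 (s 0).2.1 (s h).2.1 =
      (1 / 2 : ℝ) • (force (m (z h)) + force (m (z (-h)))) := by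
    rw [midpointForce, add_comm (s (-h)).2.1, ← smul_add]
  rw [e5]
  have e3 := mul_le_mul_of_nonneg_left e2 (by positivity : 0 ≤ h ^ 4)
  rw [← Real.norm_of_nonneg (by positivity : 0 ≤ h ^ 4), ← norm_smul,
    Real.norm_of_nonneg (by positivity : 0 ≤ h ^ 4)] at e3
  have e4 := mul_le_mul_of_nonneg_left h4 (by norm_num : (0 : ℝ) ≤ 1 / 2)
  rw [← Real.norm_of_nonneg (by norm_num : (0 : ℝ) ≤ 1 / 2), ← norm_smul,
    Real.norm_of_nonneg (by norm_num : (0 : ℝ) ≤ 1 / 2)] at e4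
  calc _ ≤ _ := (le_of_eq ?_ : _ ≤ ‖(1 / 2 : ℝ) • (_ : Plane) - h ^ 4 • (_ : Plane)‖).trans
        (norm_sub_le _ _)
    _ ≤ 1 / 2 * (2 * C₁ * h ^ 4) + h ^ 4 * C₂ := add_le_add e4 e3
    _ = _ := by ring
  congr 1
  module

/-- With D' = `tidalDot x v` and Df = `tidal x (force x)`, the h⁴ terms match when the leading
perturbation is (1/12 - 1/8)D' + (1/12 - 1/4)Df = -(D'/24 + Df/6). This is its value at σ = 1. -/
theorem midpoint_isConsistent : IsConsistent 1 midpointForce := by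
  intro K hKU hK
  obtain ⟨C, hC, hb⟩ := exists_second_difference_bound 1 hKU hK
  obtain ⟨C', hC', h₁, hh₁, hb'⟩ := exists_midpoint_bound 1 hKU hK
  refine ⟨C + C', by positivity, h₁, hh₁, fun h hh s hs => ?_⟩
  have h1 := hb h hh.1 s hs
  have h2 := hb' h hh s hs
  have h0 : (0 : ℝ) ∈ Icc (-h) h := ⟨by linarith [hh.1], hh.1.le⟩
  have hx : ‖(s 0).2.1‖ ≠ 0 := norm_ne_zero_iff.mpr (hKU (hs 0 h0).2.1).1
  have e : leadingPerturbation 1 (s 0).2.1 (s 0).2.2 = -((1 / 24 : ℝ) •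
      tidalDot (s 0).2.1 (s 0).2.2 + (1 / 6 : ℝ) • tidal (s 0).2.1 (force (s 0).2.1)) := by
    simp only [leadingPerturbation, radialCoeff, velocityCoeff, tidalDot, tidal, force,
      inner_neg_right, inner_smul_right, real_inner_self_eq_norm_sq]
    match_scalars
    · field_simp
      ring
    · ring
  rw [e] at h1
  have e3 := mul_le_mul_of_nonneg_left h2 (sq_nonneg h)
  rw [← Real.norm_of_nonneg (sq_nonneg h), ← norm_smul, Real.norm_of_nonneg (sq_nonneg h)] at e3
  calc _ ≤ _ := (le_of_eq ?_ : _ ≤ ‖_ - h ^ 2 • (_ : Plane)‖).trans (norm_sub_le _ _)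
    _ ≤ C * h ^ 6 + h ^ 2 * (C' * h ^ 4) := add_le_add h1 e3
    _ = _ := by ring
  congr 1
  module

/-! ### The modified Lagrangians -/

theorem eventually_mul_le (c : ℝ) {ε : ℝ} (hε : 0 < ε) : ∀ᶠ h in 𝓝[>] (0 : ℝ), c * h ≤ ε := by
  have h1 : Tendsto (fun h : ℝ => c * h) (𝓝 0) (𝓝 (c * 0)) := tendsto_id.const_mul c
  rw [mul_zero] at h1
  exact ((h1.mono_left nhdsWithin_le_nhds).eventually_lt_const hε).mono fun _ h => h.le

theorem exists_pos_forall_Ioo {p : ℝ → Prop} (hp : ∀ᶠ h in 𝓝[>] (0 : ℝ), p h) :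
    ∃ h₀ > 0, ∀ h ∈ Ioo 0 h₀, p h := by
  obtain ⟨u, hu, hs⟩ := mem_nhdsGT_iff_exists_Ioo_subset.mp hp
  exact ⟨u, hu, fun h hh => hs hh⟩

/-- Two steps of Newton's iteration for `F w = y`, where `F` is nearly `w ↦ F w₀ + h • (w - w₀)`. -/
theorem exists_shooting {F : Plane → Plane} {w₀ y : Plane} {h B c : ℝ} (h0 : 0 < h) (h1 : h ≤ 1)
    (hB : 0 ≤ B) (hc : 0 ≤ c)
    (hF : ∀ w w', ‖w - w₀‖ ≤ c * (1 + B) * h ^ 2 → ‖w' - w₀‖ ≤ c * (1 + B) * h ^ 2 →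
      ‖F w - F w' - h • (w - w')‖ ≤ B * h ^ 2 * ‖w - w'‖) (hy : ‖y - F w₀‖ ≤ c * h ^ 3) :
    ∃ w, ‖w - w₀‖ ≤ c * (1 + B) * h ^ 2 ∧ ‖y - F w‖ ≤ B ^ 2 * c * h ^ 5 := by
  have key : ∀ w, ‖w - w₀‖ ≤ c * (1 + B) * h ^ 2 →
      ‖w + h⁻¹ • (y - F w) - w₀‖ ≤ c * (1 + B) * h ^ 2 →
      ‖y - F (w + h⁻¹ • (y - F w))‖ ≤ B * h * ‖y - F w‖ := by
    intro w hw hw'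
    have h2 := hF _ _ hw' hw
    rw [add_sub_cancel_left, smul_inv_smul₀ h0.ne', norm_smul, norm_inv,
      Real.norm_of_nonneg h0.le] at h2
    rw [← norm_neg]
    calc _ = _ := by congr 1; module
      _ ≤ _ := h2
      _ = _ := by field_simp
  have step : ∀ w, ‖w + h⁻¹ • (y - F w) - w‖ = h⁻¹ * ‖y - F w‖ := fun w => by
    rw [add_sub_cancel_left, norm_smul, norm_inv, Real.norm_of_nonneg h0.le]
  have hcB : c * h ^ 2 ≤ c * (1 + B) * h ^ 2 := by
    have : 0 ≤ c * B * h ^ 2 := by positivity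
    linarith
  have hw0 : ‖w₀ - w₀‖ ≤ c * (1 + B) * h ^ 2 := by
    rw [sub_self, norm_zero]
    positivity
  set w₁ := w₀ + h⁻¹ • (y - F w₀) with hw₁
  have h2 : ‖w₁ - w₀‖ ≤ c * h ^ 2 := by
    rw [hw₁, step]
    calc _ ≤ h⁻¹ * (c * h ^ 3) := by gcongr
      _ = _ := by field_simp
  have hw1 := h2.trans hcB
  have h3 : ‖y - F w₁‖ ≤ B * c * h ^ 4 :=
    calc _ ≤ B * h * ‖y - F w₀‖ := key _ hw0 hw1
      _ ≤ B * h * (c * h ^ 3) := by gcongr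
      _ = _ := by ring
  have h4 : ‖w₁ + h⁻¹ • (y - F w₁) - w₁‖ ≤ B * c * h ^ 2 := by
    rw [step]
    calc _ ≤ h⁻¹ * (B * c * h ^ 4) := by gcongr
      _ = B * c * h ^ 2 * h := by field_simp
      _ ≤ B * c * h ^ 2 * 1 := by gcongr
      _ = _ := mul_one _
  have hw2 : ‖w₁ + h⁻¹ • (y - F w₁) - w₀‖ ≤ c * (1 + B) * h ^ 2 :=
    (norm_sub_le_norm_sub_add_norm_sub _ w₁ _).trans (by linarith)
  refine ⟨_, hw2, (key _ hw1 hw2).trans ?_⟩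
  calc _ ≤ B * h * (B * c * h ^ 4) := by gcongr
    _ = _ := by ring

/-- Numerical solutions shadow the solutions of the modified equation. -/
theorem IsConsistent.exists_shadow {σ : ℝ} {Φ : Plane → Plane → Plane → Plane}
    (hΦ : IsConsistent σ Φ) (hb : ∀ ρ > 0, ∃ Λ ≥ 0, MethodBound Φ ρ Λ) {K : Set State}
    (hKU : K ⊆ regular σ) (hK : IsCompact K) {T c : ℝ} (hT : 0 < T) (hc : 0 ≤ c) :
    ∃ E > 0, ∃ h₀ > 0, ∀ h ∈ Ioo 0 h₀, ∀ s : ℝ → State,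
      (∀ t ∈ Icc 0 T, (s t).1 = h ^ 2 ∧ s t ∈ K ∧ HasDerivAt s (field σ (s t)) t) →
      ∀ x₁, ‖x₁ - (s h).2.1‖ ≤ c * h ^ 5 →
        (∃ x, IsNumericalSolution Φ h T x ∧ x 0 = (s 0).2.1 ∧ x 1 = x₁) ∧
        ∀ x, IsNumericalSolution Φ h T x → x 0 = (s 0).2.1 → x 1 = x₁ →
          ∀ k : ℕ, k * h ≤ T → ‖x k - (s (k * h)).2.1‖ ≤ E * h ^ 4 := by
  rcases K.eq_empty_or_nonempty with rfl | hKne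
  · refine ⟨1, one_pos, 1, one_pos, fun h hh s hs => ?_⟩
    exact absurd (hs 0 ⟨le_rfl, hT.le⟩).2.1 (notMem_empty _)
  obtain ⟨s₀, hs₀, hmin⟩ := hK.exists_isMinOn hKne
    (continuous_snd.fst.norm.continuousOn (s := K) (f := fun s : State => ‖s.2.1‖))
  set ρ := ‖s₀.2.1‖ / 2 with hρ_def
  have hρ : 0 < ρ := half_pos (norm_pos_iff.mpr (hKU hs₀).1)
  have hρK : ∀ s ∈ K, 2 * ρ ≤ ‖s.2.1‖ := fun s hs => by
    rw [hρ_def, mul_div_cancel₀ _ two_ne_zero]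
    exact hmin hs
  obtain ⟨Λ, hΛ0, hΛ⟩ := hb ρ hρ
  obtain ⟨M, hM, hbM, -⟩ := exists_bound_lipschitz (isOpen_regular σ) hK hKU
    (u := fun s : State => s.2.2) fun s _ => (contDiffAt_state s).2.2.contDiffWithinAt
  obtain ⟨C, hC, h₁, hh₁, hres⟩ := hΦ K hKU hK
  set E := (C + c) * (1 + 2 * T) * Real.exp ((1 + 11 * Λ) * T) with hE
  have hE0 : 0 < E := by positivity
  refine ⟨E, hE0, exists_pos_forall_Ioo ?_⟩
  filter_upwards [self_mem_nhdsWithin, eventually_mul_le 1 one_pos, eventually_mul_le 1 hT,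
    eventually_mul_le 1 (half_pos hh₁), eventually_mul_le Λ (by norm_num : (0 : ℝ) < 1 / 2),
    eventually_mul_le Λ (by positivity : (0 : ℝ) < ρ / 4),
    eventually_mul_le E (by positivity : (0 : ℝ) < ρ / 16),
    eventually_mul_le M (by positivity : (0 : ℝ) < ρ / 8),
    eventually_mul_le c (by positivity : (0 : ℝ) < ρ / 8)]
    with h h0 hle hhT hhh hl1 hl2 hE1 hM1 hc1 s hs x₁ hx₁
  rw [mem_Ioi] at h0
  rw [one_mul] at hle hhT hhh
  have hpow : ∀ n : ℕ, n ≠ 0 → h ^ n ≤ h := fun n hn => pow_le_of_le_one h0.le hle hn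
  have hmem : ∀ k : ℕ, (k : ℝ) * h ≤ T → (k : ℝ) * h ∈ Icc 0 T := fun k hk => ⟨by positivity, hk⟩
  have hX : ∀ k : ℕ, k * h ≤ T → 2 * ρ ≤ ‖(s (k * h)).2.1‖ := fun k hk =>
    hρK _ (hs _ (hmem k hk)).2.1
  have hXs : ∀ k : ℕ, (k + 1) * h ≤ T →
      ‖(s ((k + 1 : ℕ) * h)).2.1 - (s (k * h)).2.1‖ ≤ ρ / 8 := by
    intro k hk
    have hk' : ((k + 1 : ℕ) : ℝ) * h ≤ T := by push_cast; exact hk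
    have hk'' : (k : ℝ) * h ≤ T := by linarith
    refine (Convex.norm_image_sub_le_of_norm_hasDerivWithin_le (C := M) (s := Icc 0 T)
      (fun t ht => (hasDerivAt_state (hs t ht).2.2).2.1.hasDerivWithinAt)
      (fun t ht => hbM _ (hs t ht).2.1) (convex_Icc 0 T) (hmem _ hk'') (hmem _ hk')).trans ?_
    rw [← sub_mul, Nat.cast_add_one, add_sub_cancel_left, one_mul, Real.norm_of_nonneg h0.le]
    exact hM1
  have hXe : ∀ k : ℕ, (k + 2) * h ≤ T →
      ‖(s ((k + 2 : ℕ) * h)).2.1 - (2 : ℝ) • (s ((k + 1 : ℕ) * h)).2.1 + (s (k * h)).2.1 -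
        h ^ 2 • Φ (s (k * h)).2.1 (s ((k + 1 : ℕ) * h)).2.1 (s ((k + 2 : ℕ) * h)).2.1‖ ≤
        (C + c) * h ^ 6 := by
    intro k hk
    -- The system is autonomous, so consistency at time 0 applies to the curve recentred at (k +
    -- 1)h.
    have h2 := hres h ⟨h0, by linarith⟩ (fun τ => s ((k + 1 : ℕ) * h + τ)) fun τ hτ => by
      have hm : ((k + 1 : ℕ) : ℝ) * h + τ ∈ Icc 0 T := by
        push_cast
        constructor
        · have : 0 ≤ (k : ℝ) * h := by positivity
          linarith [hτ.1]
        · linarith [hτ.2]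
      exact ⟨(hs _ hm).1, (hs _ hm).2.1, (hs _ hm).2.2.comp_const_add _ _⟩
    rw [show ((k + 1 : ℕ) : ℝ) * h + h = (k + 2 : ℕ) * h by push_cast; ring,
      show ((k + 1 : ℕ) : ℝ) * h + -h = k * h by push_cast; ring, add_zero] at h2
    exact h2.trans (by gcongr; linarith)
  have hx₁' : ‖x₁ - (s ((1 : ℕ) * h)).2.1‖ ≤ (C + c) * h ^ 5 := by
    rw [Nat.cast_one, one_mul]
    exact hx₁.trans (by gcongr; linarith)
  have hclose : ∀ x T', T' ≤ T → IsNumericalSolution Φ h T' x → x 0 = (s 0).2.1 → x 1 = x₁ →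
      ∀ k : ℕ, k * h ≤ T' → ‖x k - (s (k * h)).2.1‖ ≤ E * h ^ 4 := by
    intro x T' hT' hx hx0 hx1 k hk
    have hEh : E * h ^ 4 ≤ ρ := (mul_le_mul_of_nonneg_left (hpow 4 (by norm_num)) hE0.le).trans
      (by linarith)
    refine IsNumericalSolution.close (X := fun k : ℕ => (s (k * h)).2.1) hΛ hρ.le hΛ0
      (by positivity) h0 hle (by linarith) hEh hX (fun k hk => (hXs k hk).trans ?_) hXe hT' hx
      ?_ ?_ k hk
    · have := hX k (by linarith)
      linarith
    · simpa using hx0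
    · simpa [hx1] using hx₁'
  refine ⟨?_, fun x => hclose x T le_rfl⟩
  have hh2 : h ^ 2 * Λ ≤ Λ * h := by
    rw [mul_comm]
    exact mul_le_mul_of_nonneg_left (hpow 2 (by norm_num)) hΛ0
  refine exists_isNumericalSolution (X := fun k : ℕ => (s (k * h)).2.1) hΛ h0 (hh2.trans hl1)
    (hh2.trans hl2) hX hXs (C := E * h ^ 4)
    ((mul_le_mul_of_nonneg_left (hpow 4 (by norm_num)) hE0.le).trans hE1) hρ hclose ?_
  have h3 := hXs 0 (by simpa using hhT)
  have h4 := hX 0 (by simpa using hT.le)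
  simp only [zero_add, Nat.cast_one, one_mul, Nat.cast_zero, zero_mul] at h3 h4
  have h5 := norm_sub_le_norm_sub_add_norm_sub x₁ (s h).2.1 (s 0).2.1
  have h6 := mul_le_mul_of_nonneg_left (hpow 5 (by norm_num)) hc
  linarith

/-- The position γ(0) is kept and the initial velocity is tuned by O(h²) until the modified flow at
time h meets x₁ up to O(h⁵). This is the accuracy at which shadowing starts. -/
theorem IsKepler.isModifiedLagrangian {γ γ' : ℝ → Plane} (hγ : IsKepler γ γ')
    (hA : lrl (γ 0) (γ' 0) ≠ 0) {T : ℝ} (hT : 0 < T) {σ : ℝ} {Φ : Plane → Plane → Plane → Plane}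
    (hΦ : IsConsistent σ Φ) (hb : ∀ ρ > 0, ∃ Λ ≥ 0, MethodBound Φ ρ Λ) :
    IsModifiedLagrangian Φ (modLagrangian σ) γ γ' T := by
  intro κ hκ
  obtain ⟨K, hKU, hK, δ, hδ, A, hA1, Y, hγK, hY, hYY⟩ := hγ.exists_flow hA hT.le σ
  obtain ⟨M, hM, hbM, hlM⟩ := exists_bound_lipschitz (isOpen_regular σ) hK hKU
    (contDiffOn_field σ)
  have hA0 : 0 < A := by linarith
  -- The shooting constants are c = κ + A, from the prescribed deviation κh³ plus the drift Ah³ of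
  -- the modified flow from γ, and B = MA, from integrating the Lipschitz bound of the acceleration
  -- twice.
  set R := 1 + (κ + A) * (1 + M * A) with hR
  have hR1 : 1 ≤ R := by
    have : 0 ≤ (κ + A) * (1 + M * A) := by positivity
    linarith
  obtain ⟨E, hE, h₁, hh₁, hsh⟩ := hΦ.exists_shadow hb hKU hK hT
    (by positivity : 0 ≤ (M * A) ^ 2 * (κ + A))
  refine ⟨E + R, by positivity, exists_pos_forall_Ioo ?_⟩
  filter_upwards [self_mem_nhdsWithin, eventually_mul_le 1 one_pos, eventually_mul_le 1 hT,
    eventually_mul_le 1 (half_pos hh₁), eventually_mul_le (A * R) hδ] with h h0 hle hhT hhh hAR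
  rw [mem_Ioi] at h0
  rw [one_mul] at hle hhT hhh
  have hh2 : h ^ 2 ≤ h := pow_le_of_le_one h0.le hle two_ne_zero
  have hd : ∀ w w' : Plane, dist (h ^ 2, γ 0, w) ((h ^ 2, γ 0, w') : State) = ‖w - w'‖ := by
    intro w w'
    simp [dist_eq_norm]
  have hd0 : ∀ {w : Plane} {r : ℝ}, 1 ≤ r → ‖w - γ' 0‖ ≤ r * h ^ 2 →
      dist ((h ^ 2, γ 0, w) : State) (0, γ 0, γ' 0) ≤ r * h ^ 2 := by
    intro w r hr hw
    rw [Prod.dist_eq, Prod.dist_eq, Real.dist_eq, sub_zero, abs_of_nonneg (sq_nonneg h), dist_self,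
      dist_eq_norm]
    exact max_le (by nlinarith [sq_nonneg h]) (max_le (by positivity) hw)
  have hz : ∀ {w : Plane}, ‖w - γ' 0‖ ≤ R * h ^ 2 →
      A * dist ((h ^ 2, γ 0, w) : State) (0, γ 0, γ' 0) ≤ δ := by
    intro w hw
    calc _ ≤ A * (R * h ^ 2) := by gcongr; exact hd0 hR1 hw
      _ ≤ A * (R * h) := by gcongr
      _ ≤ δ := by linarith
  have hsub : ∀ t ∈ Icc 0 h, t ∈ Icc 0 T := fun t ht => ⟨ht.1, ht.2.trans hhT⟩
  have hRc : (κ + A) * (1 + M * A) * h ^ 2 ≤ R * h ^ 2 := by gcongr; linarith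
  have hw0 : ‖γ' 0 - γ' 0‖ ≤ R * h ^ 2 := by
    rw [sub_self, norm_zero]
    positivity
  have shoot : ∀ x₁, ‖x₁ - γ h‖ ≤ κ * h ^ 3 → ∃ w, ‖w - γ' 0‖ ≤ R * h ^ 2 ∧
      ‖x₁ - (Y (h ^ 2, γ 0, w) h).2.1‖ ≤ (M * A) ^ 2 * (κ + A) * h ^ 5 := by
    intro x₁ hx₁
    refine (exists_shooting (F := fun w => (Y (h ^ 2, γ 0, w) h).2.1) (w₀ := γ' 0) (y := x₁)
      (B := M * A) (c := κ + A) h0 hle (by positivity) (by positivity) ?_ ?_).imp fun w hw =>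
        ⟨hw.1.trans hRc, hw.2⟩
    · intro w w' hw hw'
      obtain ⟨hi, hf⟩ := hY _ (hz (hw.trans hRc))
      obtain ⟨hi', hf'⟩ := hY _ (hz (hw'.trans hRc))
      set z : State := (h ^ 2, γ 0, w)
      set z' : State := (h ^ 2, γ 0, w')
      have := norm_le_of_deriv2_le (h := h)
        (φ := fun t => (Y z t).2.1 - (Y z' t).2.1 - t • (w - w'))
        (φ' := fun t => (Y z t).2.2 - (Y z' t).2.2 - (w - w'))
        (φ'' := fun t => (field σ (Y z t)).2.2 - (field σ (Y z' t)).2.2) (C := M * (A * ‖w - w'‖))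
        (fun t ht => ?_) (fun t ht => ?_) ?_ ?_ (fun t ht => ?_) h ⟨h0.le, le_rfl⟩
      · exact this.trans (le_of_eq (by ring))
      · have h1 := (hasDerivAt_state (hf t (hsub t ht)).2.2.1).2.1
        have h2 := (hasDerivAt_state (hf' t (hsub t ht)).2.2.1).2.1
        have h3 := (hasDerivAt_id t).smul_const (w - w')
        rw [one_smul] at h3
        exact (h1.sub h2).sub h3
      · have h1 := (hasDerivAt_state (hf t (hsub t ht)).2.2.1).2.2
        have h2 := (hasDerivAt_state (hf' t (hsub t ht)).2.2.1).2.2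
        exact (h1.sub h2).sub_const _
      · simp [hi, hi', z, z']
      · simp [hi, hi', z, z']
      · have h1 := hlM _ (hf t (hsub t ht)).2.1 _ (hf' t (hsub t ht)).2.1
        refine ((norm_snd_le _).trans (norm_snd_le _)).trans (h1.trans ?_)
        gcongr
        rw [← dist_eq_norm, ← hd]
        exact hYY _ _ t (hsub t ht)
    · obtain ⟨hi, hf⟩ := hY _ (hz hw0)
      set z : State := (h ^ 2, γ 0, γ' 0)
      have := norm_le_of_deriv_le (h := h) (φ := fun t => γ t - (Y z t).2.1)
        (φ' := fun t => γ' t - (Y z t).2.2) (C := A * h ^ 2)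
        (fun t ht => ?_) ?_ (fun t ht => ?_) h ⟨h0.le, le_rfl⟩
      · refine (norm_sub_le_norm_sub_add_norm_sub x₁ (γ h) _).trans ?_
        linarith
      · exact (hγ t).2.1.sub (hasDerivAt_state (hf t (hsub t ht)).2.2.1).2.1
      · simp [hi, z]
      · have h1 := (hf t (hsub t ht)).2.2.2
        have h2 := hd0 (w := γ' 0) le_rfl (by rw [sub_self, norm_zero]; positivity)
        rw [one_mul] at h2
        rw [norm_sub_rev, ← dist_eq_norm]
        refine ((le_max_right _ _).trans (le_max_right _ _)).trans (h1.trans ?_)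
        gcongr
  have flow : ∀ {w : Plane}, ‖w - γ' 0‖ ≤ R * h ^ 2 → ∀ t ∈ Icc 0 T,
      (Y (h ^ 2, γ 0, w) t).1 = h ^ 2 ∧ Y (h ^ 2, γ 0, w) t ∈ K ∧
        HasDerivAt (Y (h ^ 2, γ 0, w)) (field σ (Y (h ^ 2, γ 0, w) t)) t := fun hw t ht =>
    have h1 := (hY _ (hz hw)).2 t ht
    ⟨h1.1, h1.2.1, h1.2.2.1⟩
  have hh : h ∈ Ioo 0 h₁ := ⟨h0, by linarith⟩
  refine ⟨fun x₁ hx₁ => ?_, fun x hx hx0 hx₁ => ?_⟩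
  · obtain ⟨w, hw, hwy⟩ := shoot x₁ hx₁
    obtain ⟨x, hx⟩ := (hsh h hh _ (flow hw) x₁ hwy).1
    rw [(hY _ (hz hw)).1] at hx
    exact ⟨x, hx⟩
  · obtain ⟨w, hw, hwy⟩ := shoot (x 1) hx₁
    have hi := (hY _ (hz hw)).1
    have hcl := (hsh h hh _ (flow hw) (x 1) hwy).2 x hx (by rw [hi]; exact hx0) rfl
    refine ⟨_, _, isMotion_of_field fun t ht =>
      ⟨(flow hw t ht).1, hKU (flow hw t ht).2.1, (flow hw t ht).2.2⟩, ?_, ?_, fun k hk => ?_⟩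
    · rw [hi, sub_self, norm_zero]
      positivity
    · rw [hi]
      exact hw.trans (by gcongr; linarith)
    · exact (hcl k hk).trans (by gcongr; linarith)

/-- Here ℓ² = b²/a is the semilatus rectum and e the eccentricity, the length of the
Laplace-Runge-Lenz vector. -/
theorem precession_coefficient {a b ℓ e : ℝ} (ha : 0 < a) (hb : 0 < b) (hℓ : a * ℓ ^ 2 = b ^ 2)
    (he : a ^ 2 * e ^ 2 = a ^ 2 - b ^ 2) :
    (4 + e ^ 2) / (8 * ℓ ^ 6) = 1 / 24 * (15 * (a ^ 3 / b ^ 6) - 3 * (a / b ^ 4)) := by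
  have h1 : ℓ ^ 6 = b ^ 6 / a ^ 3 := by
    rw [eq_div_iff (by positivity)]
    linear_combination (a ^ 2 * ℓ ^ 4 + a * ℓ ^ 2 * b ^ 2 + b ^ 4) * hℓ
  have h2 : e ^ 2 = (a ^ 2 - b ^ 2) / a ^ 2 := by
    rw [eq_div_iff (by positivity)]
    linarith
  rw [h1, h2]
  field_simp
  ring

end Kepler

end

/-! ### The two methods compared. -/

theorem mainTheorem2 (γ γ' : ℝ → Kepler.Plane) (a b T : ℝ)
    (hγ : Kepler.IsMotion Kepler.lagrangian Set.univ γ γ')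
    (hab : ∃ F : Kepler.Plane, Kepler.IsEllipse (Set.range γ) 0 F a b)
    (hecc : b < a)
    (hT : Kepler.IsPeriod γ T) :
    ∃ ρ ρSV : ℝ,
      Kepler.HasNumericalPrecessionRate Kepler.midpointForce Kepler.midpointLagrangian γ γ' T ρ ∧
      ρ = Real.sign (Kepler.angularMomentum (γ 0) (γ' 0)) * (Real.pi / 12) *
        (15 * (a ^ 3 / b ^ 6) - 3 * (a / b ^ 4)) ∧
      Kepler.HasNumericalPrecessionRate Kepler.verletForce Kepler.verletLagrangian γ γ' T ρSV ∧
      ρ = -2 * ρSV := by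
  obtain ⟨F, hF⟩ := hab
  obtain ⟨ha, hb, -, -⟩ := id hF
  have hk := hγ.isKepler
  obtain ⟨hℓ, he⟩ := hk.elliptic hF hecc
  have hℓ0 : Kepler.angularMomentum (γ 0) (γ' 0) ≠ 0 := fun h => by
    rw [h] at hℓ
    have : 0 < b ^ 2 := by positivity
    linarith
  have he0 : Kepler.lrl (γ 0) (γ' 0) ≠ 0 := fun h => by
    rw [h, norm_zero] at he
    nlinarith
  have hT0 : 0 < T := hT.1.1
  have hmp : Kepler.midpointLagrangian = Kepler.modLagrangian 1 :=
    funext Kepler.midpointLagrangian_eq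
  have hsv : Kepler.verletLagrangian = Kepler.modLagrangian (-2) :=
    funext Kepler.verletLagrangian_eq
  -- The two rates differ only in the factor 1 + σ, which is 2 here and -1 for Störmer-Verlet.
  have h1 := hk.hasPrecessionRate hℓ0 he0 hT 1
  have h2 := hk.hasPrecessionRate hℓ0 he0 hT (-2)
  rw [hmp, hsv]
  refine ⟨_, _, ⟨?_, h1⟩, ?_, ⟨?_, h2⟩, ?_⟩
  · exact hk.isModifiedLagrangian he0 hT0 Kepler.midpoint_isConsistent fun ρ hρ =>
      ⟨_, by positivity, Kepler.midpointForce_bound hρ⟩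
  · rw [mul_div_assoc, Kepler.precession_coefficient ha hb hℓ he]
    ring
  · exact hk.isModifiedLagrangian he0 hT0 Kepler.verlet_isConsistent fun ρ hρ =>
      ⟨_, by positivity, Kepler.verletForce_bound hρ⟩
  · ring
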